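/- Let $d\ge 3$ and let $r\ge 0$, $z\in\mathbb R$ denote the cylindrical coordinates on $\mathbb R^d$ ($z$ is the coordinate along a fixed coordinate axis, $r$ the distance to that axis), with unit vectors $e^r,e^z$. For every integer $q\ge d$ and all real numbers $M,K,S$ there is a constant $C>0$, depending only on $d,q,M,K,S$, such that the following holds. Let $s>1+d/2$, $0<T\le\infty$, and let $u\in C([0,T);H^s(\mathbb R^d))\cap C^1([0,T);H^{s-1}(\mathbb R^d))$ be a solution of the incompressible Euler equations $$\partial_t u+(u\cdot\nabla)u+\nabla p=0,\qquad \nabla\cdot u=0\qquad\text{on }[0,T)\times\mathbb R^d,$$ which is axisymmetric without swirl, $u=u^r(t,r,z)e^r+u^z(t,r,z)e^z$, and let $\omega=\partial_zu^r-\partial_ru^z$ be its scalar vorticity. Suppose that the initial vorticity $\omega_0=\omega(0,\cdot)$ is non-negative and compactly supported in $\mathbb R^d$, that $$\|r\,\omega_0\|_{L^1(\mathbb R^d)}\le M,\qquad \|r^{-(d-2)}\omega_0\|_{L^\infty(\mathbb R^d)}\le K,$$ and that $r\le S$ at every point with $\omega_0(r,z)\ne0$. For $r\ge0$ put $$m_r(t)=\iint_{\{\bar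 r\ge r\}}\omega(t,\bar r,\bar z)\,d\bar z\,d\bar r .$$ Then for every $t\in[0,T)$ and every $r$ with $$r\ \ge\ C\,[(1+t)\ln(e+t)]^{1/(d+1)},$$ the vorticity $\omega(t)$ is integrable over $\{\bar r\ge r\}$ and $m_r(t)\le r^{-q}$. -/

import Mathlib

open MeasureTheory Set
open scoped SchwartzMap ENNReal

noncomputable section

namespace AxisymEuler

/-- The space `ℝ^d` with its Euclidean structure. -/
abbrev Space (d : ℕ) : Type := EuclideanSpace ℝ (Fin d)

/-- The complexification of the space of values, needed for the Fourier transform. -/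
abbrev CSpace (d : ℕ) : Type := EuclideanSpace ℂ (Fin d)

/-- A real vector regarded as a complex vector. -/
def complexify {d : ℕ} (v : Space d) : CSpace d := WithLp.toLp 2 fun i => (v i : ℂ)

/-! ### Cylindrical coordinates; the symmetry axis is the coordinate axis of index `0` -/

section Cylindrical

variable {d : ℕ} [NeZero d]

/-- The unit vector `e^z` along the axis of symmetry. -/
def eZ : Space d := EuclideanSpace.single 0 1

/-- The axial coordinate `z`. -/
def ax (x : Space d) : ℝ := x 0

/-- The component of `x` orthogonal to the axis of symmetry. -/
def horiz (x : Space d) : Space d := x - ax x • eZ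

/-- The radial coordinate `r`, i.e. the distance to the axis of symmetry. -/
def rad (x : Space d) : ℝ := ‖horiz x‖

/-- The radial unit vector `e^r` (it is `0` on the axis, where `e^r` is not defined). -/
def eR (x : Space d) : Space d := (rad x)⁻¹ • horiz x

/-- The vector field `v` is axisymmetric without swirl, with radial and axial components `vr`, `vz`:
`v = v^r(r,z) e^r + v^z(r,z) e^z`. -/
def IsAxisymNoSwirl (v : Space d → Space d) (vr vz : ℝ → ℝ → ℝ) : Prop :=
  ∀ x, v x = vr (rad x) (ax x) • eR x + vz (rad x) (ax x) • eZ

/-- A function of `(r,z)`, `r > 0`, regarded as a function on `ℝ^d`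
(with the value `0` on the axis, which is a null set). -/
def lift (f : ℝ → ℝ → ℝ) (x : Space d) : ℝ := if 0 < rad x then f (rad x) (ax x) else 0

end Cylindrical

/-- The scalar vorticity `ω = ∂_z v^r - ∂_r v^z` (used only at points with `r > 0`). -/
def vorticity (vr vz : ℝ → ℝ → ℝ) (r z : ℝ) : ℝ :=
  deriv (fun ζ => vr r ζ) z - deriv (fun ρ => vz ρ z) r

/-- The region `A_r = {(r', z') : r' ≥ 0, r' ≥ r}` of the half plane. -/
def outer (r : ℝ) : Set (ℝ × ℝ) := {y | 0 ≤ y.1 ∧ r ≤ y.1}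

/-- The mass `m_r = ∬_{A_r} ω dz dr` of `ω` in `A_r`. -/
def mass (ω : ℝ → ℝ → ℝ) (r : ℝ) : ℝ := ∫ y in outer r, ω y.1 y.2

/-- The time interval `[0, T)`, where `T` may be `∞`. -/
def lifespan (T : EReal) : Set ℝ := {t | 0 ≤ t ∧ (t : EReal) < T}

/-- `v ∈ C^k(I; H^s(ℝ^d))`. The map `v ↦ (1 - Δ)^{s/2} v` (up to the normalisation of the Fourier
transform, which only changes the norm of `H^s` to an equivalent one) identifies `H^s` with `L²`,
so this says that `t ↦ (1 - Δ)^{s/2} v(t)` is a `C^k` curve in `L²`. -/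
def IsCkSobolev {d : ℕ} (k : ℕ) (s : ℝ) (I : Set ℝ) (v : ℝ → Space d → Space d) : Prop :=
  ∃ W : ℝ → Lp (CSpace d) 2 (volume : Measure (Space d)),
    ContDiffOn ℝ k W I ∧
    ∀ t ∈ I, ∃ h : MemLp (fun x => complexify (v t x)) 2 (volume : Measure (Space d)),
      TemperedDistribution.besselPotential (Space d) (CSpace d) s
        (h.toLp _ : Lp (CSpace d) 2 (volume : Measure (Space d))) = W t

/-- `u ∈ C([0,T); H^s) ∩ C^1([0,T); H^{s-1})` is a velocity field solving the incompressible Euler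
equations `∂_t u + (u · ∇) u + ∇ p = 0`, `∇ · u = 0` on `[0,T) × ℝ^d`. For `s > 1 + d/2` all terms
are continuous functions, and the equations hold pointwise for the `C^1` representative. -/
structure IsEulerSolution {d : ℕ} (s : ℝ) (T : EReal) (u : ℝ → Space d → Space d)
    (p : ℝ → Space d → ℝ) : Prop where
  regularity : IsCkSobolev 0 s (lifespan T) u
  regularity_deriv : IsCkSobolev 1 (s - 1) (lifespan T) u
  contDiff : ∀ t ∈ lifespan T, ContDiff ℝ 1 (u t)
  pressure_differentiable : ∀ t ∈ lifespan T, Differentiable ℝ (p t)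
  momentum : ∀ t ∈ lifespan T, ∀ x,
    HasDerivWithinAt (fun τ => u τ x) (-(fderiv ℝ (u t) x (u t x)) - gradient (p t) x)
      (lifespan T) t
  divergence_free : ∀ t ∈ lifespan T, ∀ x,
    ∑ i, fderiv ℝ (u t) x (EuclideanSpace.single i 1) i = 0

end AxisymEuler

end

/-!
The radial velocity of an axisymmetric flow without swirl is recovered from the vorticity by a
kernel which is antisymmetric in its two arguments. Testing the vorticity equation with a radial
weight `g` therefore gives a bilinear form in which only differences of `f = r^{-(d-2)} g'` occur,
and vorticity is transported outward across a shell far from the axis only slowly. The decay of the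
mass far from the axis comes from iterating this observation over many thin shells.

*The vorticity in the meridian plane.* Sobolev embedding bounds the velocity and its spatial and
temporal Lipschitz constants on compact time intervals (`IsEulerSolution.exists_uniformControl`).
Restricting the velocity to a meridian plane and integrating the momentum equation against
perpendicular gradients removes the pressure and gives the weak equation `∂_t ω + div (ω v) = 0` in
the `(r,z)`-plane (`PlanarFlow.hasDerivAt_integral_curl`). Tested with a bump moving along a
trajectory, it shows that the vorticity keeps its sign along trajectories
(`PlanarFlow.exists_origin`); hence `ω(t) ≥ 0`, and `ω(t)` stays supported in a bounded set.

*Evolution of moments.* For a weight `g` with `g' = r^{d-2} f`, the derivative of `∬ g ω` is the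
integral of `f ω u^r` over `ℝ^d`, up to a constant (`ControlledFlow.hasDerivAt_moment`). The
Biot–Savart law enters only through this integral: the divergence of the field `biotSavartField`
has integral zero, which identifies a mollification of `u^r` with the velocity induced by `ω`
through the regularised kernel `ker` (`inducedVel_eq_integral`), and the mollification is removed in
the limit (`tendsto_transport`). For constant `f` the antisymmetry of `ker` makes the rate vanish,
so that the impulse `∬ r^{d-1} ω` is conserved (`ControlledFlow.impulse_eq`); it is bounded by
`‖r ω₀‖_{L¹}`.

*The rate for a shell.* Let `f` be `l`-Lipschitz and supported in a shell `ρ' ≤ r ≤ ρ` with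
`ρ' ≥ ρ/2`. Then the rate is at most `C l / ρ` times the impulse times the mass beyond `ρ'`
(`exists_abs_transport_le`). Rings with `r ≤ ρ/4` act on the shell like dipoles, because the kernel
nearly cancels under the half turn about the axis (`abs_inducedVel_inner_le`). For the remaining
rings, the difference of the values of `f` compensates the singularity of the kernel: what is left
is `D² |x-y|^{-d}`, `D` being the distance in the meridian plane, and its angular average is bounded
by a multiple of `(r r')^{-(d-2)/2}` (`lintegral_cyl_kernel_le`, `exists_abs_outer_le`).

*Iteration.* Taking for `f` a tent over `[ρ - h, ρ]` of slope of order `h^{-2} ρ^{-(d-2)}`, the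
weight `g` vanishes up to `ρ - h` and is at least `1` beyond `ρ`. A bound `K t^k` for the mass beyond
`ρ - h` thus improves to `C I h^{-2} ρ^{-(d-1)} K t^{k+1} / (k+1)` beyond `ρ`, where `I` is the
impulse (`exists_tail_step`). With `n` shells of width `r/(2n)` the product of the factors is
`(C' I n t / r^{d+1})^n`, since `n!` cancels half of the `n^{2n}` (`exists_tail_le`). For
`n = ⌈q ln r⌉` the base is at most `e^{-1}` as soon as `r^{d+1}` exceeds a
large multiple of `(1+t) ln(e+t)`, and the bound becomes `r^{-q}` (`mul_log_le`, `pow_ceil_le`).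
-/

noncomputable section
namespace AxisymEuler
open scoped FourierTransform ContDiff

/-! ### Sobolev embedding -/

theorem memLp_bessel_weight {d : ℕ} {σ : ℝ} (hσ : (d : ℝ) / 2 < σ) :
    MemLp (fun x : Space d ↦ (1 + ‖x‖ ^ 2) ^ (-σ / 2)) 2 := by
  constructor
  · have : (fun x : Space d ↦ (1 + ‖x‖ ^ 2) ^ (-σ / 2)).HasTemperateGrowth := by
      fun_prop
    exact this.1.continuous.aestronglyMeasurable
  · rw [eLpNorm_lt_top_iff_lintegral_rpow_enorm_lt_top (by norm_num) (by norm_num)]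
    suffices h : ∫⁻ a : Space d, ENNReal.ofReal ‖(1 + ‖a‖ ^ 2) ^ (-σ)‖ < ⊤ from by
      norm_cast
      simp_rw [ofReal_norm] at h
      simp_rw [← enorm_pow]
      convert h
      rw [← Real.rpow_mul_natCast (by positivity)]
      simp
    have hs : (Module.finrank ℝ (Space d) : ℝ) < 2 * σ := by simp; linarith
    apply ((integrable_rpow_neg_one_add_norm_sq hs).congr _).lintegral_lt_top
    filter_upwards with x
    rw [Real.norm_eq_abs, abs_eq_self.mpr (by positivity)]
    congr
    ring

/-- A function whose Bessel potential of order `σ > d / 2` is in `L²` is the inverse Fourier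
integral of an `L¹` function, namely `(1 + |ξ|²)^{-σ/2}` times the transform of the potential. -/
theorem exists_fourierInv_of_bessel {d : ℕ} {σ : ℝ} (hσ : (d : ℝ) / 2 < σ)
    {f : Space d → CSpace d} (hf : Continuous f) (h : MemLp f 2 volume)
    (w : Lp (CSpace d) 2 (volume : Measure (Space d)))
    (hw : TemperedDistribution.besselPotential (Space d) (CSpace d) σ
        (h.toLp _ : Lp (CSpace d) 2 (volume : Measure (Space d))) = w) :
    ∃ v : Space d → CSpace d, Integrable v ∧
      (v =ᵐ[volume] fun ξ => (((1 + ‖ξ‖ ^ 2) ^ (-σ / 2) : ℝ) : ℂ) • (𝓕 w : Lp (CSpace d) 2 _) ξ) ∧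
      ∀ x, f x = 𝓕⁻ v x := by
  have hm : MemLp (fun x : Space d ↦ (((1 + ‖x‖ ^ 2) ^ (-σ / 2) : ℝ) : ℂ)) 2 :=
    (memLp_bessel_weight hσ).ofReal
  set fL : Lp (CSpace d) 2 (volume : Measure (Space d)) := h.toLp _ with hfL
  set V : Lp (CSpace d) 1 (volume : Measure (Space d)) :=
    (hm.toLp _ : Lp ℂ 2 volume) • (𝓕 w : Lp (CSpace d) 2 _) with hV
  have hVd : 𝓕 (fL : 𝓢'(Space d, CSpace d)) = (V : 𝓢'(Space d, CSpace d)) := by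
    rw [hV, MeasureTheory.Lp.toTemperedDistribution_smul_eq (by fun_prop) hm,
      ← MeasureTheory.Lp.fourier_toTemperedDistribution_eq, ← hw,
      TemperedDistribution.fourier_besselPotential_eq_smulLeftCLM_fourier_apply,
      TemperedDistribution.smulLeftCLM_smulLeftCLM_apply (by fun_prop) (by fun_prop)]
    convert! (TemperedDistribution.smulLeftCLM_const 1 (𝓕 (fL : 𝓢'(Space d, CSpace d)))).symm
      using 1
    · simp
    · congr
      ext x
      rw [Pi.mul_apply]
      norm_cast
      rw [← Real.rpow_add (by positivity)]
      ring_nf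
      simp
  have hVae : (V : Space d → CSpace d) =ᵐ[volume]
      fun ξ => (((1 + ‖ξ‖ ^ 2) ^ (-σ / 2) : ℝ) : ℂ) • (𝓕 w : Lp (CSpace d) 2 _) ξ := by
    filter_upwards [Lp.coeFn_lpSMul (r := 1) (hm.toLp _) (𝓕 w : Lp (CSpace d) 2 _),
      hm.coeFn_toLp] with x h1 h2
    rw [hV, h1]
    simp only [Pi.smul_apply', h2]
  have hVi : Integrable (V : Space d → CSpace d) := L1.integrable_coeFn V
  refine ⟨V, hVi, hVae, ?_⟩
  have hcont : Continuous (𝓕⁻ (V : Space d → CSpace d)) := by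
    have := VectorFourier.fourierIntegral_continuous (μ := (volume : Measure (Space d)))
      Real.continuous_fourierChar (L := -innerₗ (Space d))
      (continuous_inner (𝕜 := ℝ) (E := Space d)).neg hVi
    exact this
  have hae : f =ᵐ[volume] 𝓕⁻ (V : Space d → CSpace d) := by
    apply ae_eq_of_integral_contDiff_smul_eq hf.locallyIntegrable hcont.locallyIntegrable
    intro g g_smooth g_cpt
    have hg₁ : HasCompactSupport (Complex.ofRealCLM ∘ g) := g_cpt.comp_left rfl
    have hg₂ : ContDiff ℝ ∞ (Complex.ofRealCLM ∘ g) := by fun_prop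
    set φ := hg₁.toSchwartzMap hg₂ with hφ
    have h1 : (fL : 𝓢'(Space d, CSpace d)) φ = ∫ x, g x • f x := by
      rw [MeasureTheory.Lp.toTemperedDistribution_apply]
      apply integral_congr_ae
      filter_upwards [h.coeFn_toLp] with x hx
      rw [hfL, hx]
      simp [hφ]
    have h2 : (fL : 𝓢'(Space d, CSpace d)) φ = (V : 𝓢'(Space d, CSpace d)) (𝓕⁻ φ) := by
      rw [← hVd, TemperedDistribution.fourier_apply]
      simp
    rw [← h1, h2, MeasureTheory.Lp.toTemperedDistribution_apply]
    have := VectorFourier.integral_fourierIntegral_smul_eq_flip (𝕜 := ℝ)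
      (μ := (volume : Measure (Space d))) (ν := (volume : Measure (Space d)))
      Real.continuous_fourierChar (L := -innerₗ (Space d)) 
      (continuous_inner (𝕜 := ℝ) (E := Space d)).neg
      (f := (φ : Space d → ℂ)) (g := V) φ.integrable hVi
    have e1 : ∀ ξ, VectorFourier.fourierIntegral Real.fourierChar volume (-innerₗ (Space d))
        (φ : Space d → ℂ) ξ = (𝓕⁻ φ) ξ := fun ξ => by
      rw [SchwartzMap.fourierInv_coe]; rfl
    have e2 : (-innerₗ (Space d)).flip = -innerₗ (Space d) := by
      ext x y
      simp [real_inner_comm]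
    simp only [e1, e2] at this
    rw [this]
    refine integral_congr_ae (Filter.Eventually.of_forall fun x => ?_)
    simp [hφ]
    rfl
  exact fun x => congrFun ((Continuous.ae_eq_iff_eq volume hf hcont).1 hae) x


theorem norm_complexify {d : ℕ} (v : Space d) : ‖complexify v‖ = ‖v‖ := by
  simp [complexify, EuclideanSpace.norm_eq]

theorem complexify_sub {d : ℕ} (v w : Space d) :
    complexify (v - w) = complexify v - complexify w := by
  ext i; simp [complexify]

theorem continuous_complexify {d : ℕ} : Continuous (complexify (d := d)) := by
  unfold complexify
  fun_prop

theorem norm_fourierLp {d : ℕ} (w : Lp (CSpace d) 2 (volume : Measure (Space d))) :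
    ‖(𝓕 w : Lp (CSpace d) 2 (volume : Measure (Space d)))‖ = ‖w‖ := by
  exact MeasureTheory.Lp.norm_fourier_eq w

/-- Cauchy-Schwarz for a square integrable weight against an `L²` field. -/
theorem integral_weight_norm_le {d : ℕ} {m : Space d → ℝ} (hm : MemLp m 2 volume)
    (hm0 : ∀ x, 0 ≤ m x) (W : Lp (CSpace d) 2 (volume : Measure (Space d))) :
    Integrable (fun ξ => m ξ * ‖W ξ‖) ∧
    ∫ ξ, m ξ * ‖W ξ‖ ≤ (eLpNorm m 2 volume).toReal * ‖W‖ := by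
  have hW := Lp.memLp W
  have hi : Integrable (fun ξ => m ξ * ‖W ξ‖) := hm.integrable_mul hW.norm
  refine ⟨hi, ?_⟩
  have h2 : (2 : ℝ≥0∞) = ENNReal.ofReal 2 := by norm_num
  have := integral_mul_le_Lp_mul_Lq_of_nonneg (μ := (volume : Measure (Space d)))
    Real.HolderConjugate.two_two (f := m) (g := fun ξ => ‖W ξ‖)
    (Filter.Eventually.of_forall hm0) (Filter.Eventually.of_forall fun ξ => norm_nonneg _)
    (h2 ▸ hm) (h2 ▸ hW.norm)
  refine this.trans (le_of_eq ?_)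
  rw [Lp.norm_def, hm.eLpNorm_eq_integral_rpow_norm (by norm_num) (by norm_num),
    hW.eLpNorm_eq_integral_rpow_norm (by norm_num) (by norm_num),
    ENNReal.toReal_ofReal (by positivity), ENNReal.toReal_ofReal (by positivity)]
  simp

/-- The Sobolev embedding `H^σ ⊂ L^∞`, `σ > d / 2`. -/
theorem sobolev_sup {d : ℕ} {σ : ℝ} (hσ : (d : ℝ) / 2 < σ) :
    ∃ C : ℝ, 0 ≤ C ∧ ∀ (f : Space d → Space d), Continuous f →
      ∀ (h : MemLp (fun x => complexify (f x)) 2 (volume : Measure (Space d)))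
        (w : Lp (CSpace d) 2 (volume : Measure (Space d))),
        TemperedDistribution.besselPotential (Space d) (CSpace d) σ
          (h.toLp _ : Lp (CSpace d) 2 (volume : Measure (Space d))) = w →
        ∀ x, ‖f x‖ ≤ C * ‖w‖ := by
  refine ⟨(eLpNorm (fun x : Space d ↦ (1 + ‖x‖ ^ 2) ^ (-σ / 2)) 2 volume).toReal,
    ENNReal.toReal_nonneg, fun f hf h w hw x => ?_⟩
  obtain ⟨v, hvi, hv, hfv⟩ :=
    exists_fourierInv_of_bessel hσ (continuous_complexify.comp hf) h w hw
  obtain ⟨hi, hle⟩ := integral_weight_norm_le (memLp_bessel_weight hσ)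
    (fun x => by positivity) (𝓕 w : Lp (CSpace d) 2 _)
  rw [norm_fourierLp] at hle
  rw [← norm_complexify, show complexify (f x) = 𝓕⁻ v x from hfv x, Real.fourierInv_eq]
  refine (norm_integral_le_integral_norm _).trans (le_trans (le_of_eq ?_) hle)
  refine integral_congr_ae ?_
  filter_upwards [hv] with ξ hξ
  rw [Circle.norm_smul, hξ, norm_smul, Complex.norm_real, Real.norm_of_nonneg (by positivity)]

theorem norm_fourierChar_sub_le (a b : ℝ) :
    ‖(Real.fourierChar a : ℂ) - Real.fourierChar b‖ ≤ 2 * Real.pi * |a - b| := by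
  have h1 : (Real.fourierChar a : ℂ) = Real.fourierChar b * Real.fourierChar (a - b) := by
    rw [← Circle.coe_mul, ← AddChar.map_add_eq_mul]
    congr 2
    ring
  rw [h1, ← mul_sub_one, norm_mul, Circle.norm_coe, one_mul, Real.fourierChar_apply]
  have := Real.norm_exp_I_mul_ofReal_sub_one_le (x := 2 * Real.pi * (a - b))
  rw [mul_comm (Complex.I)] at this
  refine this.trans (le_of_eq ?_)
  rw [Real.norm_eq_abs, abs_mul, abs_of_pos (by positivity)]

/-- The Sobolev embedding `H^σ ⊂ W^{1,∞}`, `σ > 1 + d / 2`. -/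
theorem sobolev_lipschitz {d : ℕ} {σ : ℝ} (hσ : 1 + (d : ℝ) / 2 < σ) :
    ∃ C : ℝ, 0 ≤ C ∧ ∀ (f : Space d → Space d), Continuous f →
      ∀ (h : MemLp (fun x => complexify (f x)) 2 (volume : Measure (Space d)))
        (w : Lp (CSpace d) 2 (volume : Measure (Space d))),
        TemperedDistribution.besselPotential (Space d) (CSpace d) σ
          (h.toLp _ : Lp (CSpace d) 2 (volume : Measure (Space d))) = w →
        ∀ x y, ‖f x - f y‖ ≤ C * ‖w‖ * ‖x - y‖ := by
  have hσ' : (d : ℝ) / 2 < σ - 1 := by linarith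
  refine ⟨2 * Real.pi * 
    (eLpNorm (fun x : Space d ↦ (1 + ‖x‖ ^ 2) ^ (-(σ - 1) / 2)) 2 volume).toReal, by positivity,
    fun f hf h w hw x y => ?_⟩
  obtain ⟨v, hvi, hv, hfv⟩ :=
    exists_fourierInv_of_bessel (by linarith) (continuous_complexify.comp hf) h w hw
  obtain ⟨hi, hle⟩ := integral_weight_norm_le (memLp_bessel_weight hσ')
    (fun x => by positivity) (𝓕 w : Lp (CSpace d) 2 _)
  rw [norm_fourierLp] at hle
  have hint : ∀ x : Space d, Integrable (fun ξ => Real.fourierChar (inner ℝ ξ x) • v ξ) := by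
    intro x
    have := (VectorFourier.fourierIntegral_convergent_iff (μ := (volume : Measure (Space d)))
      Real.continuous_fourierChar (L := -innerₗ (Space d))
      (continuous_inner (𝕜 := ℝ) (E := Space d)).neg (f := v) x).2 hvi
    simpa using! this
  have hfv' : ∀ x, complexify (f x) = ∫ ξ, Real.fourierChar (inner ℝ ξ x) • v ξ := fun x => by
    rw [show complexify (f x) = 𝓕⁻ v x from hfv x, Real.fourierInv_eq]
  rw [← norm_complexify, complexify_sub, hfv', hfv', ← integral_sub (hint x) (hint y)]
  calc _ ≤ ∫ ξ, (2 * Real.pi * ‖x - y‖) * ((1 + ‖ξ‖ ^ 2) ^ (-(σ - 1) / 2) *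
        ‖(𝓕 w : Lp (CSpace d) 2 volume) ξ‖) := by
        refine norm_integral_le_of_norm_le (hi.const_mul _) ?_
        filter_upwards [hv] with ξ hξ
        rw [Circle.smul_def, Circle.smul_def, ← sub_smul, norm_smul, hξ, norm_smul,
          Complex.norm_real, Real.norm_of_nonneg (by positivity)]
        have h1 := norm_fourierChar_sub_le (inner ℝ ξ x) (inner ℝ ξ y)
        rw [← inner_sub_right] at h1
        have h2 := abs_real_inner_le_norm ξ (x - y)
        have h3 : ‖ξ‖ ≤ (1 + ‖ξ‖ ^ 2) ^ (1 / 2 : ℝ) := by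
          rw [← Real.sqrt_eq_rpow]
          exact Real.le_sqrt_of_sq_le (by linarith)
        have h4 : (1 + ‖ξ‖ ^ 2) ^ (-(σ - 1) / 2) =
            (1 + ‖ξ‖ ^ 2) ^ (1 / 2 : ℝ) * (1 + ‖ξ‖ ^ 2) ^ (-σ / 2) := by
          rw [← Real.rpow_add (by positivity)]
          congr 1
          ring
        rw [h4]
        have h5 : ‖(Real.fourierChar (inner ℝ ξ x) : ℂ) - Real.fourierChar (inner ℝ ξ y)‖ ≤
            2 * Real.pi * ‖x - y‖ * (1 + ‖ξ‖ ^ 2) ^ (1 / 2 : ℝ) := by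
          refine h1.trans ?_
          have := mul_le_mul_of_nonneg_right h3 (norm_nonneg (x - y))
          nlinarith [Real.pi_pos]
        refine (mul_le_mul_of_nonneg_right h5 (by positivity)).trans (le_of_eq ?_)
        ring
    _ ≤ _ := by
        rw [integral_const_mul]
        have := mul_le_mul_of_nonneg_left hle (show 0 ≤ 2 * Real.pi * ‖x - y‖ by positivity)
        refine this.trans (le_of_eq ?_)
        ring

end AxisymEuler
end

noncomputable section
namespace AxisymEuler

/-! ### Uniform bounds on compact time intervals -/

theorem Icc_subset_lifespan {T : EReal} {t₁ : ℝ} (h : t₁ ∈ lifespan T) :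
    Icc 0 t₁ ⊆ lifespan T := fun _ ht =>
  ⟨ht.1, lt_of_le_of_lt (EReal.coe_le_coe_iff.2 ht.2) h.2⟩

/-- Differences of `H^σ` functions: the potential of `f - g` is the difference of potentials. -/
theorem bessel_sub {d : ℕ} {σ : ℝ} {f g : Space d → Space d}
    (hf : MemLp (fun x => complexify (f x)) 2 (volume : Measure (Space d)))
    (hg : MemLp (fun x => complexify (g x)) 2 (volume : Measure (Space d)))
    {wf wg : Lp (CSpace d) 2 (volume : Measure (Space d))}
    (hwf : TemperedDistribution.besselPotential (Space d) (CSpace d) σ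
        (hf.toLp _ : Lp (CSpace d) 2 (volume : Measure (Space d))) = wf)
    (hwg : TemperedDistribution.besselPotential (Space d) (CSpace d) σ
        (hg.toLp _ : Lp (CSpace d) 2 (volume : Measure (Space d))) = wg) :
    ∃ h : MemLp (fun x => complexify (f x - g x)) 2 (volume : Measure (Space d)),
      TemperedDistribution.besselPotential (Space d) (CSpace d) σ
        (h.toLp _ : Lp (CSpace d) 2 (volume : Measure (Space d))) =
        (wf - wg : Lp (CSpace d) 2 (volume : Measure (Space d))) := by
  have h : MemLp (fun x => complexify (f x - g x)) 2 (volume : Measure (Space d)) := by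
    simpa only [complexify_sub] using! hf.sub hg
  have e : (h.toLp _ : Lp (CSpace d) 2 (volume : Measure (Space d))) =
      hf.toLp _ - hg.toLp _ := by
    rw [← MemLp.toLp_sub]
    congr 1
    ext1 x
    simp [complexify_sub]
  refine ⟨h, ?_⟩
  rw [e, ← Lp.toTemperedDistributionCLM_apply, map_sub, map_sub,
    Lp.toTemperedDistributionCLM_apply, Lp.toTemperedDistributionCLM_apply, hwf, hwg,
    ← Lp.toTemperedDistributionCLM_apply (wf - wg), map_sub]
  rfl

/-- Uniform control of a time-dependent field on a compact time interval: the field is bounded,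
Lipschitz in space and in time, and its space derivative is continuous in time, uniformly in
space. -/
structure UniformControl {d : ℕ} (t₁ L : ℝ) (u : ℝ → Space d → Space d) : Prop where
  nonneg : 0 ≤ L
  contDiff : ∀ t ∈ Icc 0 t₁, ContDiff ℝ 1 (u t)
  bound : ∀ t ∈ Icc 0 t₁, ∀ x, ‖u t x‖ ≤ L
  lip_space : ∀ t ∈ Icc 0 t₁, ∀ x y, ‖u t x - u t y‖ ≤ L * ‖x - y‖
  lip_time : ∀ t ∈ Icc 0 t₁, ∀ s ∈ Icc 0 t₁, ∀ x, ‖u t x - u s x‖ ≤ L * |t - s|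
  fderiv_time : ∀ s ∈ Icc 0 t₁, ∀ ε > 0, ∃ δ > 0, ∀ t ∈ Icc 0 t₁, |t - s| < δ →
    ∀ x, ‖fderiv ℝ (u t) x - fderiv ℝ (u s) x‖ ≤ ε

/-- A `C¹` curve on a compact interval is Lipschitz. -/
theorem exists_lipschitz_Icc {E : Type*} [NormedAddCommGroup E] [NormedSpace ℝ E] {t₁ : ℝ}
    {W : ℝ → E} (hW : ContDiffOn ℝ 1 W (Icc 0 t₁)) :
    ∃ L : ℝ, 0 ≤ L ∧ ∀ t ∈ Icc 0 t₁, ∀ s ∈ Icc 0 t₁, ‖W t - W s‖ ≤ L * |t - s| := by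
  rcases le_or_gt t₁ 0 with h | h
  · refine ⟨0, le_rfl, fun t ht s hs => ?_⟩
    have h1 : t = s := by linarith [ht.1, ht.2, hs.1, hs.2]
    simp [h1]
  · have hc := hW.continuousOn_derivWithin (uniqueDiffOn_Icc h) le_rfl
    obtain ⟨L, hL⟩ := isCompact_Icc.exists_bound_of_continuousOn hc
    refine ⟨max L 0, le_max_right _ _, fun t ht s hs => ?_⟩
    have := (convex_Icc (0 : ℝ) t₁).norm_image_sub_le_of_norm_derivWithin_le
      (hW.differentiableOn one_ne_zero) (fun x hx => (hL x hx).trans (le_max_left L 0)) hs ht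
    simpa using! this

/-- The `H^s` regularity with `s > 1 + d/2`, through Sobolev embedding, controls the velocity and its
Lipschitz constants in space and time uniformly on compact time intervals. -/
theorem IsEulerSolution.exists_uniformControl {d : ℕ} {s : ℝ} {T : EReal}
    {u : ℝ → Space d → Space d} {p : ℝ → Space d → ℝ} (hs : 1 + (d : ℝ) / 2 < s)
    (hu : IsEulerSolution s T u p) {t₁ : ℝ} (ht₁ : t₁ ∈ lifespan T) :
    ∃ L, UniformControl t₁ L u := by
  have hsub := Icc_subset_lifespan ht₁
  obtain ⟨W, hWc, hW⟩ := hu.regularity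
  obtain ⟨V, hVc, hV⟩ := hu.regularity_deriv
  obtain ⟨C₀, hC₀, H₀⟩ := sobolev_sup (d := d) (σ := s) (by linarith)
  obtain ⟨C₁, hC₁, H₁⟩ := sobolev_lipschitz (d := d) (σ := s) hs
  obtain ⟨C₂, hC₂, H₂⟩ := sobolev_sup (d := d) (σ := s - 1) (by linarith)
  have hWc' : ContinuousOn W (Icc 0 t₁) := hWc.continuousOn.mono hsub
  obtain ⟨B, hB⟩ := isCompact_Icc.exists_bound_of_continuousOn hWc'
  have hVc' : ContDiffOn ℝ 1 V (Icc 0 t₁) := by exact_mod_cast hVc.mono hsub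
  obtain ⟨LV, hLV, hLip⟩ := exists_lipschitz_Icc hVc'
  have hcd : ∀ t ∈ Icc 0 t₁, ContDiff ℝ 1 (u t) := fun t ht => hu.contDiff t (hsub ht)
  set L := C₀ * max B 0 + C₁ * max B 0 + C₂ * LV with hL
  have p1 : 0 ≤ C₀ * max B 0 := mul_nonneg hC₀ (le_max_right _ _)
  have p2 : 0 ≤ C₁ * max B 0 := mul_nonneg hC₁ (le_max_right _ _)
  have p3 : 0 ≤ C₂ * LV := mul_nonneg hC₂ hLV
  refine ⟨L, ⟨by positivity, hcd, fun t ht x => ?_, fun t ht x y => ?_, fun t ht τ hτ x => ?_,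
    fun τ hτ ε hε => ?_⟩⟩
  · obtain ⟨h, hw⟩ := hW t (hsub ht)
    have h1 := H₀ (u t) (hcd t ht).continuous h (W t) hw x
    have h2 := mul_le_mul_of_nonneg_left ((hB t ht).trans (le_max_left B 0)) hC₀
    linarith
  · obtain ⟨h, hw⟩ := hW t (hsub ht)
    have h1 := H₁ (u t) (hcd t ht).continuous h (W t) hw x y
    have h2 := mul_le_mul_of_nonneg_left ((hB t ht).trans (le_max_left B 0)) hC₁
    exact h1.trans (mul_le_mul_of_nonneg_right (by linarith) (norm_nonneg _))
  · obtain ⟨h, hw⟩ := hV t (hsub ht)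
    obtain ⟨h', hw'⟩ := hV τ (hsub hτ)
    obtain ⟨hh, hhw⟩ := bessel_sub h h' hw hw'
    have h1 := H₂ (fun x => u t x - u τ x) ((hcd t ht).continuous.sub (hcd τ hτ).continuous) hh
      _ hhw x
    have h2 := mul_le_mul_of_nonneg_left (hLip t ht τ hτ) hC₂
    have h3 := mul_le_mul_of_nonneg_right (show C₂ * LV ≤ L by linarith) (abs_nonneg (t - τ))
    linarith
  · have h1 := Metric.continuousWithinAt_iff.1 (hWc' τ hτ) (ε / (C₁ + 1)) (by positivity)
    obtain ⟨δ, hδ, H⟩ := h1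
    refine ⟨δ, hδ, fun t ht htτ x => ?_⟩
    have h2 := H ht (by rwa [Real.dist_eq])
    rw [dist_eq_norm] at h2
    obtain ⟨h, hw⟩ := hW t (hsub ht)
    obtain ⟨h', hw'⟩ := hW τ (hsub hτ)
    obtain ⟨hh, hhw⟩ := bessel_sub h h' hw hw'
    have h3 : ∀ x y, ‖(u t x - u τ x) - (u t y - u τ y)‖ ≤ ε * ‖x - y‖ := fun x y => by
      refine (H₁ (fun x => u t x - u τ x) ((hcd t ht).continuous.sub (hcd τ hτ).continuous) hh
        _ hhw x y).trans (mul_le_mul_of_nonneg_right ?_ (norm_nonneg _))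
      rw [lt_div_iff₀ (by positivity)] at h2
      nlinarith [norm_nonneg (W t - W τ)]
    rw [← fderiv_fun_sub ((hcd t ht).differentiable one_ne_zero x)
      ((hcd τ hτ).differentiable one_ne_zero x)]
    have h4 : LipschitzWith ⟨ε, hε.le⟩ (fun x => u t x - u τ x) :=
      LipschitzWith.of_dist_le_mul fun x y => by
        rw [dist_eq_norm, dist_eq_norm]; exact h3 x y
    exact norm_fderiv_le_of_lipschitz ℝ h4

theorem IsEulerSolution.memLp {d : ℕ} {s : ℝ} {T : EReal}
    {u : ℝ → Space d → Space d} {p : ℝ → Space d → ℝ} 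
    (hu : IsEulerSolution s T u p) {t : ℝ} (ht : t ∈ lifespan T) :
    MemLp (u t) 2 (volume : Measure (Space d)) := by
  obtain ⟨W, -, hW⟩ := hu.regularity
  obtain ⟨h, -⟩ := hW t ht
  exact h.of_le (hu.contDiff t ht).continuous.aestronglyMeasurable
    (Filter.Eventually.of_forall fun x => (norm_complexify _).ge)

end AxisymEuler
end

noncomputable section
namespace AxisymEuler
open scoped Topology
open Filter

/-! ### Weak form of the planar vorticity equation -/

/-- A solution `v` of the momentum equation `∂_t v + (v · ∇) v + ∇ P = 0` in the plane on the time
interval `[0, t₁]`, with no condition on the divergence, and uniformly controlled. -/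
structure PlanarFlow (t₁ L : ℝ) (v : ℝ → ℝ × ℝ → ℝ × ℝ) : Prop where
  nonneg : 0 ≤ L
  contDiff : ∀ t ∈ Icc 0 t₁, ContDiff ℝ 1 (v t)
  bound : ∀ t ∈ Icc 0 t₁, ∀ x, ‖v t x‖ ≤ L
  lip_space : ∀ t ∈ Icc 0 t₁, ∀ x y, ‖v t x - v t y‖ ≤ L * ‖x - y‖
  lip_time : ∀ t ∈ Icc 0 t₁, ∀ s ∈ Icc 0 t₁, ∀ x, ‖v t x - v s x‖ ≤ L * |t - s|
  fderiv_time : ∀ s ∈ Icc 0 t₁, ∀ ε > 0, ∃ δ > 0, ∀ t ∈ Icc 0 t₁, |t - s| < δ →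
    ∀ x, ‖fderiv ℝ (v t) x - fderiv ℝ (v s) x‖ ≤ ε
  momentum : ∀ t ∈ Ioo 0 t₁, ∃ P : ℝ × ℝ → ℝ, Differentiable ℝ P ∧ ∀ y,
    HasDerivAt (fun τ => v τ y)
      (-(fderiv ℝ (v t) y (v t y)) - (fderiv ℝ P y (1, 0), fderiv ℝ P y (0, 1))) t

/-- The scalar curl `∂_2 v_1 - ∂_1 v_2` of a planar vector field. -/
def curl (v : ℝ × ℝ → ℝ × ℝ) (y : ℝ × ℝ) : ℝ :=
  (fderiv ℝ v y (0, 1)).1 - (fderiv ℝ v y (1, 0)).2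

/-- `G` is a compactly supported `C¹` function on the line with derivative `G'`. -/
structure IsBump (G G' : ℝ → ℝ) : Prop where
  hasDerivAt : ∀ x, HasDerivAt G (G' x) x
  continuous_deriv : Continuous G'
  compact : HasCompactSupport G

namespace IsBump
variable {G G' : ℝ → ℝ}

theorem continuous (h : IsBump G G') : Continuous G :=
  continuous_iff_continuousAt.2 fun x => (h.hasDerivAt x).continuousAt

theorem compact_deriv (h : IsBump G G') : HasCompactSupport G' := by
  have : G' = deriv G := funext fun x => (h.hasDerivAt x).deriv.symm
  rw [this]
  exact h.compact.deriv

end IsBump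

theorem hasCompactSupport_prod_mul {f g : ℝ → ℝ} (hf : HasCompactSupport f)
    (hg : HasCompactSupport g) : HasCompactSupport (fun y : ℝ × ℝ => f y.1 * g y.2) := by
  refine HasCompactSupport.intro (hf.isCompact.prod hg.isCompact) fun y hy => ?_
  by_cases h1 : y.1 ∈ tsupport f
  · have h2 : y.2 ∉ tsupport g := fun h2 => hy ⟨h1, h2⟩
    rw [image_eq_zero_of_notMem_tsupport h2, mul_zero]
  · rw [image_eq_zero_of_notMem_tsupport h1, zero_mul]

theorem integrable_mul_of_compact_of_bound {E : Type*} [NormedAddCommGroup E]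
    [MeasurableSpace E] [BorelSpace E] {μ : Measure E} [IsFiniteMeasureOnCompacts μ]
    {f g : E → ℝ} (hf : Continuous f)
    (hfc : HasCompactSupport f) (hg : AEStronglyMeasurable g μ) {M : ℝ} (hM : ∀ x, |g x| ≤ M) :
    Integrable (fun x => f x * g x) μ := by
  refine Integrable.mono' ((hf.integrable_of_hasCompactSupport hfc (μ := μ)).norm.mul_const M)
    (hf.aestronglyMeasurable.mul hg) (Eventually.of_forall fun x => ?_)
  rw [norm_mul]
  exact mul_le_mul_of_nonneg_left (hM x) (norm_nonneg _)

section IBP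
variable {E : Type*} [NormedAddCommGroup E] [NormedSpace ℝ E] [MeasurableSpace E] [BorelSpace E]
  [FiniteDimensional ℝ E] {μ : Measure E} [μ.IsAddHaarMeasure]

/-- Integration by parts in a direction `v`, one factor being compactly supported. -/
theorem integral_mul_lineDeriv_eq_neg {f f' g g' : E → ℝ} {v : E} (hf : Continuous f)
    (hfc : HasCompactSupport f) (hf' : Continuous f') (hfc' : HasCompactSupport f')
    (hg : Continuous g) (hg' : AEStronglyMeasurable g' μ) {M : ℝ} (hM : ∀ x, |g' x| ≤ M)
    (h1 : ∀ x, HasLineDerivAt ℝ f (f' x) x v) (h2 : ∀ x, HasLineDerivAt ℝ g (g' x) x v) :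
    ∫ x, f x * g' x ∂μ = - ∫ x, f' x * g x ∂μ := by
  refine integral_bilinear_hasLineDerivAt_right_eq_neg_left_of_integrable
    (B := ContinuousLinearMap.mul ℝ ℝ) ?_ ?_ ?_ (fun x _ => h1 x) (fun x _ => h2 x)
  · exact (hf'.mul hg).integrable_of_hasCompactSupport hfc'.mul_right
  · exact integrable_mul_of_compact_of_bound hf hfc hg' hM
  · exact (hf.mul hg).integrable_of_hasCompactSupport hfc.mul_right

end IBP

theorem hasLineDerivAt_prod_fst {f f' g : ℝ → ℝ} (h : ∀ x, HasDerivAt f (f' x) x) (y : ℝ × ℝ) :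
    HasLineDerivAt ℝ (fun y : ℝ × ℝ => f y.1 * g y.2) (f' y.1 * g y.2) y (1, 0) := by
  have h1 : HasDerivAt (fun t : ℝ => y.1 + t) 1 0 := by
    simpa using (hasDerivAt_id (0 : ℝ)).const_add y.1
  have h2 : HasDerivAt (fun t : ℝ => f (y.1 + t)) (f' y.1) 0 := by
    have := HasDerivAt.comp (0 : ℝ) (by simpa using h y.1 : HasDerivAt f (f' y.1) (y.1 + 0)) h1
    simpa using! this
  have := h2.mul_const (g y.2)
  simpa [HasLineDerivAt] using this

theorem hasLineDerivAt_prod_snd {f g g' : ℝ → ℝ} (h : ∀ x, HasDerivAt g (g' x) x) (y : ℝ × ℝ) :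
    HasLineDerivAt ℝ (fun y : ℝ × ℝ => f y.1 * g y.2) (f y.1 * g' y.2) y (0, 1) := by
  have h1 : HasDerivAt (fun t : ℝ => y.2 + t) 1 0 := by
    simpa using (hasDerivAt_id (0 : ℝ)).const_add y.2
  have h2 : HasDerivAt (fun t : ℝ => g (y.2 + t)) (g' y.2) 0 := by
    have := HasDerivAt.comp (0 : ℝ) (by simpa using h y.2 : HasDerivAt g (g' y.2) (y.2 + 0)) h1
    simpa using! this
  have := h2.const_mul (f y.1)
  simpa [HasLineDerivAt] using this

section Weak
variable {G G' χ χ' : ℝ → ℝ}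

/-- `∬ ∇^⊥ψ · ∇Q = 0` for a test function `ψ = G ⊗ χ` of class `C¹`. -/
theorem integral_perp_grad_eq_zero (hG : IsBump G G') (hχ : IsBump χ χ') {Q : ℝ × ℝ → ℝ}
    (hQ : Differentiable ℝ Q) {M : ℝ} (h1 : ∀ y, |fderiv ℝ Q y (1, 0)| ≤ M)
    (h2 : ∀ y, |fderiv ℝ Q y (0, 1)| ≤ M) :
    ∫ y : ℝ × ℝ, ((G' y.1 * χ y.2) * fderiv ℝ Q y (0, 1) -
      (G y.1 * χ' y.2) * fderiv ℝ Q y (1, 0)) = 0 := by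
  have c1 := hG.continuous
  have c2 := hχ.continuous
  have c3 := hG.continuous_deriv
  have c4 := hχ.continuous_deriv
  have m1 : AEStronglyMeasurable (fun y => fderiv ℝ Q y (1, 0)) volume :=
    (measurable_fderiv_apply_const ℝ Q _).aestronglyMeasurable
  have m2 : AEStronglyMeasurable (fun y => fderiv ℝ Q y (0, 1)) volume :=
    (measurable_fderiv_apply_const ℝ Q _).aestronglyMeasurable
  rw [integral_sub]
  · rw [integral_mul_lineDeriv_eq_neg (f := fun y : ℝ × ℝ => G' y.1 * χ y.2)
      (f' := fun y => G' y.1 * χ' y.2) (g := Q) (v := (0, 1)) (by fun_prop)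
      (hasCompactSupport_prod_mul hG.compact_deriv hχ.compact) (by fun_prop)
      (hasCompactSupport_prod_mul hG.compact_deriv hχ.compact_deriv) hQ.continuous m2 h2
      (fun y => hasLineDerivAt_prod_snd hχ.hasDerivAt y)
      (fun y => (hQ y).hasFDerivAt.hasLineDerivAt _),
      integral_mul_lineDeriv_eq_neg (f := fun y : ℝ × ℝ => G y.1 * χ' y.2)
      (f' := fun y => G' y.1 * χ' y.2) (g := Q) (v := (1, 0)) (by fun_prop)
      (hasCompactSupport_prod_mul hG.compact hχ.compact_deriv) (by fun_prop)
      (hasCompactSupport_prod_mul hG.compact_deriv hχ.compact_deriv) hQ.continuous m1 h1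
      (fun y => hasLineDerivAt_prod_fst hG.hasDerivAt y)
      (fun y => (hQ y).hasFDerivAt.hasLineDerivAt _), sub_self]
  · exact integrable_mul_of_compact_of_bound (by fun_prop)
      (hasCompactSupport_prod_mul hG.compact_deriv hχ.compact) m2 h2
  · exact integrable_mul_of_compact_of_bound (by fun_prop)
      (hasCompactSupport_prod_mul hG.compact hχ.compact_deriv) m1 h1

theorem continuous_curl {v : ℝ × ℝ → ℝ × ℝ} (hv : ContDiff ℝ 1 v) : Continuous (curl v) := by
  have := hv.continuous_fderiv one_ne_zero
  unfold curl
  fun_prop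

theorem norm_fderiv_le_of_lip {E F : Type*} [NormedAddCommGroup E] [NormedSpace ℝ E]
    [NormedAddCommGroup F] [NormedSpace ℝ F] {v : E → F} {L : ℝ} (hL : 0 ≤ L)
    (h : ∀ x y, ‖v x - v y‖ ≤ L * ‖x - y‖) (x : E) : ‖fderiv ℝ v x‖ ≤ L := by
  have h4 : LipschitzWith ⟨L, hL⟩ v := LipschitzWith.of_dist_le_mul fun x y => by
    rw [dist_eq_norm, dist_eq_norm]; exact h x y
  exact norm_fderiv_le_of_lipschitz ℝ h4

theorem norm_e1 : ‖((1 : ℝ), (0 : ℝ))‖ = 1 := by simp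
theorem norm_e2 : ‖((0 : ℝ), (1 : ℝ))‖ = 1 := by simp

theorem abs_curl_le {v : ℝ × ℝ → ℝ × ℝ} {L : ℝ} {y : ℝ × ℝ} (h : ‖fderiv ℝ v y‖ ≤ L) :
    |curl v y| ≤ 2 * L := by
  have h1 := (norm_fst_le _).trans ((fderiv ℝ v y).le_of_opNorm_le h (0, 1))
  have h2 := (norm_snd_le _).trans ((fderiv ℝ v y).le_of_opNorm_le h (1, 0))
  rw [norm_e2, mul_one, Real.norm_eq_abs] at h1
  rw [norm_e1, mul_one, Real.norm_eq_abs] at h2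
  unfold curl
  rw [abs_le] at *
  constructor <;> linarith [h1.1, h1.2, h2.1, h2.2]

/-- The curl tested against a function is minus the pairing of the velocity with the perpendicular
gradient `(∂₂, -∂₁)` of that function. -/
theorem integral_mul_curl (hG : IsBump G G') (hχ : IsBump χ χ') {v : ℝ × ℝ → ℝ × ℝ}
    (hv : ContDiff ℝ 1 v) {L : ℝ} (hL : ∀ y, ‖fderiv ℝ v y‖ ≤ L) :
    ∫ y : ℝ × ℝ, (G y.1 * χ y.2) * curl v y =
      ∫ y : ℝ × ℝ, ((G' y.1 * χ y.2) * (v y).2 - (G y.1 * χ' y.2) * (v y).1) := by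
  have c1 := hG.continuous
  have c2 := hχ.continuous
  have c3 := hG.continuous_deriv
  have c4 := hχ.continuous_deriv
  have c5 := hv.continuous
  have c6 := hv.continuous_fderiv one_ne_zero
  have d := hv.differentiable one_ne_zero
  have s1 := hasCompactSupport_prod_mul hG.compact hχ.compact
  have s2 := hasCompactSupport_prod_mul hG.compact_deriv hχ.compact
  have s3 := hasCompactSupport_prod_mul hG.compact hχ.compact_deriv
  have e : ∀ y : ℝ × ℝ, (G y.1 * χ y.2) * curl v y =
      (G y.1 * χ y.2) * (fderiv ℝ v y (0, 1)).1 - (G y.1 * χ y.2) * (fderiv ℝ v y (1, 0)).2 :=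
    fun y => by unfold curl; ring
  simp only [e]
  rw [integral_sub, integral_sub,
    integral_mul_lineDeriv_eq_neg (f := fun y : ℝ × ℝ => G y.1 * χ y.2)
      (f' := fun y => G y.1 * χ' y.2) (g := fun y => (v y).1)
      (g' := fun y => (fderiv ℝ v y (0, 1)).1) (v := (0, 1)) (M := L) (by fun_prop)
      s1 (by fun_prop) s3 (by fun_prop) (by fun_prop) ?_
      (fun y => hasLineDerivAt_prod_snd hχ.hasDerivAt y)
      (fun y => ((d y).hasFDerivAt.fst).hasLineDerivAt _),
    integral_mul_lineDeriv_eq_neg (f := fun y : ℝ × ℝ => G y.1 * χ y.2)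
      (f' := fun y => G' y.1 * χ y.2) (g := fun y => (v y).2)
      (g' := fun y => (fderiv ℝ v y (1, 0)).2) (v := (1, 0)) (M := L) (by fun_prop)
      s1 (by fun_prop) s2 (by fun_prop) (by fun_prop) ?_
      (fun y => hasLineDerivAt_prod_fst hG.hasDerivAt y)
      (fun y => ((d y).hasFDerivAt.snd).hasLineDerivAt _)]
  · ring
  · intro y
    have h1 := (norm_snd_le _).trans ((fderiv ℝ v y).le_of_opNorm_le (hL y) (1, 0))
    rwa [norm_e1, mul_one] at h1
  · intro y
    have h1 := (norm_fst_le _).trans ((fderiv ℝ v y).le_of_opNorm_le (hL y) (0, 1))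
    rwa [norm_e2, mul_one] at h1
  · exact Continuous.integrable_of_hasCompactSupport (by fun_prop) s2.mul_right
  · exact Continuous.integrable_of_hasCompactSupport (by fun_prop) s3.mul_right
  · exact Continuous.integrable_of_hasCompactSupport (by fun_prop) s1.mul_right
  · exact Continuous.integrable_of_hasCompactSupport (by fun_prop) s1.mul_right

variable {t₁ L : ℝ} {v : ℝ → ℝ × ℝ → ℝ × ℝ}

theorem PlanarFlow.norm_fderiv_le (hv : PlanarFlow t₁ L v) {t : ℝ} (ht : t ∈ Icc 0 t₁)
    (y : ℝ × ℝ) : ‖fderiv ℝ (v t) y‖ ≤ L :=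
  norm_fderiv_le_of_lip hv.nonneg (hv.lip_space t ht) y

/-- The acceleration field `a = ∂_t v` of a planar flow. By the momentum equation
`a = - ∇Q - η (v_2, -v_1)` with `Q = P + |v|² / 2`, and the gradient part is orthogonal to every
`∇^⊥ψ`. -/
theorem PlanarFlow.exists_accel (hv : PlanarFlow t₁ L v) {t : ℝ} (ht : t ∈ Ioo 0 t₁) :
    ∃ a : ℝ × ℝ → ℝ × ℝ, Measurable a ∧ (∀ y, ‖a y‖ ≤ L) ∧
      (∀ y, HasDerivAt (fun τ => v τ y) (a y) t) ∧
      ∀ G G' χ χ' : ℝ → ℝ, IsBump G G' → IsBump χ χ' →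
      (∫ y : ℝ × ℝ, ((G' y.1 * χ y.2) * (a y).2 - (G y.1 * χ' y.2) * (a y).1)) =
      ∫ y : ℝ × ℝ, ((G' y.1 * χ y.2) * (v t y).1 + (G y.1 * χ' y.2) * (v t y).2) *
        curl (v t) y := by
  have ht' : t ∈ Icc 0 t₁ := Ioo_subset_Icc_self ht
  have c5 := (hv.contDiff t ht').continuous
  have c6 := continuous_curl (hv.contDiff t ht')
  have c7 := (hv.contDiff t ht').continuous_fderiv one_ne_zero
  obtain ⟨P, hP, hm⟩ := hv.momentum t ht
  set a : ℝ × ℝ → ℝ × ℝ := fun y =>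
    -(fderiv ℝ (v t) y (v t y)) - (fderiv ℝ P y (1, 0), fderiv ℝ P y (0, 1)) with ha
  have hIcc : Icc 0 t₁ ∈ 𝓝 t := Icc_mem_nhds ht.1 ht.2
  have haL : ∀ y, ‖a y‖ ≤ L := fun y => by
    refine (hm y).le_of_lip' hv.nonneg ?_
    filter_upwards [hIcc] with τ hτ
    exact hv.lip_time τ hτ t ht' y
  have ham : Measurable a := by
    have h1 := measurable_fderiv_apply_const ℝ P (1, 0)
    have h2 := measurable_fderiv_apply_const ℝ P (0, 1)
    have h3 : Continuous fun y => fderiv ℝ (v t) y (v t y) := by fun_prop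
    exact h3.measurable.neg.sub (h1.prodMk h2)
  refine ⟨a, ham, haL, hm, fun G G' χ χ' hG hχ => ?_⟩
  have c1 := hG.continuous
  have c2 := hχ.continuous
  have c3 := hG.continuous_deriv
  have c4 := hχ.continuous_deriv
  have s2 := hasCompactSupport_prod_mul hG.compact_deriv hχ.compact
  have s3 := hasCompactSupport_prod_mul hG.compact hχ.compact_deriv
  set Q : ℝ × ℝ → ℝ := fun y => P y + ((v t y).1 ^ 2 + (v t y).2 ^ 2) / 2 with hQ
  have dv := (hv.contDiff t ht').differentiable one_ne_zero
  have hQd : ∀ y, HasFDerivAt Q (fderiv ℝ P y + (1 / 2 : ℝ) •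
      ((2 * (v t y).1) • (ContinuousLinearMap.fst ℝ ℝ ℝ).comp (fderiv ℝ (v t) y) +
      (2 * (v t y).2) • (ContinuousLinearMap.snd ℝ ℝ ℝ).comp (fderiv ℝ (v t) y))) y := fun y => by
    have h1 := ((dv y).hasFDerivAt.fst).pow 2
    have h2 := ((dv y).hasFDerivAt.snd).pow 2
    have h3 := (hP y).hasFDerivAt.add ((h1.add h2).const_mul (1 / 2 : ℝ))
    refine (h3.congr_fderiv ?_).congr_of_eventuallyEq (Eventually.of_forall fun x => ?_)
    · simp
    · simp [hQ]; ring
  have hQ' : Differentiable ℝ Q := fun y => (hQd y).differentiableAt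
  have lin : ∀ y (w : ℝ × ℝ), fderiv ℝ (v t) y w =
      w.1 • fderiv ℝ (v t) y (1, 0) + w.2 • fderiv ℝ (v t) y (0, 1) := fun y w => by
    rw [← map_smul, ← map_smul, ← map_add]; simp
  have eqr : ∀ y, fderiv ℝ Q y (1, 0) = -(a y).1 - (v t y).2 * curl (v t) y := fun y => by
    rw [(hQd y).fderiv, ha]
    simp only [curl, lin y (v t y)]
    simp
    ring
  have eqz : ∀ y, fderiv ℝ Q y (0, 1) = -(a y).2 + (v t y).1 * curl (v t) y := fun y => by
    rw [(hQd y).fderiv, ha]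
    simp only [curl, lin y (v t y)]
    simp
    ring
  have cb : ∀ y, |curl (v t) y| ≤ 2 * L := fun y => abs_curl_le (hv.norm_fderiv_le ht' y)
  have bnd : ∀ (i : ℝ) (y : ℝ × ℝ), |i| ≤ L → |i * curl (v t) y| ≤ L * (2 * L) := fun i y hi => by
    rw [abs_mul]
    exact mul_le_mul hi (cb y) (abs_nonneg _) hv.nonneg
  have b1 : ∀ y, |fderiv ℝ Q y (1, 0)| ≤ L + L * (2 * L) := fun y => by
    rw [eqr]
    refine (abs_sub _ _).trans (add_le_add ?_ (bnd _ _ ((norm_snd_le _).trans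
      (hv.bound t ht' y))))
    rw [abs_neg]
    exact (norm_fst_le _).trans (haL y)
  have b2 : ∀ y, |fderiv ℝ Q y (0, 1)| ≤ L + L * (2 * L) := fun y => by
    rw [eqz]
    refine (abs_add_le _ _).trans (add_le_add ?_ (bnd _ _ ((norm_fst_le _).trans
      (hv.bound t ht' y))))
    rw [abs_neg]
    exact (norm_snd_le _).trans (haL y)
  have z := integral_perp_grad_eq_zero hG hχ hQ' b1 b2
  rw [← add_zero (∫ y : ℝ × ℝ, ((G' y.1 * χ y.2) * (a y).2 - (G y.1 * χ' y.2) * (a y).1)), ← z,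
    ← integral_add]
  · refine integral_congr_ae (Eventually.of_forall fun y => ?_)
    simp only [eqr, eqz]
    ring
  · exact (integrable_mul_of_compact_of_bound (by fun_prop) s2
      ham.snd.aestronglyMeasurable fun y => (norm_snd_le _).trans (haL y)).sub
      (integrable_mul_of_compact_of_bound (by fun_prop) s3
      ham.fst.aestronglyMeasurable fun y => (norm_fst_le _).trans (haL y))
  · exact (integrable_mul_of_compact_of_bound (by fun_prop) s2
      (measurable_fderiv_apply_const ℝ Q _).aestronglyMeasurable b2).sub
      (integrable_mul_of_compact_of_bound (by fun_prop) s3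
      (measurable_fderiv_apply_const ℝ Q _).aestronglyMeasurable b1)

/-- The vorticity of a planar flow satisfies the weak form of `∂_t η + div (η v) = 0`. -/
theorem PlanarFlow.hasDerivAt_integral_curl (hv : PlanarFlow t₁ L v) (hG : IsBump G G')
    (hχ : IsBump χ χ') {t : ℝ} (ht : t ∈ Ioo 0 t₁) :
    HasDerivAt (fun τ => ∫ y : ℝ × ℝ, (G y.1 * χ y.2) * curl (v τ) y)
      (∫ y : ℝ × ℝ, ((G' y.1 * χ y.2) * (v t y).1 + (G y.1 * χ' y.2) * (v t y).2) *
        curl (v t) y) t := by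
  have c1 := hG.continuous
  have c2 := hχ.continuous
  have c3 := hG.continuous_deriv
  have c4 := hχ.continuous_deriv
  have s2 := hasCompactSupport_prod_mul hG.compact_deriv hχ.compact
  have s3 := hasCompactSupport_prod_mul hG.compact hχ.compact_deriv
  have ht' : t ∈ Icc 0 t₁ := Ioo_subset_Icc_self ht
  have c5 := (hv.contDiff t ht').continuous
  have hIcc : Icc 0 t₁ ∈ 𝓝 t := Icc_mem_nhds ht.1 ht.2
  obtain ⟨a, ham, haL, hm, val⟩ := hv.exists_accel ht
  have key : HasDerivAt (fun τ => ∫ y : ℝ × ℝ, ((G' y.1 * χ y.2) * (v τ y).2 -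
      (G y.1 * χ' y.2) * (v τ y).1))
      (∫ y : ℝ × ℝ, ((G' y.1 * χ y.2) * (a y).2 - (G y.1 * χ' y.2) * (a y).1)) t := by
    refine (hasDerivAt_integral_of_dominated_loc_of_lip
      (bound := fun y : ℝ × ℝ => (|G' y.1 * χ y.2| + |G y.1 * χ' y.2|) * L)
      (s := Icc 0 t₁) hIcc ?_ ?_ ?_ ?_ ?_ ?_).2
    · filter_upwards [hIcc] with τ hτ
      have := (hv.contDiff τ hτ).continuous
      exact Continuous.aestronglyMeasurable (by fun_prop)
    · exact Integrable.sub
        (Continuous.integrable_of_hasCompactSupport (by fun_prop) s2.mul_right)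
        (Continuous.integrable_of_hasCompactSupport (by fun_prop) s3.mul_right)
    · have h1 := ham.fst.aestronglyMeasurable (μ := (volume : Measure (ℝ × ℝ)))
      have h2 := ham.snd.aestronglyMeasurable (μ := (volume : Measure (ℝ × ℝ)))
      exact ((Continuous.aestronglyMeasurable (by fun_prop)).mul h2).sub
        ((Continuous.aestronglyMeasurable (by fun_prop)).mul h1)
    · refine Eventually.of_forall fun y => LipschitzOnWith.of_dist_le_mul fun τ hτ s hs => ?_
      have h0 := hv.lip_time τ hτ s hs y
      have h1 := (norm_fst_le _).trans h0
      have h2 := (norm_snd_le _).trans h0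
      rw [Real.dist_eq, Real.dist_eq, Real.coe_nnabs,
        abs_of_nonneg (mul_nonneg (by positivity) hv.nonneg)]
      have e : G' y.1 * χ y.2 * (v τ y).2 - G y.1 * χ' y.2 * (v τ y).1 -
          (G' y.1 * χ y.2 * (v s y).2 - G y.1 * χ' y.2 * (v s y).1) =
          G' y.1 * χ y.2 * (v τ y - v s y).2 - G y.1 * χ' y.2 * (v τ y - v s y).1 := by
        simp only [Prod.snd_sub, Prod.fst_sub]; ring
      rw [e]
      refine (abs_sub _ _).trans ?_
      rw [abs_mul, abs_mul (G y.1 * χ' y.2)]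
      have i1 := mul_le_mul_of_nonneg_left h2 (abs_nonneg (G' y.1 * χ y.2))
      have i2 := mul_le_mul_of_nonneg_left h1 (abs_nonneg (G y.1 * χ' y.2))
      simp only [Real.norm_eq_abs] at i1 i2
      linarith
    · exact (Integrable.add
        (Continuous.integrable_of_hasCompactSupport (by fun_prop) s2).abs
        (Continuous.integrable_of_hasCompactSupport (by fun_prop) s3).abs).mul_const L
    · refine Eventually.of_forall fun y => ?_
      have h1 : HasDerivAt (fun τ => (v τ y).1) (a y).1 t := by
        simpa using (hm y).hasFDerivAt.fst.hasDerivAt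
      have h2 : HasDerivAt (fun τ => (v τ y).2) (a y).2 t := by
        simpa using (hm y).hasFDerivAt.snd.hasDerivAt
      exact (h2.const_mul _).sub (h1.const_mul _)
  rw [val G G' χ χ' hG hχ] at key
  refine key.congr_of_eventuallyEq ?_
  filter_upwards [hIcc] with τ hτ
  exact integral_mul_curl hG hχ (hv.contDiff τ hτ) (hv.norm_fderiv_le hτ)

end Weak

end AxisymEuler
end

noncomputable section
namespace AxisymEuler
open scoped Topology
open Filter

/-! ### Transport of the planar vorticity along trajectories -/

theorem IsBump.shift {B B' : ℝ → ℝ} (h : IsBump B B') (c : ℝ) :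
    IsBump (fun x => B (x - c)) (fun x => B' (x - c)) where
  hasDerivAt x := HasDerivAt.comp_sub_const x c (h.hasDerivAt _)
  continuous_deriv := h.continuous_deriv.comp (by fun_prop)
  compact := h.compact.comp_homeomorph (Homeomorph.subRight c)

/-- Bounds for a `C¹` bump: size, Lipschitz constant, and radius of the support. -/
theorem IsBump.exists_bounds {B B' : ℝ → ℝ} (h : IsBump B B') :
    ∃ N ρ : ℝ, 0 ≤ N ∧ 0 ≤ ρ ∧ (∀ x, |B x| ≤ N) ∧ (∀ x y, |B x - B y| ≤ N * |x - y|) ∧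
      ∀ x, ρ < |x| → B x = 0 := by
  obtain ⟨N₁, h1⟩ := h.compact.exists_bound_of_continuous h.continuous
  obtain ⟨N₂, h2⟩ := h.compact_deriv.exists_bound_of_continuous h.continuous_deriv
  obtain ⟨ρ, hρ⟩ := h.compact.isCompact.isBounded.exists_norm_le
  refine ⟨max (max N₁ N₂) 0, max ρ 0, le_max_right _ _, le_max_right _ _, fun x => (h1 x).trans
    ((le_max_left _ _).trans (le_max_left _ _)), fun x y => ?_, fun x hx => ?_⟩
  · have := Convex.norm_image_sub_le_of_norm_hasDerivWithin_le (s := univ) (x := y) (y := x)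
      (f := B) (f' := B') (C := max (max N₁ N₂) 0) (fun x _ => (h.hasDerivAt x).hasDerivWithinAt)
      (fun x _ => (h2 x).trans ((le_max_right _ _).trans (le_max_left _ _))) convex_univ
      (mem_univ _) (mem_univ _)
    simpa using this
  · refine image_eq_zero_of_notMem_tsupport fun hx' => ?_
    exact absurd (hρ x hx') (not_le.2 (lt_of_le_of_lt (le_max_left _ _) hx))

/-- Stability of a triple product of bounded Lipschitz quantities. -/
theorem abs_triple_sub_le {p q r p' q' r' N L δ : ℝ} (hN : 0 ≤ N) (hL : 0 ≤ L) (hδ : 0 ≤ δ)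
    (hq : |q| ≤ N) (hr : |r| ≤ L) (hp' : |p'| ≤ N) (hq' : |q'| ≤ N)
    (h1 : |p - p'| ≤ N * (L * δ)) (h2 : |q - q'| ≤ N * (L * δ)) (h3 : |r - r'| ≤ L * δ) :
    |p * q * r - p' * q' * r'| ≤ N ^ 2 * L * (2 * L + 1) * δ := by
  have e : p * q * r - p' * q' * r' = (p - p') * (q * r) + p' * ((q - q') * r) +
    p' * (q' * (r - r')) := by ring
  have i1 : |(p - p') * (q * r)| ≤ N * (L * δ) * (N * L) := by
    rw [abs_mul, abs_mul]; gcongr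
  have i2 : |p' * ((q - q') * r)| ≤ N * (N * (L * δ) * L) := by
    rw [abs_mul, abs_mul]; gcongr
  have i3 : |p' * (q' * (r - r'))| ≤ N * (N * (L * δ)) := by
    rw [abs_mul, abs_mul]; gcongr
  rw [e]
  refine (abs_add_le _ _).trans ((add_le_add ((abs_add_le _ _).trans (add_le_add i1 i2)) i3).trans
    (le_of_eq ?_))
  ring

variable {t₁ L : ℝ} {v : ℝ → ℝ × ℝ → ℝ × ℝ} {X : ℝ → ℝ × ℝ}

/-- `X` is a trajectory of the planar field `v` on `[0, t₁]`. -/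
def IsTrajectory (t₁ : ℝ) (v : ℝ → ℝ × ℝ → ℝ × ℝ) (X : ℝ → ℝ × ℝ) : Prop :=
  ∀ s ∈ Icc 0 t₁, HasDerivWithinAt X (v s (X s)) (Icc 0 t₁) s

theorem IsTrajectory.lip (hv : PlanarFlow t₁ L v) (hX : IsTrajectory t₁ v X) {s t : ℝ}
    (hs : s ∈ Icc 0 t₁) (ht : t ∈ Icc 0 t₁) : ‖X t - X s‖ ≤ L * |t - s| :=
  (convex_Icc 0 t₁).norm_image_sub_le_of_norm_hasDerivWithin_le hX
    (fun τ hτ => hv.bound τ hτ _) hs ht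

theorem IsTrajectory.continuousOn (hX : IsTrajectory t₁ v X) : ContinuousOn X (Icc 0 t₁) :=
  fun s hs => (hX s hs).continuousWithinAt

theorem PlanarFlow.exists_trajectory (hv : PlanarFlow t₁ L v) (h0 : 0 ≤ t₁) (y : ℝ × ℝ) :
    ∃ X, X t₁ = y ∧ IsTrajectory t₁ v X := by
  have hL := hv.nonneg
  have hpl : IsPicardLindelof v (tmin := 0) (tmax := t₁) ⟨t₁, h0, le_rfl⟩ y
      ⟨L * t₁, by positivity⟩ 0 ⟨L, hL⟩ ⟨L, hL⟩ := by
    refine ⟨fun t ht => ?_, fun x _ => ?_, fun t ht x _ => hv.bound t ht x, ?_⟩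
    · exact (LipschitzWith.of_dist_le_mul fun x y => by
        rw [dist_eq_norm, dist_eq_norm]; exact hv.lip_space t ht x y).lipschitzOnWith
    · have : LipschitzOnWith ⟨L, hL⟩ (v · x) (Icc 0 t₁) :=
        LipschitzOnWith.of_dist_le_mul fun s hs t ht => by
          rw [dist_eq_norm, dist_eq_norm]; exact hv.lip_time s hs t ht x
      exact this.continuousOn
    · simp only [sub_self, sub_zero, NNReal.coe_zero, max_eq_right h0]
      exact le_rfl
  exact hpl.exists_eq_forall_mem_Icc_hasDerivWithinAt₀

/-- The vorticity tested against a bump moving along a trajectory: only the velocity relative to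
the trajectory enters the derivative. -/
theorem PlanarFlow.hasDerivAt_integral_moving (hv : PlanarFlow t₁ L v)
    (hX : IsTrajectory t₁ v X) {B B' B'' : ℝ → ℝ} (hB : IsBump B B') (hB' : IsBump B' B'')
    {t : ℝ} (ht : t ∈ Ioo 0 t₁) :
    HasDerivAt (fun τ => ∫ y : ℝ × ℝ, (B (y.1 - (X τ).1) * B (y.2 - (X τ).2)) * curl (v τ) y)
      (∫ y : ℝ × ℝ, ((B' (y.1 - (X t).1) * B (y.2 - (X t).2)) * ((v t y).1 - (v t (X t)).1) +
        (B (y.1 - (X t).1) * B' (y.2 - (X t).2)) * ((v t y).2 - (v t (X t)).2)) *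
        curl (v t) y) t := by
  have ht' : t ∈ Icc 0 t₁ := Ioo_subset_Icc_self ht
  have hIcc : Icc 0 t₁ ∈ 𝓝 t := Icc_mem_nhds ht.1 ht.2
  have hL := hv.nonneg
  have c1 := hB.continuous
  have c2 := hB.continuous_deriv
  have c3 := hB'.continuous_deriv
  have c5 := (hv.contDiff t ht').continuous
  have c6 := continuous_curl (hv.contDiff t ht')
  have hXt : HasDerivAt X (v t (X t)) t := (hX t ht').hasDerivAt hIcc
  have hX1 : HasDerivAt (fun τ => (X τ).1) (v t (X t)).1 t := by
    simpa using hXt.hasFDerivAt.fst.hasDerivAt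
  have hX2 : HasDerivAt (fun τ => (X τ).2) (v t (X t)).2 t := by
    simpa using hXt.hasFDerivAt.snd.hasDerivAt
  obtain ⟨N₁, ρ₁, hN₁, hρ₁, n1, l1, z1⟩ := hB.exists_bounds
  obtain ⟨N₂, ρ₂, hN₂, hρ₂, n2, l2, z2⟩ := hB'.exists_bounds
  obtain ⟨R, hR⟩ := isCompact_Icc.exists_bound_of_continuousOn hX.continuousOn
  set N := max N₁ N₂ with hN
  set ρ := max ρ₁ ρ₂ with hρ
  have hN0 : 0 ≤ N := hN₁.trans (le_max_left _ _)
  have n1' : ∀ x, |B x| ≤ N := fun x => (n1 x).trans (le_max_left _ _)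
  have n2' : ∀ x, |B' x| ≤ N := fun x => (n2 x).trans (le_max_right _ _)
  have l1' : ∀ x y, |B x - B y| ≤ N * |x - y| := fun x y =>
    (l1 x y).trans (mul_le_mul_of_nonneg_right (le_max_left _ _) (abs_nonneg _))
  have l2' : ∀ x y, |B' x - B' y| ≤ N * |x - y| := fun x y =>
    (l2 x y).trans (mul_le_mul_of_nonneg_right (le_max_right _ _) (abs_nonneg _))
  have z1' : ∀ x, ρ < |x| → B x = 0 := fun x hx => z1 x (lt_of_le_of_lt (le_max_left _ _) hx)
  have z2' : ∀ x, ρ < |x| → B' x = 0 := fun x hx => z2 x (lt_of_le_of_lt (le_max_right _ _) hx)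
  have sB := fun c => hB.shift c
  have sB' := fun c => hB'.shift c
  obtain ⟨a, ham, haL, hm, val⟩ := hv.exists_accel ht
  set J : ℝ → ℝ × ℝ → ℝ := fun τ y =>
    (B' (y.1 - (X τ).1) * B (y.2 - (X τ).2)) * (v τ y).2 -
      (B (y.1 - (X τ).1) * B' (y.2 - (X τ).2)) * (v τ y).1 with hJ
  set K := Metric.closedBall (0 : ℝ × ℝ) (R + ρ) with hK
  have hzero : ∀ s ∈ Icc 0 t₁, ∀ y ∉ K, J s y = 0 := by
    intro s hs y hy
    have h1 : R + ρ < ‖y‖ := by simpa [hK] using hy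
    have h2 := hR s hs
    rw [Prod.norm_def] at h1 h2
    have h3 := (le_max_left _ _).trans h2
    have h4 := (le_max_right _ _).trans h2
    simp only [Real.norm_eq_abs] at h1 h3 h4
    rcases lt_max_iff.1 h1 with h | h
    · have : ρ < |y.1 - (X s).1| := by have := abs_sub_abs_le_abs_sub y.1 (X s).1; linarith
      simp [hJ, z1' _ this, z2' _ this]
    · have : ρ < |y.2 - (X s).2| := by have := abs_sub_abs_le_abs_sub y.2 (X s).2; linarith
      simp [hJ, z1' _ this, z2' _ this]
  set f₁ : ℝ × ℝ → ℝ := fun y => (B'' (y.1 - (X t).1) * B (y.2 - (X t).2)) * (v t y).2 -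
    (B' (y.1 - (X t).1) * B' (y.2 - (X t).2)) * (v t y).1 with hf₁
  set f₂ : ℝ × ℝ → ℝ := fun y => (B' (y.1 - (X t).1) * B' (y.2 - (X t).2)) * (v t y).2 -
    (B (y.1 - (X t).1) * B'' (y.2 - (X t).2)) * (v t y).1 with hf₂
  set f₃ : ℝ × ℝ → ℝ := fun y => (B' (y.1 - (X t).1) * B (y.2 - (X t).2)) * (a y).2 -
    (B (y.1 - (X t).1) * B' (y.2 - (X t).2)) * (a y).1 with hf₃
  set J' : ℝ × ℝ → ℝ := fun y =>
    (-(v t (X t)).1 * f₁ y + -(v t (X t)).2 * f₂ y) + f₃ y with hJ'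
  have key : HasDerivAt (fun τ => ∫ y, J τ y) (∫ y, J' y) t := by
    refine (hasDerivAt_integral_of_dominated_loc_of_lip
      (bound := K.indicator fun _ => N ^ 2 * L * (2 * L + 1) + N ^ 2 * L * (2 * L + 1))
      (s := Icc 0 t₁) hIcc ?_ ?_ ?_ ?_ ?_ ?_).2
    · filter_upwards [hIcc] with τ hτ
      have := (hv.contDiff τ hτ).continuous
      exact Continuous.aestronglyMeasurable (by fun_prop)
    · exact Integrable.sub
        (Continuous.integrable_of_hasCompactSupport (by fun_prop)
          (hasCompactSupport_prod_mul (sB' _).compact (sB _).compact).mul_right)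
        (Continuous.integrable_of_hasCompactSupport (by fun_prop)
          (hasCompactSupport_prod_mul (sB _).compact (sB' _).compact).mul_right)
    · have h1 := ham.fst.aestronglyMeasurable (μ := (volume : Measure (ℝ × ℝ)))
      have h2 := ham.snd.aestronglyMeasurable (μ := (volume : Measure (ℝ × ℝ)))
      refine (Continuous.aestronglyMeasurable (by fun_prop)).add
        (((Continuous.aestronglyMeasurable (by fun_prop)).mul h2).sub
        ((Continuous.aestronglyMeasurable (by fun_prop)).mul h1))
    · refine Eventually.of_forall fun y => LipschitzOnWith.of_dist_le_mul fun τ hτ s hs => ?_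
      rw [Real.dist_eq, Real.dist_eq, Real.coe_nnabs]
      by_cases hy : y ∈ K
      · have hNL : 0 ≤ N ^ 2 * L * (2 * L + 1) + N ^ 2 * L * (2 * L + 1) := by positivity
        rw [indicator_of_mem hy, abs_of_nonneg hNL]
        have h0 := hv.lip_time τ hτ s hs y
        have h1 := (norm_fst_le _).trans h0
        have h2 := (norm_snd_le _).trans h0
        have b0 := hv.bound τ hτ y
        have b1 := (norm_fst_le _).trans b0
        have b2 := (norm_snd_le _).trans b0
        have x0 := hX.lip hv hs hτ
        have x1 := (norm_fst_le _).trans x0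
        have x2 := (norm_snd_le _).trans x0
        simp only [Prod.fst_sub, Prod.snd_sub, Real.norm_eq_abs] at h1 h2 b1 b2 x1 x2
        have k1 : |(y.1 - (X τ).1) - (y.1 - (X s).1)| ≤ L * |τ - s| := by
          rw [show (y.1 - (X τ).1) - (y.1 - (X s).1) = -((X τ).1 - (X s).1) by ring, abs_neg]
          exact x1
        have k2 : |(y.2 - (X τ).2) - (y.2 - (X s).2)| ≤ L * |τ - s| := by
          rw [show (y.2 - (X τ).2) - (y.2 - (X s).2) = -((X τ).2 - (X s).2) by ring, abs_neg]
          exact x2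
        have m1 := fun p q (hpq : |p - q| ≤ L * |τ - s|) =>
          (l1' p q).trans (mul_le_mul_of_nonneg_left hpq hN0)
        have m2 := fun p q (hpq : |p - q| ≤ L * |τ - s|) =>
          (l2' p q).trans (mul_le_mul_of_nonneg_left hpq hN0)
        have i1 := abs_triple_sub_le hN0 hL (abs_nonneg (τ - s)) (n1' (y.2 - (X τ).2)) b2
          (n2' (y.1 - (X s).1)) (n1' (y.2 - (X s).2)) (m2 _ _ k1) (m1 _ _ k2) h2
        have i2 := abs_triple_sub_le hN0 hL (abs_nonneg (τ - s)) (n2' (y.2 - (X τ).2)) b1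
          (n1' (y.1 - (X s).1)) (n2' (y.2 - (X s).2)) (m1 _ _ k1) (m2 _ _ k2) h1
        simp only [hJ]
        have e : ∀ p q r s : ℝ, p - q - (r - s) = (p - r) - (q - s) := fun _ _ _ _ => by ring
        rw [e, add_mul]
        exact (abs_sub _ _).trans (add_le_add i1 i2)
      · rw [hzero _ hτ y hy, hzero _ hs y hy]
        simp [hy]
    · refine (integrable_indicator_iff Metric.isClosed_closedBall.measurableSet).2 ?_
      exact integrableOn_const (isCompact_closedBall _ _).measure_lt_top.ne
    · refine Eventually.of_forall fun y => ?_
      have h1 : HasDerivAt (fun τ => (v τ y).1) (a y).1 t := by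
        simpa using (hm y).hasFDerivAt.fst.hasDerivAt
      have h2 : HasDerivAt (fun τ => (v τ y).2) (a y).2 t := by
        simpa using (hm y).hasFDerivAt.snd.hasDerivAt
      have e1 := fun {G G' : ℝ → ℝ} (hG : IsBump G G') =>
        HasDerivAt.comp t (hG.hasDerivAt (y.1 - (X t).1)) (hX1.const_sub y.1)
      have e2 := fun {G G' : ℝ → ℝ} (hG : IsBump G G') =>
        HasDerivAt.comp t (hG.hasDerivAt (y.2 - (X t).2)) (hX2.const_sub y.2)
      have := (((e1 hB').mul (e2 hB)).mul h2).sub (((e1 hB).mul (e2 hB')).mul h1)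
      refine (this.congr_deriv ?_)
      simp only [hJ', hf₁, hf₂, hf₃, Function.comp_apply, Pi.mul_apply]
      ring
  have i1 := integral_mul_curl (sB' (X t).1) (sB (X t).2) (hv.contDiff t ht')
    (hv.norm_fderiv_le ht')
  have i2 := integral_mul_curl (sB (X t).1) (sB' (X t).2) (hv.contDiff t ht')
    (hv.norm_fderiv_le ht')
  have i3 := val _ _ _ _ (sB (X t).1) (sB (X t).2)
  have s0 := hasCompactSupport_prod_mul (sB (X t).1).compact (sB (X t).2).compact
  have s1 := hasCompactSupport_prod_mul (sB' (X t).1).compact (sB (X t).2).compact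
  have s2 := hasCompactSupport_prod_mul (sB (X t).1).compact (sB' (X t).2).compact
  have s3 := hasCompactSupport_prod_mul (sB' (X t).1).compact (sB' (X t).2).compact
  have s4 := hasCompactSupport_prod_mul (sB' (X t).1).compact_deriv (sB (X t).2).compact
  have s5 := hasCompactSupport_prod_mul (sB (X t).1).compact (sB' (X t).2).compact_deriv
  have I1 : Integrable f₁ :=
    (Continuous.integrable_of_hasCompactSupport (by fun_prop) s4.mul_right).sub
      (Continuous.integrable_of_hasCompactSupport (by fun_prop) s3.mul_right)
  have I2 : Integrable f₂ :=
    (Continuous.integrable_of_hasCompactSupport (by fun_prop) s3.mul_right).sub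
      (Continuous.integrable_of_hasCompactSupport (by fun_prop) s5.mul_right)
  have I3 : Integrable f₃ :=
    (integrable_mul_of_compact_of_bound (by fun_prop) s1
        ham.snd.aestronglyMeasurable fun y => (norm_snd_le _).trans (haL y)).sub
        (integrable_mul_of_compact_of_bound (by fun_prop) s2
        ham.fst.aestronglyMeasurable fun y => (norm_fst_le _).trans (haL y))
  have J1 : Integrable (fun y : ℝ × ℝ =>
      (B' (y.1 - (X t).1) * B (y.2 - (X t).2)) * curl (v t) y) :=
    Continuous.integrable_of_hasCompactSupport (by fun_prop) s1.mul_right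
  have J2 : Integrable (fun y : ℝ × ℝ =>
      (B (y.1 - (X t).1) * B' (y.2 - (X t).2)) * curl (v t) y) :=
    Continuous.integrable_of_hasCompactSupport (by fun_prop) s2.mul_right
  have J3 : Integrable (fun y : ℝ × ℝ =>
      ((B' (y.1 - (X t).1) * B (y.2 - (X t).2)) * (v t y).1 +
        (B (y.1 - (X t).1) * B' (y.2 - (X t).2)) * (v t y).2) * curl (v t) y) := by
    simp only [add_mul]
    exact (Continuous.integrable_of_hasCompactSupport (by fun_prop) s1.mul_right.mul_right).add
      (Continuous.integrable_of_hasCompactSupport (by fun_prop) s2.mul_right.mul_right)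
  have fin : (∫ y, J' y) =
      ∫ y : ℝ × ℝ, ((B' (y.1 - (X t).1) * B (y.2 - (X t).2)) * ((v t y).1 - (v t (X t)).1) +
        (B (y.1 - (X t).1) * B' (y.2 - (X t).2)) * ((v t y).2 - (v t (X t)).2)) *
        curl (v t) y := by
    have A12 : Integrable (fun y => -(v t (X t)).1 * f₁ y + -(v t (X t)).2 * f₂ y) :=
      (I1.const_mul _).add (I2.const_mul _)
    have A34 : Integrable (fun y : ℝ × ℝ =>
        -(v t (X t)).1 * ((B' (y.1 - (X t).1) * B (y.2 - (X t).2)) * curl (v t) y) +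
        -(v t (X t)).2 * ((B (y.1 - (X t).1) * B' (y.2 - (X t).2)) * curl (v t) y)) :=
      (J1.const_mul _).add (J2.const_mul _)
    rw [integral_add A12 I3, integral_add (I1.const_mul _) (I2.const_mul _), integral_const_mul,
      integral_const_mul, ← i1, ← i2, i3, ← integral_const_mul, ← integral_const_mul,
      ← integral_add (J1.const_mul _) (J2.const_mul _), ← integral_add A34 J3]
    refine integral_congr_ae (Eventually.of_forall fun y => ?_)
    simp only
    ring
  rw [fin] at key
  refine key.congr_of_eventuallyEq ?_
  filter_upwards [hIcc] with τ hτ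
  exact integral_mul_curl (sB _) (sB _) (hv.contDiff τ hτ) (hv.norm_fderiv_le hτ)

end AxisymEuler
end

noncomputable section
namespace AxisymEuler
open scoped Topology
open Filter

variable {t₁ L : ℝ} {v : ℝ → ℝ × ℝ → ℝ × ℝ} {X : ℝ → ℝ × ℝ}

theorem PlanarFlow.continuousOn_curl (hv : PlanarFlow t₁ L v) :
    ContinuousOn (fun q : ℝ × (ℝ × ℝ) => curl (v q.1) q.2) (Icc 0 t₁ ×ˢ univ) := by
  rintro ⟨s, y⟩ ⟨hs, -⟩
  rw [Metric.continuousWithinAt_iff]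
  intro ε hε
  obtain ⟨δ₁, hδ₁, h1⟩ := hv.fderiv_time s hs (ε / 6) (by positivity)
  have h2 := (continuous_curl (hv.contDiff s hs)).continuousAt (x := y)
  rw [Metric.continuousAt_iff] at h2
  obtain ⟨δ₂, hδ₂, h2⟩ := h2 (ε / 2) (by positivity)
  refine ⟨min δ₁ δ₂, lt_min hδ₁ hδ₂, ?_⟩
  rintro ⟨τ, x⟩ ⟨hτ, -⟩ hd
  rw [Prod.dist_eq] at hd
  have d1 := (le_max_left _ _).trans_lt hd |>.trans_le (min_le_left _ _)
  have d2 := (le_max_right _ _).trans_lt hd |>.trans_le (min_le_right _ _)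
  simp only at d1 d2
  rw [Real.dist_eq] at d1
  have e1 := h1 τ hτ d1 x
  have e2 := h2 d2
  rw [Real.dist_eq] at e2 ⊢
  have e3 : |curl (v τ) x - curl (v s) x| ≤ 2 * (ε / 6) := by
    have k1 := (norm_fst_le _).trans
      ((fderiv ℝ (v τ) x - fderiv ℝ (v s) x).le_of_opNorm_le e1 (0, 1))
    have k2 := (norm_snd_le _).trans
      ((fderiv ℝ (v τ) x - fderiv ℝ (v s) x).le_of_opNorm_le e1 (1, 0))
    rw [norm_e2, mul_one, Real.norm_eq_abs] at k1
    rw [norm_e1, mul_one, Real.norm_eq_abs] at k2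
    simp only [sub_apply, Prod.fst_sub, Prod.snd_sub] at k1 k2
    unfold curl
    rw [abs_le] at *
    constructor <;> linarith [k1.1, k1.2, k2.1, k2.2]
  have := abs_sub_le (curl (v τ) x) (curl (v s) x) (curl (v s) y)
  simp only
  linarith

/-- A bound for the integral of a function supported in a square of side `2 ε`. -/
theorem abs_integral_le_of_closedBall {f : ℝ × ℝ → ℝ} {x : ℝ × ℝ} {ε c : ℝ} (hε : 0 ≤ ε)
    (h0 : ∀ y ∉ Metric.closedBall x ε, f y = 0) (hc : ∀ y ∈ Metric.closedBall x ε, |f y| ≤ c) :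
    |∫ y, f y| ≤ c * (4 * ε ^ 2) := by
  rw [← setIntegral_eq_integral_of_forall_compl_eq_zero h0]
  have hvol : volume.real (Metric.closedBall x ε) = 4 * ε ^ 2 := by
    rw [← closedBall_prod_same, measureReal_def, Measure.volume_eq_prod, Measure.prod_prod,
      Real.volume_closedBall, Real.volume_closedBall, ENNReal.toReal_mul,
      ENNReal.toReal_ofReal (by positivity)]
    ring
  rw [← hvol]
  exact norm_setIntegral_le_of_norm_le_const (μ := volume) (f := f)
    (isCompact_closedBall x ε).measure_lt_top hc

theorem exists_unit_bump : ∃ b b' b'' : ℝ → ℝ, IsBump b b' ∧ IsBump b' b'' ∧ (∀ x, 0 ≤ b x) ∧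
    (∫ x, b x) = 1 ∧ (∀ x, 1 < |x| → b x = 0) ∧ (∀ x, 1 < |x| → b' x = 0) := by
  let f : ContDiffBump (0 : ℝ) := ⟨1 / 2, 1, by norm_num, by norm_num⟩
  set b := f.normed volume with hb
  have hbs : ContDiff ℝ 2 b := f.contDiff_normed
  have hbc : HasCompactSupport b := f.hasCompactSupport_normed
  have hb1 : ContDiff ℝ 1 (deriv b) := ContDiff.deriv' hbs
  have hts : ∀ x, 1 < |x| → x ∉ tsupport b := fun x hx hx' => by
    rw [hb, f.tsupport_normed_eq] at hx'
    simp at hx'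
    exact absurd hx' (not_le.2 hx)
  refine ⟨b, deriv b, deriv (deriv b), ⟨fun x => ?_, ?_, hbc⟩, ⟨fun x => ?_, ?_, hbc.deriv⟩,
    fun x => f.nonneg_normed x, f.integral_normed, fun x hx => ?_, fun x hx => ?_⟩
  · exact (hbs.differentiable two_ne_zero x).hasDerivAt
  · exact hb1.continuous
  · exact (hb1.differentiable one_ne_zero x).hasDerivAt
  · exact hb1.continuous_deriv le_rfl
  · exact image_eq_zero_of_notMem_tsupport (hts x hx)
  · refine image_eq_zero_of_notMem_tsupport fun h => hts x hx ?_
    exact tsupport_deriv_subset h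

theorem IsBump.scale {b b' : ℝ → ℝ} (h : IsBump b b') {ε : ℝ} (hε : 0 < ε) (c : ℝ) :
    IsBump (fun x => c * b (x / ε)) (fun x => c / ε * b' (x / ε)) where
  hasDerivAt x := by
    have h1 : HasDerivAt (fun x : ℝ => x / ε) (1 / ε) x := (hasDerivAt_id x).div_const ε
    have := (HasDerivAt.comp x (h.hasDerivAt (x / ε)) h1).const_mul c
    refine this.congr_deriv ?_
    ring
  continuous_deriv := by
    have := h.continuous_deriv
    fun_prop
  compact := by
    have h1 : HasCompactSupport (fun x => b (x / ε)) := by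
      simpa only [div_eq_mul_inv] using! h.compact.comp_homeomorph (Homeomorph.mulRight₀ ε⁻¹ (inv_ne_zero hε.ne'))
    exact h1.mul_left

theorem integral_scaled_shift {b : ℝ → ℝ} (h1 : ∫ x, b x = 1) {ε : ℝ} (hε : 0 < ε) (c : ℝ) :
    ∫ x, 1 / ε * b ((x - c) / ε) = 1 := by
  rw [integral_const_mul, integral_sub_right_eq_self (fun x => b (x / ε)) c,
    Measure.integral_comp_div, h1, abs_of_pos hε]
  simp [hε.ne']

/-- Along a trajectory, the increment of the vorticity is controlled by the vorticity itself:
its material derivative is `- η div v`. -/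
theorem PlanarFlow.exists_curl_increment (hv : PlanarFlow t₁ L v) :
    ∃ C, 0 ≤ C ∧ ∀ X, IsTrajectory t₁ v X → ∀ s ∈ Ioo 0 t₁, ∀ t ∈ Ioo 0 t₁, s ≤ t → ∀ m,
      (∀ τ ∈ Icc s t, |curl (v τ) (X τ)| ≤ m) →
      |curl (v t) (X t) - curl (v s) (X s)| ≤ C * m * (t - s) := by
  obtain ⟨b, b', b'', hb, hb', b0, bi, z, z'⟩ := exists_unit_bump
  obtain ⟨N₁, -, hN₁, -, n1, -, -⟩ := hb.exists_bounds
  obtain ⟨N₂, -, hN₂, -, n2, -, -⟩ := hb'.exists_bounds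
  set N := max N₁ N₂ with hN
  have hN0 : 0 ≤ N := hN₁.trans (le_max_left _ _)
  have hL := hv.nonneg
  refine ⟨8 * N ^ 2 * L, by positivity, fun X hX s hs t ht hst m hm => ?_⟩
  have hsub : Icc s t ⊆ Ioo 0 t₁ := fun τ hτ => ⟨hs.1.trans_le hτ.1, hτ.2.trans_lt ht.2⟩
  have hsub' : Icc s t ⊆ Icc 0 t₁ := hsub.trans Ioo_subset_Icc_self
  have hm0 : 0 ≤ m := (abs_nonneg _).trans (hm s ⟨le_rfl, hst⟩)
  have hts : 0 ≤ t - s := sub_nonneg.2 hst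
  refine le_of_forall_pos_le_add fun e he => ?_
  set κ := e / (2 + 8 * N ^ 2 * L * (t - s)) with hκ
  have hκ0 : 0 < κ := by positivity
  have hκe : 2 * κ + 8 * N ^ 2 * L * (t - s) * κ = e := by
    rw [← add_mul, hκ, mul_div_cancel₀]; positivity
  -- uniform continuity of the vorticity near the trajectory
  have hg : ContinuousOn (fun q : ℝ × (ℝ × ℝ) => curl (v q.1) (X q.1 + q.2))
      (Icc s t ×ˢ Metric.closedBall 0 1) := by
    have hc : ContinuousOn (fun q : ℝ × (ℝ × ℝ) => (q.1, X q.1 + q.2))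
        (Icc s t ×ˢ Metric.closedBall 0 1) := by
      have h1 : ContinuousOn (fun q : ℝ × (ℝ × ℝ) => X q.1) (Icc s t ×ˢ Metric.closedBall 0 1) :=
        (hX.continuousOn.mono hsub').comp continuousOn_fst fun q hq => hq.1
      exact continuousOn_fst.prodMk (h1.add continuousOn_snd)
    exact hv.continuousOn_curl.comp hc fun q hq => ⟨hsub' hq.1, mem_univ _⟩
  have hu := (isCompact_Icc.prod (isCompact_closedBall (0 : ℝ × ℝ) 1)).uniformContinuousOn_of_continuous hg
  rw [Metric.uniformContinuousOn_iff] at hu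
  obtain ⟨δ, hδ, hu⟩ := hu κ hκ0
  set ε := min (δ / 2) 1 with hε
  have hε0 : 0 < ε := by positivity
  have near : ∀ τ ∈ Icc s t, ∀ y ∈ Metric.closedBall (X τ) ε,
      |curl (v τ) y - curl (v τ) (X τ)| ≤ κ := by
    intro τ hτ y hy
    rw [mem_closedBall_iff_norm] at hy
    have := hu (τ, y - X τ) ⟨hτ, by simpa using hy.trans (min_le_right _ _)⟩ (τ, 0)
      ⟨hτ, by simp⟩ (by
        rw [Prod.dist_eq]
        simp only [dist_self, dist_zero_right]
        rw [max_eq_right (norm_nonneg _)]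
        exact (hy.trans (min_le_left _ _)).trans_lt (by linarith))
    rw [Real.dist_eq] at this
    simpa using this.le
  -- the bump of scale `ε`
  set B : ℝ → ℝ := fun x => 1 / ε * b (x / ε) with hB
  set B' : ℝ → ℝ := fun x => 1 / ε / ε * b' (x / ε) with hB'
  have HB : IsBump B B' := hb.scale hε0 _
  have HB' : IsBump B' _ := hb'.scale hε0 _
  have zz : ∀ x, ε < |x| → B x = 0 ∧ B' x = 0 := fun x hx => by
    have : 1 < |x / ε| := by rw [abs_div, abs_of_pos hε0, lt_div_iff₀ hε0]; linarith
    simp [hB, hB', z _ this, z' _ this]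
  have nB : ∀ x, |B x| ≤ 1 / ε * N := fun x => by
    rw [hB, abs_mul, abs_of_pos (show 0 < 1 / ε by positivity)]
    exact mul_le_mul_of_nonneg_left ((n1 _).trans (le_max_left _ _)) (by positivity)
  have nB' : ∀ x, |B' x| ≤ 1 / ε / ε * N := fun x => by
    rw [hB', abs_mul, abs_of_pos (show 0 < 1 / ε / ε by positivity)]
    exact mul_le_mul_of_nonneg_left ((n2 _).trans (le_max_right _ _)) (by positivity)
  set F : ℝ → ℝ := fun τ =>
    ∫ y : ℝ × ℝ, (B (y.1 - (X τ).1) * B (y.2 - (X τ).2)) * curl (v τ) y with hF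
  have out : ∀ τ, ∀ y ∉ Metric.closedBall (X τ) ε,
      ε < |y.1 - (X τ).1| ∨ ε < |y.2 - (X τ).2| := fun τ y hy => by
    rw [mem_closedBall_iff_norm, not_le, Prod.norm_def] at hy
    exact lt_max_iff.1 hy
  have hder : ∀ τ ∈ Icc s t, |F t - F s| ≤ 8 * N ^ 2 * L * (m + κ) * (t - s) := by
    intro τ₀ _
    have := (convex_Icc s t).norm_image_sub_le_of_norm_hasDerivWithin_le (f := F)
      (C := 8 * N ^ 2 * L * (m + κ)) (x := s) (y := t)
      (fun τ hτ => (hv.hasDerivAt_integral_moving hX HB HB' (hsub hτ)).hasDerivWithinAt)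
      (fun τ hτ => ?_) ⟨le_rfl, hst⟩ ⟨hst, le_rfl⟩
    · rwa [Real.norm_eq_abs, Real.norm_of_nonneg hts] at this
    · rw [Real.norm_eq_abs]
      refine (abs_integral_le_of_closedBall (x := X τ) (c := 2 * (1 / ε / ε * N * (1 / ε * N)) *
        (L * ε) * (m + κ)) hε0.le (fun y hy => ?_) fun y hy => ?_).trans (le_of_eq ?_)
      · rcases out τ y hy with h | h <;> simp [(zz _ h).1, (zz _ h).2]
      · have c1 : |curl (v τ) y| ≤ m + κ := by
          have h1 := near τ hτ y hy
          have h2 := hm τ hτ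
          have h3 := abs_sub_abs_le_abs_sub (curl (v τ) y) (curl (v τ) (X τ))
          linarith
        rw [mem_closedBall_iff_norm] at hy
        have h0 := (hv.lip_space τ (hsub' hτ) y (X τ)).trans (mul_le_mul_of_nonneg_left hy hL)
        have h1 := (norm_fst_le _).trans h0
        have h2 := (norm_snd_le _).trans h0
        simp only [Prod.fst_sub, Prod.snd_sub, Real.norm_eq_abs] at h1 h2
        have p1 : |B' (y.1 - (X τ).1) * B (y.2 - (X τ).2)| ≤ 1 / ε / ε * N * (1 / ε * N) := by
          rw [abs_mul]
          exact mul_le_mul (nB' _) (nB _) (abs_nonneg _) (by positivity)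
        have p2 : |B (y.1 - (X τ).1) * B' (y.2 - (X τ).2)| ≤ 1 / ε / ε * N * (1 / ε * N) := by
          rw [abs_mul, mul_comm]
          exact mul_le_mul (nB' _) (nB _) (abs_nonneg _) (by positivity)
        rw [abs_mul]
        refine mul_le_mul ?_ c1 (abs_nonneg _) (by positivity)
        refine (abs_add_le _ _).trans ?_
        rw [abs_mul, abs_mul (B (y.1 - (X τ).1) * B' (y.2 - (X τ).2))]
        have q1 := mul_le_mul p1 h1 (abs_nonneg _) (by positivity)
        have q2 := mul_le_mul p2 h2 (abs_nonneg _) (by positivity)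
        linarith
      · field_simp
        ring
  have hval : ∀ τ ∈ Icc s t, |F τ - curl (v τ) (X τ)| ≤ κ := by
    intro τ hτ
    have hc := continuous_curl (hv.contDiff τ (hsub' hτ))
    have cB := HB.continuous
    have cs := hasCompactSupport_prod_mul (HB.shift (X τ).1).compact (HB.shift (X τ).2).compact
    have one : ∫ y : ℝ × ℝ, B (y.1 - (X τ).1) * B (y.2 - (X τ).2) = 1 := by
      rw [Measure.volume_eq_prod, integral_prod_mul (fun x => B (x - (X τ).1))
        (fun x => B (x - (X τ).2)), integral_scaled_shift bi hε0, integral_scaled_shift bi hε0,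
        one_mul]
    have e1 : curl (v τ) (X τ) =
        ∫ y : ℝ × ℝ, (B (y.1 - (X τ).1) * B (y.2 - (X τ).2)) * curl (v τ) (X τ) := by
      rw [integral_mul_const, one, one_mul]
    have i0 : Integrable (fun y : ℝ × ℝ => B (y.1 - (X τ).1) * B (y.2 - (X τ).2)) :=
      Continuous.integrable_of_hasCompactSupport (by fun_prop) cs
    have i1 : Integrable (fun y : ℝ × ℝ => B (y.1 - (X τ).1) * B (y.2 - (X τ).2) *
        curl (v τ) y) := Continuous.integrable_of_hasCompactSupport (by fun_prop) cs.mul_right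
    have i2 := i0.mul_const (curl (v τ) (X τ))
    rw [e1, hF, ← integral_sub i1 i2]
    have : κ = ∫ y : ℝ × ℝ, (B (y.1 - (X τ).1) * B (y.2 - (X τ).2)) * κ := by
      rw [integral_mul_const, one, one_mul]
    rw [this, ← Real.norm_eq_abs]
    refine norm_integral_le_of_norm_le (i0.mul_const κ) (Eventually.of_forall fun y => ?_)
    have Bn : ∀ x, 0 ≤ B x := fun x => mul_nonneg (by positivity) (b0 _)
    rw [← mul_sub, norm_mul, Real.norm_of_nonneg (mul_nonneg (Bn _) (Bn _)), Real.norm_eq_abs]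
    by_cases hy : y ∈ Metric.closedBall (X τ) ε
    · exact mul_le_mul_of_nonneg_left (near τ hτ y hy) (mul_nonneg (Bn _) (Bn _))
    · rcases out τ y hy with h | h <;> simp [(zz _ h).1]
  have k1 := hval s ⟨le_rfl, hst⟩
  have k2 := hval t ⟨hst, le_rfl⟩
  have k3 := hder s ⟨le_rfl, hst⟩
  have k4 : 8 * N ^ 2 * L * (m + κ) * (t - s) = 8 * N ^ 2 * L * m * (t - s) +
    8 * N ^ 2 * L * (t - s) * κ := by ring
  rw [abs_le] at *
  constructor <;> linarith [k1.1, k1.2, k2.1, k2.2, k3.1, k3.2]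

/-- A continuous function whose increments are controlled by its size cannot vanish at one point
without vanishing identically. -/
theorem eq_zero_of_increment_le {h : ℝ → ℝ} {C : ℝ} (hC : 0 ≤ C)
    (hc : ContinuousOn h (Icc 0 t₁))
    (H : ∀ s ∈ Ioo 0 t₁, ∀ t ∈ Ioo 0 t₁, s ≤ t → ∀ m, (∀ τ ∈ Icc s t, |h τ| ≤ m) →
      |h t - h s| ≤ C * m * (t - s)) {t₀ : ℝ} (ht₀ : t₀ ∈ Icc 0 t₁) (h0 : h t₀ = 0) :
    ∀ t ∈ Icc 0 t₁, h t = 0 := by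
  -- the increment bound extends to the closed interval
  have H' : ∀ s ∈ Icc 0 t₁, ∀ t ∈ Icc 0 t₁, s ≤ t → ∀ m, (∀ τ ∈ Icc s t, |h τ| ≤ m) →
      |h t - h s| ≤ C * m * (t - s) := by
    intro s hs t ht hst m hm
    rcases hst.eq_or_lt with rfl | hst
    · simp
    have m0 : 0 ≤ m := (abs_nonneg _).trans (hm s ⟨le_rfl, hst.le⟩)
    have T1 : Tendsto (fun θ : ℝ => s + θ) (𝓝[>] 0) (𝓝[Icc 0 t₁] s) := by
      refine tendsto_nhdsWithin_iff.2 ⟨?_, ?_⟩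
      · have : Tendsto (fun θ : ℝ => s + θ) (𝓝 0) (𝓝 (s + 0)) := by
          exact (continuous_const.add continuous_id).tendsto 0
        rw [add_zero] at this
        exact this.mono_left nhdsWithin_le_nhds
      · filter_upwards [Ioo_mem_nhdsGT (sub_pos.2 hst)] with θ hθ
        exact ⟨by linarith [hs.1, hθ.1], by linarith [ht.2, hθ.2]⟩
    have T2 : Tendsto (fun θ : ℝ => t - θ) (𝓝[>] 0) (𝓝[Icc 0 t₁] t) := by
      refine tendsto_nhdsWithin_iff.2 ⟨?_, ?_⟩
      · have : Tendsto (fun θ : ℝ => t - θ) (𝓝 0) (𝓝 (t - 0)) := by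
          exact (continuous_const.sub continuous_id).tendsto 0
        rw [sub_zero] at this
        exact this.mono_left nhdsWithin_le_nhds
      · filter_upwards [Ioo_mem_nhdsGT (sub_pos.2 hst)] with θ hθ
        exact ⟨by linarith [hs.1, hθ.2], by linarith [ht.2, hθ.1]⟩
    have T := ((hc t ht).tendsto.comp T2).sub ((hc s hs).tendsto.comp T1)
    refine le_of_tendsto T.abs ?_
    filter_upwards [Ioo_mem_nhdsGT (half_pos (sub_pos.2 hst))] with θ hθ
    have := H (s + θ) ⟨by linarith [hs.1, hθ.1], by linarith [ht.2, hθ.2]⟩ (t - θ)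
      ⟨by linarith [hs.1, hθ.2], by linarith [ht.2, hθ.1]⟩ (by linarith [hθ.2]) m
      (fun τ hτ => hm τ ⟨by linarith [hτ.1, hθ.1], by linarith [hτ.2, hθ.1]⟩)
    refine this.trans (mul_le_mul_of_nonneg_left (by linarith [hθ.1]) (by positivity))
  -- the zero set is open
  set δ := 1 / (2 * (C + 1)) with hδ
  have hδ0 : 0 < δ := by positivity
  have hCδ : C * δ ≤ 1 / 2 := by
    rw [hδ, mul_one_div, div_le_div_iff₀ (by positivity) (by norm_num)]; linarith
  have loc : ∀ s ∈ Icc 0 t₁, h s = 0 → ∀ t ∈ Icc 0 t₁, |t - s| ≤ δ → h t = 0 := by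
    intro s hs h0 t ht hts
    have hne : (Icc 0 t₁ ∩ Icc (s - δ) (s + δ)).Nonempty := ⟨s, hs, by linarith, by linarith⟩
    have hK : IsCompact (Icc 0 t₁ ∩ Icc (s - δ) (s + δ)) := isCompact_Icc.inter isCompact_Icc
    obtain ⟨τ₀, hτ₀, hmax⟩ := hK.exists_isMaxOn hne (hc.abs.mono inter_subset_left)
    have hmax' : ∀ τ ∈ Icc 0 t₁ ∩ Icc (s - δ) (s + δ), |h τ| ≤ |h τ₀| := fun τ hτ => hmax hτ
    have hz : |h τ₀| ≤ C * |h τ₀| * δ := by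
      rcases le_total s τ₀ with hle | hle
      · have := H' s hs τ₀ hτ₀.1 hle |h τ₀| fun τ hτ => hmax' τ
          ⟨⟨hs.1.trans hτ.1, hτ.2.trans hτ₀.1.2⟩, by linarith [hτ.1], hτ.2.trans hτ₀.2.2⟩
        rw [h0, sub_zero] at this
        exact this.trans (mul_le_mul_of_nonneg_left (by linarith [hτ₀.2.2]) (by positivity))
      · have := H' τ₀ hτ₀.1 s hs hle |h τ₀| fun τ hτ => hmax' τ
          ⟨⟨hτ₀.1.1.trans hτ.1, hτ.2.trans hs.2⟩, hτ₀.2.1.trans hτ.1, by linarith [hτ.2]⟩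
        rw [h0, zero_sub, abs_neg] at this
        exact this.trans (mul_le_mul_of_nonneg_left (by linarith [hτ₀.2.1]) (by positivity))
    have hz0 : |h τ₀| ≤ 0 := by nlinarith [abs_nonneg (h τ₀)]
    rw [abs_le] at hts
    have := hmax' t ⟨ht, by linarith [hts.1], by linarith [hts.2]⟩
    exact abs_nonpos_iff.1 (this.trans hz0)
  -- march along the interval with steps of length `δ`
  have march : ∀ n : ℕ, ∀ t ∈ Icc 0 t₁, |t - t₀| ≤ n * δ → h t = 0 := by
    intro n
    induction n with
    | zero =>
      intro t ht hd
      have : t = t₀ := by simpa [sub_eq_zero] using hd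
      rw [this, h0]
    | succ n ih =>
      intro t ht hd
      push_cast at hd
      rcases le_or_gt |t - t₀| δ with hle | hgt
      · exact loc t₀ ht₀ h0 t ht hle
      · rcases le_total t₀ t with h1 | h1
        · rw [abs_of_nonneg (sub_nonneg.2 h1)] at hd hgt
          have hm : t - δ ∈ Icc 0 t₁ := ⟨by linarith [ht₀.1], by linarith [ht.2]⟩
          refine loc (t - δ) hm (ih _ hm ?_) t ht ?_
          · rw [abs_of_nonneg (by linarith)]; linarith
          · rw [sub_sub_cancel, abs_of_pos hδ0]
        · rw [abs_of_nonpos (sub_nonpos.2 h1)] at hd hgt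
          have hm : t + δ ∈ Icc 0 t₁ := ⟨by linarith [ht.1], by linarith [ht₀.2]⟩
          refine loc (t + δ) hm (ih _ hm ?_) t ht ?_
          · rw [abs_of_nonpos (by linarith)]; linarith
          · rw [sub_add_cancel_left, abs_neg, abs_of_pos hδ0]
  intro t ht
  obtain ⟨n, hn⟩ := exists_nat_ge (|t - t₀| / δ)
  exact march n t ht ((div_le_iff₀ hδ0).1 hn)

/-- The sign of a function as in `eq_zero_of_increment_le` does not change. -/
theorem pos_of_pos_of_zero_rigid {h : ℝ → ℝ} (hc : ContinuousOn h (Icc 0 t₁))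
    (hz : ∀ t₀ ∈ Icc 0 t₁, h t₀ = 0 → ∀ t ∈ Icc 0 t₁, h t = 0) {a b : ℝ} (ha : a ∈ Icc 0 t₁)
    (hb : b ∈ Icc 0 t₁) (hpos : 0 < h a) : 0 < h b := by
  by_contra hneg
  rw [not_lt] at hneg
  have hsub : uIcc a b ⊆ Icc 0 t₁ := uIcc_subset_Icc ha hb
  have := intermediate_value_uIcc (hc.mono hsub)
  have h0 : (0 : ℝ) ∈ uIcc (h a) (h b) := by
    rw [mem_uIcc]; right; exact ⟨hneg, hpos.le⟩
  obtain ⟨c, hc1, hc2⟩ := this h0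
  exact hpos.ne' (hz c (hsub hc1) hc2 a ha)

theorem PlanarFlow.continuousOn_curl_trajectory (hv : PlanarFlow t₁ L v)
    (hX : IsTrajectory t₁ v X) : ContinuousOn (fun t => curl (v t) (X t)) (Icc 0 t₁) :=
  hv.continuousOn_curl.comp (continuousOn_id.prodMk hX.continuousOn)
    fun _ hq => ⟨hq, mem_univ _⟩

/-- Backward trajectories carry the sign of the vorticity and, when the axis `{y | y.1 = 0}` is
invariant, stay on the same side of it. -/
theorem PlanarFlow.exists_origin (hv : PlanarFlow t₁ L v) (h0 : 0 ≤ t₁)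
    (haxis : ∀ t ∈ Icc 0 t₁, ∀ z, (v t (0, z)).1 = 0) {y : ℝ × ℝ} (hy : 0 < y.1) :
    ∃ x : ℝ × ℝ, 0 < x.1 ∧ ‖y - x‖ ≤ L * t₁ ∧ (0 ≤ curl (v 0) x → 0 ≤ curl (v t₁) y) ∧
      (curl (v t₁) y ≠ 0 → curl (v 0) x ≠ 0) := by
  obtain ⟨X, hXy, hX⟩ := hv.exists_trajectory h0 y
  have m0 : (0 : ℝ) ∈ Icc 0 t₁ := ⟨le_rfl, h0⟩
  have m1 : t₁ ∈ Icc 0 t₁ := ⟨h0, le_rfl⟩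
  obtain ⟨C, hC, hinc⟩ := hv.exists_curl_increment
  have hcc := hv.continuousOn_curl_trajectory hX
  have z1 : ∀ t₀ ∈ Icc 0 t₁, curl (v t₀) (X t₀) = 0 → ∀ t ∈ Icc 0 t₁, curl (v t) (X t) = 0 :=
    fun t₀ ht₀ hz => eq_zero_of_increment_le hC hcc (hinc X hX) ht₀ hz
  have hc1 : ContinuousOn (fun t => (X t).1) (Icc 0 t₁) := hX.continuousOn.fst
  have z2 : ∀ t₀ ∈ Icc 0 t₁, (X t₀).1 = 0 → ∀ t ∈ Icc 0 t₁, (X t).1 = 0 := by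
    intro t₀ ht₀ hz
    refine eq_zero_of_increment_le hv.nonneg hc1 (fun s hs t ht hst m hm => ?_) ht₀ hz
    have hsub : Icc s t ⊆ Icc 0 t₁ := fun τ hτ => ⟨hs.1.le.trans hτ.1, hτ.2.trans ht.2.le⟩
    have := (convex_Icc s t).norm_image_sub_le_of_norm_hasDerivWithin_le
      (f := fun t => (X t).1) (f' := fun t => (v t (X t)).1) (C := L * m) (x := s) (y := t)
      (fun τ hτ => by
        have h1 := ((hX τ (hsub hτ)).mono hsub).hasFDerivWithinAt.fst.hasDerivWithinAt
        simpa using h1)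
      (fun τ hτ => by
        have h1 := hv.lip_space τ (hsub hτ) (X τ) (0, (X τ).2)
        have h2 := (norm_fst_le _).trans h1
        rw [Prod.fst_sub, haxis τ (hsub hτ), sub_zero] at h2
        have h3 : ‖X τ - (0, (X τ).2)‖ = |(X τ).1| := by
          rw [Prod.norm_def]; simp
        rw [h3] at h2
        exact h2.trans (mul_le_mul_of_nonneg_left (hm τ hτ) hv.nonneg)) ⟨le_rfl, hst⟩ ⟨hst, le_rfl⟩
    rwa [Real.norm_eq_abs, Real.norm_of_nonneg (sub_nonneg.2 hst)] at this
  refine ⟨X 0, ?_, ?_, fun hp => ?_, fun hp h => hp ?_⟩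
  · exact pos_of_pos_of_zero_rigid hc1 z2 m1 m0 (by rw [hXy]; exact hy)
  · have := hX.lip hv m0 m1
    rwa [hXy, sub_zero, abs_of_nonneg h0] at this
  · by_contra hneg
    rw [not_le] at hneg
    have := pos_of_pos_of_zero_rigid hcc.neg (fun t₀ ht₀ hz t ht => by
      simp only [Pi.neg_apply, neg_eq_zero] at hz ⊢
      exact z1 t₀ ht₀ hz t ht) m1 m0 (by simp only [Pi.neg_apply, hXy]; linarith)
    simp only [Pi.neg_apply] at this
    linarith
  · have := z1 0 m0 h t₁ m1
    rwa [hXy] at this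

end AxisymEuler
end

noncomputable section
namespace AxisymEuler
open scoped Topology RealInnerProductSpace
open Filter

/-! ### Cylindrical coordinates -/

section Coordinates
variable {d : ℕ} [NeZero d]

theorem ax_eq_inner (x : Space d) : ax x = ⟪eZ, x⟫ := by
  simp [ax, eZ, EuclideanSpace.inner_single_left]

theorem norm_eZ : ‖(eZ : Space d)‖ = 1 := by simp [eZ]

theorem ax_eZ : ax (eZ : Space d) = 1 := by simp [ax, eZ]

theorem ax_add (x y : Space d) : ax (x + y) = ax x + ax y := by simp [ax]
theorem ax_sub (x y : Space d) : ax (x - y) = ax x - ax y := by simp [ax]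
theorem ax_smul (c : ℝ) (x : Space d) : ax (c • x) = c * ax x := by simp [ax]

theorem continuous_ax : Continuous (ax (d := d)) := by unfold ax; fun_prop

/-- The orthogonal projection onto the horizontal hyperplane, as a linear map. -/
def horizL : Space d →L[ℝ] Space d :=
  ContinuousLinearMap.id ℝ _ - (EuclideanSpace.proj 0 : Space d →L[ℝ] ℝ).smulRight eZ

theorem horizL_apply (x : Space d) : horizL x = horiz x := by
  simp [horizL, horiz, ax]

theorem continuous_horiz : Continuous (horiz (d := d)) := by
  have : (horiz : Space d → Space d) = horizL := funext fun x => (horizL_apply x).symm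
  rw [this]; exact horizL.continuous

theorem continuous_rad : Continuous (rad (d := d)) := continuous_horiz.norm

theorem rad_nonneg (x : Space d) : 0 ≤ rad x := norm_nonneg _

theorem ax_horiz (x : Space d) : ax (horiz x) = 0 := by
  rw [horiz, ax_sub, ax_smul, ax_eZ]; ring

theorem inner_eZ_horiz (x : Space d) : ⟪eZ, horiz x⟫ = 0 := by
  rw [← ax_eq_inner, ax_horiz]

theorem eq_horiz_add (x : Space d) : x = horiz x + ax x • eZ := by simp [horiz]

theorem inner_horiz_left (x y : Space d) : ⟪horiz x, y⟫ = ⟪horiz x, horiz y⟫ := by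
  conv_lhs => rw [eq_horiz_add y]
  rw [inner_add_right, inner_smul_right, real_inner_comm eZ (horiz x), inner_eZ_horiz]
  simp

theorem ax_eR (x : Space d) : ax (eR x) = 0 := by rw [eR, ax_smul, ax_horiz, mul_zero]

theorem norm_eR_le (x : Space d) : ‖eR x‖ ≤ 1 := by
  rw [eR, norm_smul, norm_inv, Real.norm_of_nonneg (rad_nonneg x)]
  exact inv_mul_le_one_of_le₀ le_rfl (rad_nonneg x)

theorem norm_eR {x : Space d} (h : 0 < rad x) : ‖eR x‖ = 1 := by
  rw [eR, norm_smul, norm_inv, Real.norm_of_nonneg (rad_nonneg x)]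
  exact inv_mul_cancel₀ h.ne'

theorem horiz_sub (x y : Space d) : horiz (x - y) = horiz x - horiz y := by
  rw [← horizL_apply, map_sub, horizL_apply, horizL_apply]

theorem norm_sq_eq (x : Space d) : ‖x‖ ^ 2 = rad x ^ 2 + ax x ^ 2 := by
  conv_lhs => rw [eq_horiz_add x]
  rw [norm_add_sq_real, inner_smul_right, real_inner_comm eZ (horiz x), inner_eZ_horiz, norm_smul, norm_eZ]
  simp [rad]

theorem abs_ax_le (x : Space d) : |ax x| ≤ ‖x‖ := by
  refine abs_le_of_sq_le_sq ?_ (norm_nonneg _)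
  rw [norm_sq_eq]; nlinarith [sq_nonneg (rad x)]

/-- The cylindrical coordinates `(r, z)` of a point. -/
def cyl (x : Space d) : ℝ × ℝ := (rad x, ax x)

theorem continuous_cyl : Continuous (cyl (d := d)) := continuous_rad.prodMk continuous_ax

theorem hasFDerivAt_rad {x : Space d} (h : 0 < rad x) :
    HasFDerivAt (rad (d := d)) (innerSL ℝ (eR x)) x := by
  have h0 : horizL x ≠ 0 := by
    rw [horizL_apply]; exact norm_pos_iff.1 h
  have h1 : HasFDerivAt (fun x : Space d => ‖horizL x‖ ^ 2)
      ((2 • innerSL ℝ (horizL x)).comp horizL) x :=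
    HasFDerivAt.comp x (hasStrictFDerivAt_norm_sq (horizL x)).hasFDerivAt horizL.hasFDerivAt
  have h2 := h1.sqrt (by positivity)
  have e : (fun y : Space d => √(‖horizL y‖ ^ 2)) = rad := by
    funext y
    rw [Real.sqrt_sq (norm_nonneg _), horizL_apply, rad]
  rw [e] at h2
  refine h2.congr_fderiv ?_
  ext y
  rw [Real.sqrt_sq (norm_nonneg _)]
  simp only [smul_apply, ContinuousLinearMap.comp_apply, horizL_apply,
    innerSL_apply_apply, smul_eq_mul, nsmul_eq_mul, eR, inner_smul_left]
  rw [← inner_horiz_left]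
  change 1 / (2 * rad x) * ((2 : ℕ) * ⟪horiz x, y⟫) = _
  simp only [conj_trivial]
  push_cast
  field_simp

theorem hasFDerivAt_ax (x : Space d) :
    HasFDerivAt (ax (d := d)) (EuclideanSpace.proj 0 : Space d →L[ℝ] ℝ) x :=
  (EuclideanSpace.proj 0 : Space d →L[ℝ] ℝ).hasFDerivAt

theorem hasFDerivAt_cyl {x : Space d} (h : 0 < rad x) :
    HasFDerivAt (cyl (d := d))
      ((innerSL ℝ (eR x)).prod (EuclideanSpace.proj 0 : Space d →L[ℝ] ℝ)) x :=
  (hasFDerivAt_rad h).prodMk (hasFDerivAt_ax x)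

end Coordinates

/-! ### Restriction to a meridian plane -/

section Meridian
variable {d : ℕ} [NeZero d]

/-- The second coordinate direction, a fixed horizontal direction. -/
def idx (d : ℕ) [NeZero d] (hd : 3 ≤ d) : Fin d := ⟨1, by omega⟩

/-- The embedding `(r, z) ↦ r e_1 + z e^z` of a meridian plane. -/
def plane (hd : 3 ≤ d) : ℝ × ℝ →L[ℝ] Space d :=
  (ContinuousLinearMap.fst ℝ ℝ ℝ).smulRight (EuclideanSpace.single (idx d hd) 1) +
    (ContinuousLinearMap.snd ℝ ℝ ℝ).smulRight eZ

/-- The orthogonal projection onto the meridian plane. -/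
def toPlane (hd : 3 ≤ d) : Space d →L[ℝ] ℝ × ℝ :=
  (EuclideanSpace.proj (idx d hd) : Space d →L[ℝ] ℝ).prod (EuclideanSpace.proj 0)

variable (hd : 3 ≤ d)

theorem idx_ne : idx d hd ≠ 0 := by
  intro h
  have := congrArg Fin.val h
  simp [idx] at this

theorem plane_apply (y : ℝ × ℝ) :
    plane hd y = y.1 • EuclideanSpace.single (idx d hd) 1 + y.2 • eZ := by simp [plane]

theorem toPlane_apply (x : Space d) : toPlane hd x = (x (idx d hd), ax x) := by
  simp [toPlane, ax]

theorem ax_plane (y : ℝ × ℝ) : ax (plane hd y) = y.2 := by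
  rw [plane_apply, ax_add, ax_smul, ax_smul, ax_eZ]
  simp [ax, (idx_ne hd).symm]

theorem horiz_plane (y : ℝ × ℝ) :
    horiz (plane hd y) = y.1 • EuclideanSpace.single (idx d hd) 1 := by
  rw [horiz, ax_plane, plane_apply]; simp

theorem rad_plane (y : ℝ × ℝ) : rad (plane hd y) = |y.1| := by
  rw [rad, horiz_plane, norm_smul]; simp

theorem eR_plane (y : ℝ × ℝ) :
    eR (plane hd y) = (|y.1|⁻¹ * y.1) • EuclideanSpace.single (idx d hd) 1 := by
  rw [eR, rad_plane, horiz_plane, smul_smul]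

theorem toPlane_plane (y : ℝ × ℝ) : toPlane hd (plane hd y) = y := by
  rw [toPlane_apply, ax_plane, plane_apply]
  ext
  · simp [eZ, idx_ne hd]
  · simp

theorem norm_plane_le (y : ℝ × ℝ) : ‖plane hd y‖ ≤ 2 * ‖y‖ := by
  rw [plane_apply]
  refine (norm_add_le _ _).trans ?_
  rw [norm_smul, norm_smul, norm_eZ]
  have h1 := norm_fst_le y
  have h2 := norm_snd_le y
  simp only [PiLp.norm_single, norm_one, mul_one]
  linarith

theorem norm_toPlane_le (x : Space d) : ‖toPlane hd x‖ ≤ ‖x‖ := by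
  rw [toPlane_apply, Prod.norm_def]
  exact max_le (PiLp.norm_apply_le x _) (abs_ax_le x)

/-- The trace of a vector field on the meridian plane. -/
def meridian (u : Space d → Space d) (y : ℝ × ℝ) : ℝ × ℝ := toPlane hd (u (plane hd y))

variable {hd} {u : Space d → Space d} {vr vz : ℝ → ℝ → ℝ}

theorem IsAxisymNoSwirl.plane_meridian (h : IsAxisymNoSwirl u vr vz) (y : ℝ × ℝ) :
    plane hd (meridian hd u y) = u (plane hd y) := by
  have e : u (plane hd y) =
      plane hd (vr |y.1| y.2 * (|y.1|⁻¹ * y.1), vz |y.1| y.2) := by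
    rw [h (plane hd y), rad_plane, ax_plane, eR_plane, plane_apply, smul_smul]
  rw [meridian, e, toPlane_plane]

theorem IsAxisymNoSwirl.meridian_eq (h : IsAxisymNoSwirl u vr vz) (y : ℝ × ℝ) :
    meridian hd u y = (vr |y.1| y.2 * (|y.1|⁻¹ * y.1), vz |y.1| y.2) := by
  have e : u (plane hd y) =
      plane hd (vr |y.1| y.2 * (|y.1|⁻¹ * y.1), vz |y.1| y.2) := by
    rw [h (plane hd y), rad_plane, ax_plane, eR_plane, plane_apply, smul_smul]
  rw [meridian, e, toPlane_plane]

theorem IsAxisymNoSwirl.meridian_of_pos (h : IsAxisymNoSwirl u vr vz) {y : ℝ × ℝ}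
    (hy : 0 < y.1) : meridian hd u y = (vr y.1 y.2, vz y.1 y.2) := by
  rw [h.meridian_eq, abs_of_pos hy, inv_mul_cancel₀ hy.ne', mul_one]

theorem IsAxisymNoSwirl.meridian_axis (h : IsAxisymNoSwirl u vr vz) (z : ℝ) :
    (meridian hd u (0, z)).1 = 0 := by
  rw [h.meridian_eq]; simp

/-- An axisymmetric field without swirl is determined by its trace on the meridian plane. -/
theorem IsAxisymNoSwirl.eq_meridian (h : IsAxisymNoSwirl u vr vz) {x : Space d}
    (hx : 0 < rad x) :
    u x = (meridian hd u (cyl x)).1 • eR x + (meridian hd u (cyl x)).2 • eZ := by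
  rw [h.meridian_of_pos (y := cyl x) hx, h x]
  rfl

theorem hasFDerivAt_meridian (hu : Differentiable ℝ u) (y : ℝ × ℝ) :
    HasFDerivAt (meridian hd u)
      ((toPlane hd).comp ((fderiv ℝ u (plane hd y)).comp (plane hd))) y :=
  HasFDerivAt.comp y (toPlane hd).hasFDerivAt
    (HasFDerivAt.comp y (hu _).hasFDerivAt (plane hd).hasFDerivAt)

theorem contDiff_meridian (hu : ContDiff ℝ 1 u) : ContDiff ℝ 1 (meridian hd u) :=
  (toPlane hd).contDiff.comp (hu.comp (plane hd).contDiff)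

/-- The vorticity of an axisymmetric field is the curl of its trace on the meridian plane. -/
theorem IsAxisymNoSwirl.curl_meridian (h : IsAxisymNoSwirl u vr vz) (hu : ContDiff ℝ 1 u)
    {y : ℝ × ℝ} (hy : 0 < y.1) : curl (meridian hd u) y = vorticity vr vz y.1 y.2 := by
  have hv := (contDiff_meridian (hd := hd) hu).differentiable one_ne_zero y
  have c1 : HasDerivAt (fun ζ : ℝ => (y.1, ζ)) ((0, 1) : ℝ × ℝ) y.2 :=
    (hasDerivAt_const _ _).prodMk (hasDerivAt_id _)
  have c2 : HasDerivAt (fun ρ : ℝ => (ρ, y.2)) ((1, 0) : ℝ × ℝ) y.1 :=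
    (hasDerivAt_id _).prodMk (hasDerivAt_const _ _)
  have h1 : HasDerivAt (fun ζ => (meridian hd u (y.1, ζ)).1)
      (fderiv ℝ (meridian hd u) y (0, 1)).1 y.2 :=
    HasFDerivAt.comp_hasDerivAt y.2 (f := fun ζ : ℝ => (y.1, ζ)) hv.hasFDerivAt.fst c1
  have h2 : HasDerivAt (fun ρ => (meridian hd u (ρ, y.2)).2)
      (fderiv ℝ (meridian hd u) y (1, 0)).2 y.1 :=
    HasFDerivAt.comp_hasDerivAt y.1 (f := fun ρ : ℝ => (ρ, y.2)) hv.hasFDerivAt.snd c2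
  have e1 : (fun ζ => (meridian hd u (y.1, ζ)).1) = fun ζ => vr y.1 ζ :=
    funext fun ζ => by rw [h.meridian_of_pos (y := (y.1, ζ)) hy]
  have e2 : (fun ρ => (meridian hd u (ρ, y.2)).2) =ᶠ[𝓝 y.1] fun ρ => vz ρ y.2 := by
    filter_upwards [lt_mem_nhds hy] with ρ hρ
    rw [h.meridian_of_pos (y := (ρ, y.2)) hρ]
  rw [vorticity, ← e1, h1.deriv, ← e2.deriv_eq, h2.deriv, curl]

/-- The vorticity vanishes on the axis, because `v^r` is odd and `v^z` even in `r`. -/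
theorem IsAxisymNoSwirl.curl_meridian_axis (h : IsAxisymNoSwirl u vr vz) (hu : ContDiff ℝ 1 u)
    (z : ℝ) : curl (meridian hd u) (0, z) = 0 := by
  have hv := (contDiff_meridian (hd := hd) hu).differentiable one_ne_zero (0, z)
  have c1 : HasDerivAt (fun ζ : ℝ => ((0 : ℝ), ζ)) ((0, 1) : ℝ × ℝ) z :=
    (hasDerivAt_const _ _).prodMk (hasDerivAt_id _)
  have c2 : HasDerivAt (fun ρ : ℝ => (ρ, z)) ((1, 0) : ℝ × ℝ) 0 :=
    (hasDerivAt_id _).prodMk (hasDerivAt_const _ _)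
  have h1 : HasDerivAt (fun ζ => (meridian hd u (0, ζ)).1)
      (fderiv ℝ (meridian hd u) (0, z) (0, 1)).1 z :=
    HasFDerivAt.comp_hasDerivAt z (f := fun ζ : ℝ => ((0 : ℝ), ζ)) hv.hasFDerivAt.fst c1
  have h2 : HasDerivAt (fun ρ => (meridian hd u (ρ, z)).2)
      (fderiv ℝ (meridian hd u) (0, z) (1, 0)).2 0 :=
    HasFDerivAt.comp_hasDerivAt (0 : ℝ) (f := fun ρ : ℝ => (ρ, z)) hv.hasFDerivAt.snd c2
  have e1 : (fun ζ => (meridian hd u (0, ζ)).1) = fun _ => 0 := funext h.meridian_axis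
  rw [e1] at h1
  have h1' := h1.unique (hasDerivAt_const z 0)
  have h3 : HasDerivAt (fun ρ : ℝ => (meridian hd u (-ρ, z)).2)
      (-(fderiv ℝ (meridian hd u) (0, z) (1, 0)).2) 0 := by
    have h2' : HasDerivAt (fun ρ => (meridian hd u (ρ, z)).2)
      (fderiv ℝ (meridian hd u) (0, z) (1, 0)).2 (-0) := by simpa using h2
    have := HasDerivAt.comp (0 : ℝ) h2' (hasDerivAt_neg (0 : ℝ))
    simpa [Function.comp_def] using! this
  have e3 : (fun ρ : ℝ => (meridian hd u (-ρ, z)).2) = fun ρ => (meridian hd u (ρ, z)).2 := by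
    funext ρ; rw [h.meridian_eq, h.meridian_eq]; simp
  rw [e3] at h3
  have h4 := h2.unique h3
  unfold curl
  linarith

/-- The scalar vorticity as a function on `ℝ^d`. -/
theorem IsAxisymNoSwirl.lift_vorticity (h : IsAxisymNoSwirl u vr vz) (hu : ContDiff ℝ 1 u)
    (x : Space d) : lift (vorticity vr vz) x = curl (meridian hd u) (cyl x) := by
  unfold lift
  split_ifs with hx
  · exact (h.curl_meridian hu (y := cyl x) hx).symm
  · have : rad x = 0 := le_antisymm (not_lt.1 hx) (rad_nonneg x)
    rw [cyl, this, h.curl_meridian_axis hu]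

/-- The antisymmetric part of the velocity gradient is `ω (e^r ∧ e^z)`. -/
theorem IsAxisymNoSwirl.fderiv_antisymm (h : IsAxisymNoSwirl u vr vz) (hu : ContDiff ℝ 1 u)
    {x : Space d} (hx : 0 < rad x) (a b : Space d) :
    ⟪fderiv ℝ u x a, b⟫ - ⟪fderiv ℝ u x b, a⟫ =
      curl (meridian hd u) (cyl x) * (ax a * ⟪eR x, b⟫ - ax b * ⟪eR x, a⟫) := by
  set V := meridian hd u with hV
  have hVd := (contDiff_meridian (hd := hd) hu).differentiable one_ne_zero (cyl x)
  have hc := hVd.hasFDerivAt.comp x (hasFDerivAt_cyl hx)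
  set D := fderiv ℝ V (cyl x) with hD
  have hA := hc.fst
  have hB := hc.snd
  have hinv : HasFDerivAt (fun y : Space d => (rad y)⁻¹)
      (-(rad x ^ 2)⁻¹ • innerSL ℝ (eR x)) x :=
    (hasDerivAt_inv hx.ne').comp_hasFDerivAt x (hasFDerivAt_rad hx)
  have heR := (hinv.smul ((horizL (d := d)).hasFDerivAt (x := x))).congr_of_eventuallyEq
    (f₁ := eR (d := d)) (Eventually.of_forall fun y => by simp [eR, horizL_apply])
  have hU := (hA.smul heR).add (hB.smul_const (eZ : Space d))
  have heq : u =ᶠ[𝓝 x] fun y => (V (cyl y)).1 • eR y + (V (cyl y)).2 • eZ := by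
    filter_upwards [continuous_rad.continuousAt.eventually (lt_mem_nhds hx)] with y hy
    exact h.eq_meridian hy
  have hfd := (hU.congr_of_eventuallyEq heq).fderiv
  have lin : ∀ w : ℝ × ℝ, D w = w.1 • D (1, 0) + w.2 • D (0, 1) := fun w => by
    rw [← map_smul, ← map_smul, ← map_add]; simp
  have key : ∀ a b : Space d, ⟪fderiv ℝ u x a, b⟫ =
      (⟪eR x, a⟫ * (D (1, 0)).1 + ax a * (D (0, 1)).1) * ⟪eR x, b⟫ +
      (V (cyl x)).1 * (rad x)⁻¹ * (⟪horiz a, horiz b⟫ - ⟪eR x, a⟫ * ⟪eR x, b⟫) +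
      (⟪eR x, a⟫ * (D (1, 0)).2 + ax a * (D (0, 1)).2) * ax b := by
    intro a b
    rw [hfd, ax_eq_inner b, ← inner_horiz_left a b]
    have e1 : horiz x = rad x • eR x := by
      rw [eR, smul_smul, mul_inv_cancel₀ hx.ne', one_smul]
    have e2 : D (⟪eR x, a⟫, (EuclideanSpace.proj 0 : Space d →L[ℝ] ℝ) a) =
      ⟪eR x, a⟫ • D (1, 0) + ax a • D (0, 1) := lin _
    simp only [add_apply, smul_apply,
      ContinuousLinearMap.comp_apply, ContinuousLinearMap.smulRight_apply,
      ContinuousLinearMap.coe_fst', ContinuousLinearMap.coe_snd',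
      ContinuousLinearMap.prod_apply, innerSL_apply_apply, e2, hV,
      horizL_apply, e1, inner_add_left, inner_smul_left, smul_add, smul_smul, smul_eq_mul,
      Function.comp_apply, Prod.fst_add, Prod.snd_add, Prod.smul_fst, Prod.smul_snd,
      conj_trivial]
    field_simp
    ring
  rw [key, key, real_inner_comm (horiz b) (horiz a)]
  unfold curl
  rw [← hD]
  ring

end Meridian

end AxisymEuler
end

noncomputable section
namespace AxisymEuler
open scoped Topology RealInnerProductSpace
open Filter

/-! ### The flow in the meridian plane -/

theorem PlanarFlow.mono {t₁ t₂ L : ℝ} {v : ℝ → ℝ × ℝ → ℝ × ℝ} (hv : PlanarFlow t₁ L v)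
    (h : t₂ ≤ t₁) : PlanarFlow t₂ L v := by
  have hs : Icc 0 t₂ ⊆ Icc 0 t₁ := Icc_subset_Icc_right h
  refine ⟨hv.nonneg, fun t ht => hv.contDiff t (hs ht), fun t ht => hv.bound t (hs ht),
    fun t ht => hv.lip_space t (hs ht), fun t ht s hs' => hv.lip_time t (hs ht) s (hs hs'),
    fun s hs' ε hε => ?_, fun t ht => hv.momentum t ⟨ht.1, ht.2.trans_le h⟩⟩
  obtain ⟨δ, hδ, H⟩ := hv.fderiv_time s (hs hs') ε hε
  exact ⟨δ, hδ, fun t ht => H t (hs ht)⟩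

variable {d : ℕ} [NeZero d]

/-- The trace of an axisymmetric Euler flow without swirl on a meridian plane is a planar flow:
the velocity is tangent to the plane, so the momentum equation restricts to it. -/
theorem IsEulerSolution.planarFlow (hd : 3 ≤ d) {s : ℝ} {T : EReal}
    {u : ℝ → Space d → Space d} {p : ℝ → Space d → ℝ} {ur uz : ℝ → ℝ → ℝ → ℝ}
    (hu : IsEulerSolution s T u p)
    (hax : ∀ t ∈ lifespan T, IsAxisymNoSwirl (u t) (ur t) (uz t)) {t₁ L : ℝ}
    (ht₁ : t₁ ∈ lifespan T) (hc : UniformControl t₁ L u) :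
    PlanarFlow t₁ (2 * L) (fun t => meridian hd (u t)) := by
  have hsub := Icc_subset_lifespan ht₁
  have hL := hc.nonneg
  refine ⟨by positivity, fun t ht => contDiff_meridian (hc.contDiff t ht), fun t ht x => ?_,
    fun t ht x y => ?_, fun t ht τ hτ x => ?_, fun τ hτ ε hε => ?_, fun t ht => ?_⟩
  · have h1 := (norm_toPlane_le hd _).trans (hc.bound t ht (plane hd x))
    exact h1.trans (by linarith)
  · unfold meridian
    rw [← map_sub]
    refine (norm_toPlane_le hd _).trans ((hc.lip_space t ht _ _).trans ?_)
    rw [← map_sub]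
    have := mul_le_mul_of_nonneg_left (norm_plane_le hd (x - y)) hL
    linarith
  · unfold meridian
    rw [← map_sub]
    refine (norm_toPlane_le hd _).trans ((hc.lip_time t ht τ hτ _).trans ?_)
    exact mul_le_mul_of_nonneg_right (by linarith) (abs_nonneg _)
  · obtain ⟨δ, hδ, H⟩ := hc.fderiv_time τ hτ (ε / 2) (by positivity)
    refine ⟨δ, hδ, fun t ht htτ x => ?_⟩
    rw [(hasFDerivAt_meridian ((hc.contDiff t ht).differentiable one_ne_zero) x).fderiv,
      (hasFDerivAt_meridian ((hc.contDiff τ hτ).differentiable one_ne_zero) x).fderiv]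
    refine ContinuousLinearMap.opNorm_le_bound _ hε.le fun w => ?_
    rw [sub_apply, ContinuousLinearMap.comp_apply, ContinuousLinearMap.comp_apply,
      ContinuousLinearMap.comp_apply, ContinuousLinearMap.comp_apply, ← map_sub, ← sub_apply]
    refine (norm_toPlane_le hd _).trans ?_
    refine (ContinuousLinearMap.le_of_opNorm_le _ (H t ht htτ (plane hd x)) _).trans ?_
    have := mul_le_mul_of_nonneg_left (norm_plane_le hd w) (half_pos hε).le
    linarith
  · have ht' := hsub (Ioo_subset_Icc_self ht)
    have hnhds : lifespan T ∈ 𝓝 t := mem_of_superset (Icc_mem_nhds ht.1 ht.2) hsub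
    have hpd := hu.pressure_differentiable t ht'
    refine ⟨fun y => p t (plane hd y), hpd.comp (plane hd).differentiable, fun y => ?_⟩
    have h1 := ((hu.momentum t ht' (plane hd y)).hasDerivAt hnhds)
    have h2 := ((toPlane hd).hasFDerivAt.comp_hasDerivAt t h1)
    refine h2.congr_deriv ?_
    rw [map_sub, map_neg,
      (hasFDerivAt_meridian ((hu.contDiff t ht').differentiable one_ne_zero) y).fderiv]
    simp only [ContinuousLinearMap.comp_apply]
    rw [(hax t ht').plane_meridian]
    congr 1
    have h3 : HasFDerivAt (fun y => p t (plane hd y))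
        ((fderiv ℝ (p t) (plane hd y)).comp (plane hd)) y :=
      HasFDerivAt.comp y (hpd _).hasFDerivAt (plane hd).hasFDerivAt
    have h4 : ∀ w, fderiv ℝ (p t) (plane hd y) w = ⟪gradient (p t) (plane hd y), w⟫ := fun w => by
      rw [gradient, InnerProductSpace.toDual_symm_apply]
    rw [h3.fderiv, toPlane_apply]
    simp only [ContinuousLinearMap.comp_apply, h4]
    have e1 : plane hd (1, 0) = EuclideanSpace.single (idx d hd) (1 : ℝ) := by
      rw [plane_apply]; simp
    have e2 : plane hd (0, 1) = (eZ : Space d) := by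
      rw [plane_apply]; simp
    rw [e1, e2]
    refine Prod.ext ?_ ?_
    · refine ((EuclideanSpace.inner_single_right _ _ _).trans ?_).symm
      simp
    · exact (ax_eq_inner _).trans (real_inner_comm _ _)

/-- Sign and support of the vorticity at later times, on the half plane `r > 0`. -/
theorem IsEulerSolution.vorticity_nonneg_and_support (hd : 3 ≤ d) {s : ℝ} {T : EReal}
    {u : ℝ → Space d → Space d} {p : ℝ → Space d → ℝ} {ur uz : ℝ → ℝ → ℝ → ℝ}
    (hu : IsEulerSolution s T u p)
    (hax : ∀ t ∈ lifespan T, IsAxisymNoSwirl (u t) (ur t) (uz t)) {t₁ L : ℝ}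
    (ht₁ : t₁ ∈ lifespan T) (hc : UniformControl t₁ L u)
    (hpos : ∀ r z, 0 < r → 0 ≤ vorticity (ur 0) (uz 0) r z)
    (hcpt : HasCompactSupport (lift (d := d) (vorticity (ur 0) (uz 0)))) :
    ∃ R, 0 < R ∧ ∀ t ∈ Icc 0 t₁, ∀ y : ℝ × ℝ, 0 < y.1 → 0 ≤ curl (meridian hd (u t)) y ∧
      (curl (meridian hd (u t)) y ≠ 0 → ‖y‖ ≤ R) := by
  have hsub := Icc_subset_lifespan ht₁
  have hflow := hu.planarFlow hd hax ht₁ hc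
  have hL := hc.nonneg
  have h0 : 0 ≤ t₁ := ht₁.1
  have m0 : (0 : ℝ) ∈ Icc 0 t₁ := ⟨le_rfl, h0⟩
  have hax0 := hax 0 (hsub m0)
  have hcd0 := hc.contDiff 0 m0
  obtain ⟨R₀, hR₀⟩ := hcpt.isCompact.isBounded.exists_norm_le
  refine ⟨max R₀ 0 + 2 * L * t₁ + 1, by positivity, fun t ht y hy => ?_⟩
  obtain ⟨x, hx, hyx, h1, h2⟩ := (hflow.mono ht.2).exists_origin ht.1
    (fun τ hτ z => (hax τ (hsub ⟨hτ.1, hτ.2.trans ht.2⟩)).meridian_axis z) hy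
  refine ⟨h1 ?_, fun hne => ?_⟩
  · rw [hax0.curl_meridian hcd0 hx]
    exact hpos _ _ hx
  · have h3 := h2 hne
    have hrad : 0 < rad (plane hd x) := by rw [rad_plane]; exact abs_pos.2 hx.ne'
    have h4 : lift (d := d) (vorticity (ur 0) (uz 0)) (plane hd x) ≠ 0 := by
      rw [hax0.lift_vorticity (hd := hd) hcd0, cyl, rad_plane, ax_plane, abs_of_pos hx]
      exact h3
    have h5 := hR₀ _ (subset_tsupport _ h4)
    have h6 : ‖x‖ ≤ ‖plane hd x‖ := by
      conv_lhs => rw [← toPlane_plane hd x]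
      exact norm_toPlane_le hd _
    have h7 := norm_le_norm_add_norm_sub' y x
    have h8 : 2 * L * t ≤ 2 * L * t₁ := mul_le_mul_of_nonneg_left ht.2 (by positivity)
    have h9 := le_max_left R₀ 0
    linarith

end AxisymEuler
end

noncomputable section
namespace AxisymEuler
open scoped Topology RealInnerProductSpace
open Filter

/-! ### Evolution of radial moments of the vorticity -/

theorem exists_bump_eq_one {R : ℝ} (hR : 0 < R) : ∃ χ χ' : ℝ → ℝ, IsBump χ χ' ∧
    (∀ x, |x| ≤ R → χ x = 1) ∧ (∀ x, |x| ≤ R → χ' x = 0) := by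
  let f : ContDiffBump (0 : ℝ) := ⟨R + 1, R + 2, by linarith, by linarith⟩
  have hone : ∀ x, |x| ≤ R + 1 → f x = 1 := fun x hx =>
    f.one_of_mem_closedBall (by simpa using hx)
  have hf : ContDiff ℝ 1 f := f.contDiff
  refine ⟨f, deriv f, ⟨fun x => (hf.differentiable one_ne_zero x).hasDerivAt,
    hf.continuous_deriv le_rfl, f.hasCompactSupport⟩, fun x hx => hone x (by linarith),
    fun x hx => ?_⟩
  have : (f : ℝ → ℝ) =ᶠ[𝓝 x] fun _ => 1 := by
    filter_upwards [(isOpen_lt continuous_abs continuous_const).mem_nhds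
      (show |x| < R + 1 by linarith)] with y hy
    exact hone y hy.le
  rw [this.deriv_eq]
  simp

section
variable {t₁ L : ℝ} {v : ℝ → ℝ × ℝ → ℝ × ℝ} {g g' : ℝ → ℝ} {R : ℝ}

theorem PlanarFlow.continuousOn_moment (hv : PlanarFlow t₁ L v)
    (hsupp : ∀ t ∈ Icc 0 t₁, ∀ y : ℝ × ℝ, 0 < y.1 → curl (v t) y ≠ 0 → ‖y‖ ≤ R)
    (hg : Continuous g) (h0 : ∀ r ≤ 0, g r = 0) :
    ContinuousOn (fun t => ∫ y : ℝ × ℝ, g y.1 * curl (v t) y) (Icc 0 t₁) := by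
  refine continuousOn_integral_of_compact_support (f := fun t (y : ℝ × ℝ) => g y.1 * curl (v t) y)
    (isCompact_closedBall (0 : ℝ × ℝ) R)
    (ContinuousOn.mul (by fun_prop) hv.continuousOn_curl) fun t y ht hy => ?_
  rcases le_or_gt y.1 0 with h | h
  · simp [h0 _ h]
  · by_contra hne
    exact hy (by simpa using hsupp t ht y h (right_ne_zero_of_mul hne))

/-- The weak vorticity equation with a weight depending on `r` only. The weight need not be compactly
supported, since the vorticity in the half plane is, and the weight vanishes for `r ≤ 0`. -/
theorem PlanarFlow.hasDerivAt_moment (hv : PlanarFlow t₁ L v) (hR : 0 < R)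
    (hsupp : ∀ t ∈ Icc 0 t₁, ∀ y : ℝ × ℝ, 0 < y.1 → curl (v t) y ≠ 0 → ‖y‖ ≤ R)
    (hg : ∀ r, HasDerivAt g (g' r) r) (hg' : Continuous g') (h0 : ∀ r ≤ 0, g r = 0)
    (h0' : ∀ r ≤ 0, g' r = 0) {t : ℝ} (ht : t ∈ Ioo 0 t₁) :
    HasDerivAt (fun τ => ∫ y : ℝ × ℝ, g y.1 * curl (v τ) y)
      (∫ y : ℝ × ℝ, g' y.1 * (v t y).1 * curl (v t) y) t := by
  obtain ⟨χ, χ', hχ, h1, h2⟩ := exists_bump_eq_one hR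
  have hgc : Continuous g := continuous_iff_continuousAt.2 fun x => (hg x).continuousAt
  have hG : IsBump (fun r => g r * χ r) (fun r => g' r * χ r + g r * χ' r) :=
    ⟨fun r => (hg r).mul (hχ.hasDerivAt r),
      (hg'.mul hχ.continuous).add (hgc.mul hχ.continuous_deriv), hχ.compact.mul_left⟩
  have cases : ∀ τ ∈ Icc 0 t₁, ∀ y : ℝ × ℝ, y.1 ≤ 0 ∨ curl (v τ) y = 0 ∨
      (|y.1| ≤ R ∧ |y.2| ≤ R) := by
    intro τ hτ y
    rcases le_or_gt y.1 0 with h | h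
    · exact Or.inl h
    · by_cases hc : curl (v τ) y = 0
      · exact Or.inr (Or.inl hc)
      · have := hsupp τ hτ y h hc
        exact Or.inr (Or.inr ⟨(norm_fst_le y).trans this, (norm_snd_le y).trans this⟩)
  have key := hv.hasDerivAt_integral_curl hG hχ ht
  refine (key.congr_of_eventuallyEq ?_).congr_deriv ?_
  · filter_upwards [Ioo_mem_nhds ht.1 ht.2] with τ hτ
    refine integral_congr_ae (Eventually.of_forall fun y => ?_)
    rcases cases τ (Ioo_subset_Icc_self hτ) y with h | h | ⟨h, h'⟩
    · simp [h0 _ h]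
    · simp [h]
    · simp [h1 _ h, h1 _ h']
  · refine integral_congr_ae (Eventually.of_forall fun y => ?_)
    rcases cases t (Ioo_subset_Icc_self ht) y with h | h | ⟨h, h'⟩
    · simp [h0 _ h, h0' _ h]
    · simp [h]
    · simp [h1 _ h, h1 _ h', h2 _ h, h2 _ h']

end

end AxisymEuler
end

noncomputable section
namespace AxisymEuler
open scoped Topology RealInnerProductSpace
open Filter

/-! ### Integration in polar coordinates -/

section Polar
open scoped Pointwise
variable {E : Type*} [NormedAddCommGroup E] [InnerProductSpace ℝ E] [FiniteDimensional ℝ E]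
  [MeasurableSpace E] [BorelSpace E] [Nontrivial E] (μ : Measure E) [μ.IsAddHaarMeasure]

theorem lintegral_polar {F : E → ℝ≥0∞} (hF : Measurable F) :
    ∫⁻ a, F a ∂μ = ∫⁻ r in Ioi (0 : ℝ), ENNReal.ofReal (r ^ (Module.finrank ℝ E - 1)) *
      ∫⁻ θ : Metric.sphere (0 : E) 1, F (r • (θ : E)) ∂μ.toSphere := by
  have hm : Measurable fun q : Metric.sphere (0 : E) 1 × Ioi (0 : ℝ) => F ((q.2 : ℝ) • (q.1 : E)) :=
    hF.comp (by fun_prop)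
  calc ∫⁻ a, F a ∂μ = ∫⁻ x : ({(0)}ᶜ : Set E), F x ∂(μ.comap (↑)) := by
        rw [lintegral_subtype_comap (measurableSet_singleton _).compl, restrict_compl_singleton]
    _ = ∫⁻ q, F ((q.2 : ℝ) • (q.1 : E)) ∂(μ.toSphere.prod
          (Measure.volumeIoiPow (Module.finrank ℝ E - 1))) := by
        rw [← μ.measurePreserving_homeomorphUnitSphereProd.lintegral_comp_emb
          (Homeomorph.measurableEmbedding _)]
        refine lintegral_congr fun x => ?_
        congr 1
        have := congrArg Subtype.val ((homeomorphUnitSphereProd E).symm_apply_apply x)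
        rw [homeomorphUnitSphereProd_symm_apply_coe] at this
        exact this.symm
    _ = ∫⁻ r, ∫⁻ θ, F ((r : ℝ) • (θ : E)) ∂μ.toSphere
          ∂(Measure.volumeIoiPow (Module.finrank ℝ E - 1)) := lintegral_prod_symm' _ hm
    _ = _ := by
        have hm' : Measurable fun r : Ioi (0 : ℝ) =>
            ∫⁻ θ : Metric.sphere (0 : E) 1, F ((r : ℝ) • (θ : E)) ∂μ.toSphere :=
          hm.lintegral_prod_left'
        rw [Measure.volumeIoiPow, lintegral_withDensity_eq_lintegral_mul _ (by fun_prop) hm',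
          ← lintegral_subtype_comap measurableSet_Ioi]
        rfl

/-- A spherical cap of radius `δ` has measure at most of order `δ^{N-1}`. -/
theorem toSphere_ball_le (hdim : 2 ≤ Module.finrank ℝ E) : ∃ C : ℝ, 0 < C ∧
    ∀ (e : Metric.sphere (0 : E) 1) (δ : ℝ), 0 < δ →
      μ.toSphere (Metric.ball e δ) ≤ ENNReal.ofReal (C * δ ^ (Module.finrank ℝ E - 1)) := by
  set N := Module.finrank ℝ E with hN
  set V : ℝ := μ.real (Metric.ball (0 : E) 1) with hV
  have hV0 : 0 < V := by
    rw [hV, measureReal_def]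
    exact ENNReal.toReal_pos (Metric.measure_ball_pos μ 0 one_pos).ne' measure_ball_lt_top.ne
  have hVe : μ (Metric.ball (0 : E) 1) = ENNReal.ofReal V :=
    (ENNReal.ofReal_toReal measure_ball_lt_top.ne).symm
  have hN1 : N ≠ 0 := by omega
  have hNpos : (0 : ℝ) < N := by positivity
  refine ⟨N * (3 * 2 ^ N) * V, by positivity, fun e δ hδ => ?_⟩
  rcases le_or_gt 1 δ with h1 | h1
  · refine (measure_mono (subset_univ _)).trans ?_
    rw [Measure.toSphere_apply_univ, hVe, ← hN, ← ENNReal.ofReal_natCast,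
      ← ENNReal.ofReal_mul (by positivity)]
    refine ENNReal.ofReal_le_ofReal ?_
    have h2 : (1 : ℝ) ≤ 2 ^ N := one_le_pow₀ (by norm_num)
    have h3 : (1 : ℝ) ≤ δ ^ (N - 1) := one_le_pow₀ h1
    have h4 : (1 : ℝ) ≤ 3 * 2 ^ N * δ ^ (N - 1) := by nlinarith
    have : 0 < N * V := by positivity
    nlinarith
  -- the cone over the cap is covered by the balls of radius `2δ` about the points `kδe`
  rw [Measure.toSphere_apply' _ Metric.isOpen_ball.measurableSet]
  set m := ⌈1 / δ⌉₊ with hm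
  have hcover : Ioo (0 : ℝ) 1 • ((↑) '' Metric.ball e δ : Set E) ⊆
      ⋃ k ∈ Finset.range (m + 1), Metric.ball (((k : ℝ) * δ) • (e : E)) (2 * δ) := by
    rintro _ ⟨r, hr, _, ⟨θ, hθ, rfl⟩, rfl⟩
    have h2 : r / δ < m + 1 := by
      have h3 := Nat.le_ceil (1 / δ)
      have h4 : r / δ ≤ 1 / δ := div_le_div_of_nonneg_right hr.2.le hδ.le
      linarith
    set k := ⌊r / δ⌋₊ with hk
    have hk1 : (k : ℝ) ≤ r / δ := Nat.floor_le (by have := hr.1; positivity)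
    have hk2 : r / δ < k + 1 := Nat.lt_floor_add_one _
    have hkm : k < m + 1 := by
      have : (k : ℝ) < m + 1 := hk1.trans_lt h2
      exact_mod_cast this
    refine mem_biUnion (Finset.mem_coe.2 (Finset.mem_range.2 hkm)) ?_
    rw [le_div_iff₀ hδ] at hk1
    rw [div_lt_iff₀ hδ] at hk2
    rw [Metric.mem_ball, dist_eq_norm]
    have hθ' : ‖(θ : E) - e‖ < δ := by
      rw [← dist_eq_norm]; exact hθ
    have he : ‖(e : E)‖ = 1 := by simp
    calc ‖r • (θ : E) - ((k : ℝ) * δ) • (e : E)‖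
        = ‖r • ((θ : E) - e) + (r - k * δ) • (e : E)‖ := by
          congr 1; rw [smul_sub, sub_smul]; abel
      _ ≤ r * ‖(θ : E) - e‖ + (r - k * δ) := by
          refine (norm_add_le _ _).trans ?_
          rw [norm_smul, norm_smul, he, mul_one, Real.norm_of_nonneg hr.1.le,
            Real.norm_of_nonneg (by linarith)]
      _ < 2 * δ := by
          have : r * ‖(θ : E) - e‖ ≤ 1 * ‖(θ : E) - e‖ :=
            mul_le_mul_of_nonneg_right hr.2.le (norm_nonneg _)
          linarith
  have hball : ∀ x : E, μ (Metric.ball x (2 * δ)) = ENNReal.ofReal ((2 * δ) ^ N * V) := fun x => by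
    rw [Measure.addHaar_ball μ x (by positivity), hVe, ← ENNReal.ofReal_mul (by positivity)]
  have hcount : ((m + 1 : ℕ) : ℝ) ≤ 3 / δ := by
    have h3 := Nat.ceil_lt_add_one (show 0 ≤ 1 / δ by positivity)
    have h4 : 1 ≤ 1 / δ := by rw [le_div_iff₀ hδ]; linarith
    push_cast
    have : 3 / δ = 3 * (1 / δ) := by ring
    linarith
  calc (N : ℝ≥0∞) * μ (Ioo (0 : ℝ) 1 • ((↑) '' Metric.ball e δ : Set E))
      ≤ N * ∑ k ∈ Finset.range (m + 1), μ (Metric.ball (((k : ℝ) * δ) • (e : E)) (2 * δ)) := by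
        gcongr
        exact (measure_mono hcover).trans (measure_biUnion_finset_le _ _)
    _ = ENNReal.ofReal (N * ((m + 1 : ℕ) * ((2 * δ) ^ N * V))) := by
        simp only [hball, Finset.sum_const, Finset.card_range, nsmul_eq_mul]
        rw [ENNReal.ofReal_mul hNpos.le, ENNReal.ofReal_mul (Nat.cast_nonneg (m + 1)),
          ENNReal.ofReal_natCast, ENNReal.ofReal_natCast]
    _ ≤ _ := by
        refine ENNReal.ofReal_le_ofReal ?_
        have h5 : (2 * δ) ^ N * V = 2 ^ N * δ ^ (N - 1) * δ * V := by
          rw [mul_pow, ← pow_sub_one_mul hN1 δ]; ring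
        rw [h5]
        have h6 := mul_le_mul_of_nonneg_right hcount
          (show 0 ≤ N * (2 ^ N * δ ^ (N - 1) * δ * V) by positivity)
        refine le_trans (le_of_eq (by ring)) (h6.trans (le_of_eq ?_))
        field_simp

/-- The kernel `D²(D² + A|θ - e|²)^{-(N+1)/2}` concentrates on the cap of radius `D/√A`, and its
integral over the unit sphere of `ℝ^N` does not depend on `D` up to a constant: the dyadic caps
contribute a geometric series. -/
theorem lintegral_sphere_kernel_le (hdim : 2 ≤ Module.finrank ℝ E) : ∃ C : ℝ, 0 < C ∧
    ∀ (e : Metric.sphere (0 : E) 1) (D A : ℝ), 0 < D → 0 < A →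
      ∫⁻ θ : Metric.sphere (0 : E) 1, ENNReal.ofReal (D ^ 2 *
        (D ^ 2 + A * ‖(θ : E) - e‖ ^ 2) ^ (-(((Module.finrank ℝ E : ℝ) + 1) / 2))) ∂μ.toSphere ≤
      ENNReal.ofReal (C / √A ^ (Module.finrank ℝ E - 1)) := by
  obtain ⟨C, hC, hcap⟩ := toSphere_ball_le μ hdim
  set N := Module.finrank ℝ E with hN
  refine ⟨C * 2 ^ (N + 1) * (4 / 3), by positivity, fun e D A hD hA => ?_⟩
  set a := √A with ha
  have ha0 : 0 < a := Real.sqrt_pos.2 hA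
  have haA : A = a ^ 2 := (Real.sq_sqrt hA.le).symm
  have hpt : ∀ θ : Metric.sphere (0 : E) 1, ENNReal.ofReal (D ^ 2 *
      (D ^ 2 + A * ‖(θ : E) - e‖ ^ 2) ^ (-(((N : ℝ) + 1) / 2))) ≤
      ∑' k : ℕ, (Metric.ball e (2 ^ k * (D / a))).indicator
        (fun _ => ENNReal.ofReal (D ^ 2 * ((2 ^ k * D / 2) ^ (N + 1))⁻¹)) θ := by
    intro θ
    set ρ := ‖(θ : E) - e‖ with hρ
    have hρ0 : 0 ≤ ρ := norm_nonneg _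
    have hex : ∃ k : ℕ, ρ < 2 ^ k * (D / a) := by
      obtain ⟨k, hk⟩ := pow_unbounded_of_one_lt (ρ / (D / a)) (one_lt_two)
      exact ⟨k, (div_lt_iff₀ (by positivity)).1 hk⟩
    classical
    set k := Nat.find hex with hk
    have hk1 : ρ < 2 ^ k * (D / a) := Nat.find_spec hex
    have hlow : (2 ^ k * D / 2) ^ 2 ≤ D ^ 2 + A * ρ ^ 2 := by
      rcases Nat.eq_zero_or_pos k with h0 | h0
      · rw [h0]
        have : 0 ≤ A * ρ ^ 2 := by positivity
        nlinarith [sq_nonneg D]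
      · have h2 : 2 ^ (k - 1) * (D / a) ≤ ρ := not_lt.1 (Nat.find_min hex (m := k - 1) (by omega))
        have h3 : (2 : ℝ) ^ k = 2 ^ (k - 1) * 2 := (pow_sub_one_mul h0.ne' 2).symm
        have h4 : 2 ^ k * D / 2 ≤ a * ρ := by
          rw [h3]
          have := mul_le_mul_of_nonneg_left h2 ha0.le
          refine le_trans (le_of_eq ?_) this
          field_simp
        have h5 := pow_le_pow_left₀ (by positivity) h4 2
        rw [haA]
        nlinarith [sq_nonneg D]
    refine le_trans ?_ (ENNReal.le_tsum k)
    rw [indicator_of_mem]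
    · refine ENNReal.ofReal_le_ofReal (mul_le_mul_of_nonneg_left ?_ (sq_nonneg D))
      refine (Real.rpow_le_rpow_of_nonpos (by positivity) hlow ?_).trans (le_of_eq ?_)
      · have : (0 : ℝ) ≤ N := Nat.cast_nonneg N
        linarith
      · have hb : 0 ≤ 2 ^ k * D / 2 := by positivity
        generalize 2 ^ k * D / 2 = b at hb
        rw [← Real.rpow_natCast b 2, ← Real.rpow_mul hb, ← Real.rpow_natCast b (N + 1),
          ← Real.rpow_neg hb]
        congr 1
        push_cast
        ring
    · rw [Metric.mem_ball, Subtype.dist_eq, dist_eq_norm]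
      exact hk1
  have hterm : ∀ k : ℕ, ENNReal.ofReal (D ^ 2 * ((2 ^ k * D / 2) ^ (N + 1))⁻¹) *
      μ.toSphere (Metric.ball e (2 ^ k * (D / a))) ≤
      ENNReal.ofReal (C * 2 ^ (N + 1) / a ^ (N - 1) * (1 / 4) ^ k) := by
    intro k
    refine (mul_le_mul_right (hcap e _ (by positivity)) _).trans ?_
    rw [← ENNReal.ofReal_mul (by positivity)]
    refine ENNReal.ofReal_le_ofReal (le_of_eq ?_)
    obtain ⟨j, hj⟩ : ∃ j, N = j + 1 := ⟨N - 1, by omega⟩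
    rw [hj, Nat.add_sub_cancel]
    have h4 : ((1 : ℝ) / 4) ^ k = 1 / (2 ^ k) ^ 2 := by
      rw [one_div_pow, ← pow_mul, mul_comm k 2, pow_mul]; norm_num
    rw [h4]
    have hb : (0 : ℝ) < 2 ^ k := by positivity
    generalize (2 : ℝ) ^ k = b at hb
    rw [div_pow, mul_pow, mul_pow, div_pow]
    field_simp
    ring
  calc _ ≤ ∫⁻ θ : Metric.sphere (0 : E) 1, ∑' k : ℕ, (Metric.ball e (2 ^ k * (D / a))).indicator
        (fun _ => ENNReal.ofReal (D ^ 2 * ((2 ^ k * D / 2) ^ (N + 1))⁻¹)) θ ∂μ.toSphere :=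
        lintegral_mono hpt
    _ = ∑' k : ℕ, ENNReal.ofReal (D ^ 2 * ((2 ^ k * D / 2) ^ (N + 1))⁻¹) *
          μ.toSphere (Metric.ball e (2 ^ k * (D / a))) := by
        rw [lintegral_tsum fun k =>
          (measurable_const.indicator Metric.isOpen_ball.measurableSet).aemeasurable]
        exact tsum_congr fun k => lintegral_indicator_const Metric.isOpen_ball.measurableSet _
    _ ≤ ∑' k : ℕ, ENNReal.ofReal (C * 2 ^ (N + 1) / a ^ (N - 1) * (1 / 4) ^ k) :=
        ENNReal.tsum_le_tsum hterm
    _ = _ := by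
        rw [← ENNReal.ofReal_tsum_of_nonneg (fun k => by positivity)
          ((summable_geometric_of_lt_one (by norm_num) (by norm_num)).mul_left _), tsum_mul_left,
          tsum_geometric_of_lt_one (by norm_num) (by norm_num)]
        congr 1
        ring

end Polar

end AxisymEuler
end

noncomputable section
namespace AxisymEuler
open scoped Topology RealInnerProductSpace
open Filter

/-! ### Integration in cylindrical coordinates -/

/-- The open half plane `{(r, z) | r > 0}`. -/
def half : Set (ℝ × ℝ) := {y | 0 < y.1}

theorem measurableSet_half : MeasurableSet half := measurableSet_lt measurable_const measurable_fst

theorem half_eq_prod : half = Ioi (0 : ℝ) ×ˢ (univ : Set ℝ) := by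
  ext y; simp [half]

/-- The area of the unit sphere of `ℝ^{d-1}`. -/
def sphereArea (d : ℕ) : ℝ :=
  (volume : Measure (EuclideanSpace ℝ (Fin (d - 1)))).toSphere.real univ

/-- The point with cylindrical coordinates `(r, z)` and angular coordinate `θ`. -/
def cylPoint {n : ℕ} (y : ℝ × ℝ) (θ : EuclideanSpace ℝ (Fin n)) : Space (n + 1) :=
  WithLp.toLp 2 (Fin.cons y.2 (y.1 • θ).ofLp)

theorem sphereArea_pos {d : ℕ} (hd : 3 ≤ d) : 0 < sphereArea d := by
  have : Nonempty (Fin (d - 1)) := ⟨⟨0, by omega⟩⟩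
  rw [sphereArea, measureReal_def]
  exact ENNReal.toReal_pos (fun h => Measure.toSphere_ne_zero _
    (Measure.measure_univ_eq_zero.1 h)) (measure_ne_top _ _)

theorem norm_sq_cylPoint_sub {n : ℕ} (y y' : ℝ × ℝ) (θ θ' : EuclideanSpace ℝ (Fin n)) :
    ‖cylPoint y θ - cylPoint y' θ'‖ ^ 2 = (y.2 - y'.2) ^ 2 + ‖y.1 • θ - y'.1 • θ'‖ ^ 2 := by
  rw [EuclideanSpace.norm_sq_eq, EuclideanSpace.norm_sq_eq, Fin.sum_univ_succ]
  simp [cylPoint]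

theorem measurable_cylPoint {n : ℕ} :
    Measurable fun q : (ℝ × ℝ) × EuclideanSpace ℝ (Fin n) =>
    cylPoint q.1 q.2 := by
  refine (WithLp.measurable_toLp 2 _).comp (measurable_pi_lambda _ fun i => ?_)
  refine Fin.cases ?_ (fun j => ?_) i
  · exact measurable_fst.snd
  · simp only [Fin.cons_succ]
    fun_prop

theorem norm_sq_cylPoint_sub' {n : ℕ} (y y' : ℝ × ℝ) {θ θ' : EuclideanSpace ℝ (Fin n)} (h : ‖θ‖ = 1)
    (h' : ‖θ'‖ = 1) : ‖cylPoint y θ - cylPoint y' θ'‖ ^ 2 =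
      (y.1 - y'.1) ^ 2 + (y.2 - y'.2) ^ 2 + y.1 * y'.1 * ‖θ - θ'‖ ^ 2 := by
  rw [norm_sq_cylPoint_sub, @norm_sub_sq_real _ _ _ (y.1 • θ), @norm_sub_sq_real _ _ _ θ]
  simp only [norm_smul, inner_smul_left, inner_smul_right, h, h', conj_trivial, mul_one,
    Real.norm_eq_abs, sq_abs]
  ring

section
variable {n : ℕ} [NeZero (n + 1)]

theorem ax_cylPoint (y : ℝ × ℝ) (θ : EuclideanSpace ℝ (Fin n)) : ax (cylPoint y θ) = y.2 := rfl

theorem rad_cylPoint (y : ℝ × ℝ) (θ : EuclideanSpace ℝ (Fin n)) :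
    rad (cylPoint y θ) = ‖y.1 • θ‖ := by
  have h1 := norm_sq_eq (cylPoint y θ)
  have h2 := norm_sq_cylPoint_sub y 0 θ 0
  have h3 : cylPoint (0 : ℝ × ℝ) (0 : EuclideanSpace ℝ (Fin n)) = 0 := by
    ext i
    refine Fin.cases ?_ (fun j => ?_) i <;> simp [cylPoint]
  rw [h3, sub_zero] at h2
  rw [ax_cylPoint] at h1
  simp only [Prod.snd_zero, sub_zero, smul_zero] at h2
  exact (pow_left_inj₀ (rad_nonneg _) (norm_nonneg _) two_ne_zero).1 (by linarith)

theorem exists_eq_cylPoint {x : Space (n + 1)} (hx : 0 < rad x) :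
    ∃ θ : EuclideanSpace ℝ (Fin n), ‖θ‖ = 1 ∧ x = cylPoint (cyl x) θ := by
  set a : EuclideanSpace ℝ (Fin n) := WithLp.toLp 2 (fun i => x i.succ) with ha
  have h1 : x = cylPoint (1, ax x) a := by
    ext i
    refine Fin.cases ?_ (fun j => ?_) i
    · rfl
    · simp [cylPoint, ha]
  have h2 : rad x = ‖a‖ := by
    conv_lhs => rw [h1, rad_cylPoint]
    simp
  have h3 : ‖a‖ ≠ 0 := by rw [← h2]; exact hx.ne'
  refine ⟨‖a‖⁻¹ • a, by rw [norm_smul, norm_inv, norm_norm, inv_mul_cancel₀ h3], ?_⟩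
  conv_lhs => rw [h1]
  rw [cyl, h2]
  simp only [cylPoint, one_smul, smul_smul, mul_inv_cancel₀ h3]

/-- Integration in cylindrical coordinates, keeping the angular variable `θ`. -/
theorem lintegral_cyl_sphere (hn : 2 ≤ n) {F : Space (n + 1) → ℝ≥0∞} (hF : Measurable F) :
    ∫⁻ x, F x = ∫⁻ y in half, ENNReal.ofReal (y.1 ^ (n - 1)) *
      ∫⁻ θ : Metric.sphere (0 : EuclideanSpace ℝ (Fin n)) 1, F (cylPoint y θ)
        ∂(volume : Measure (EuclideanSpace ℝ (Fin n))).toSphere := by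
  have : Nonempty (Fin n) := ⟨⟨0, by omega⟩⟩
  have hFc : Measurable fun q : (ℝ × ℝ) × EuclideanSpace ℝ (Fin n) => F (cylPoint q.1 q.2) :=
    hF.comp measurable_cylPoint
  have e1 : ∫⁻ x, F x = ∫⁻ q : ℝ × EuclideanSpace ℝ (Fin n), F (cylPoint (1, q.1) q.2) := by
    have m1 := PiLp.volume_preserving_toLp (Fin (n + 1))
    have m2 := (volume_preserving_piFinSuccAbove (fun _ : Fin (n + 1) => ℝ) 0).symm
    have m3 : MeasurePreserving (Prod.map id WithLp.ofLp :
        ℝ × EuclideanSpace ℝ (Fin n) → ℝ × (Fin n → ℝ)) volume volume :=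
      (MeasurePreserving.id volume).prod (PiLp.volume_preserving_ofLp (Fin n))
    rw [← ((m1.comp m2).comp m3).lintegral_comp hF]
    refine lintegral_congr fun q => ?_
    congr 1
    ext i
    refine Fin.cases ?_ (fun j => ?_) i <;> simp [cylPoint]
  have hrank : Module.finrank ℝ (EuclideanSpace ℝ (Fin n)) = n := by simp
  have e2 : ∀ z : ℝ, ∫⁻ a : EuclideanSpace ℝ (Fin n), F (cylPoint (1, z) a) =
      ∫⁻ r in Ioi (0 : ℝ), ENNReal.ofReal (r ^ (n - 1)) *
      ∫⁻ θ : Metric.sphere (0 : EuclideanSpace ℝ (Fin n)) 1, F (cylPoint (r, z) θ)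
        ∂(volume : Measure (EuclideanSpace ℝ (Fin n))).toSphere := fun z => by
    rw [lintegral_polar volume (F := fun a => F (cylPoint (1, z) a))
      (hFc.comp (measurable_const.prodMk measurable_id)), hrank]
    simp [cylPoint]
  have hm : Measurable fun y : ℝ × ℝ => ENNReal.ofReal (y.1 ^ (n - 1)) *
      ∫⁻ θ : Metric.sphere (0 : EuclideanSpace ℝ (Fin n)) 1, F (cylPoint y θ)
        ∂(volume : Measure (EuclideanSpace ℝ (Fin n))).toSphere := by
    refine Measurable.mul (by fun_prop) (Measurable.lintegral_prod_right' (f := fun q :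
      (ℝ × ℝ) × Metric.sphere (0 : EuclideanSpace ℝ (Fin n)) 1 => F (cylPoint q.1 q.2)) ?_)
    exact hFc.comp (measurable_fst.prodMk (measurable_subtype_coe.comp measurable_snd))
  rw [e1, Measure.volume_eq_prod, lintegral_prod (fun q : ℝ × EuclideanSpace ℝ (Fin n) =>
    F (cylPoint (1, q.1) q.2)) (hFc.comp
    ((measurable_const.prodMk measurable_fst).prodMk measurable_snd)).aemeasurable]
  simp only [e2]
  rw [half_eq_prod, Measure.volume_eq_prod, ← Measure.prod_restrict, Measure.restrict_univ,
    lintegral_prod_symm' _ hm]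

end

section
variable {d : ℕ} [NeZero d]

theorem lintegral_cyl (hd : 3 ≤ d) {G : ℝ × ℝ → ℝ≥0∞} (hG : Measurable G) :
    ∫⁻ x : Space d, G (cyl x) =
      ENNReal.ofReal (sphereArea d) * ∫⁻ y in half, ENNReal.ofReal (y.1 ^ (d - 2)) * G y := by
  obtain ⟨n, rfl⟩ : ∃ n, d = n + 1 := ⟨d - 1, by omega⟩
  rw [lintegral_cyl_sphere (F := fun x => G (cyl x)) (by omega)
      (hG.comp continuous_cyl.measurable),
    ← lintegral_const_mul _ (by fun_prop)]
  refine setLIntegral_congr_fun measurableSet_half fun y hy => ?_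
  have h : ∀ θ : Metric.sphere (0 : EuclideanSpace ℝ (Fin n)) 1,
      cyl (cylPoint y (θ : EuclideanSpace ℝ (Fin n))) = y := by
    intro θ
    rw [cyl, rad_cylPoint, ax_cylPoint, norm_smul, Real.norm_of_nonneg (le_of_lt hy)]
    simp
  simp only [h, lintegral_const]
  have hσ : (volume : Measure (EuclideanSpace ℝ (Fin n))).toSphere univ =
      ENNReal.ofReal (sphereArea (n + 1)) := (ofReal_measureReal (measure_ne_top _ _)).symm
  rw [hσ, show n + 1 - 2 = n - 1 by omega]
  ring

/-- The image of Lebesgue measure under cylindrical coordinates. -/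
theorem map_cyl (hd : 3 ≤ d) : (volume : Measure (Space d)).map cyl =
    (volume.restrict half).withDensity
      fun y => ENNReal.ofReal (sphereArea d * y.1 ^ (d - 2)) := by
  ext s hs
  rw [Measure.map_apply continuous_cyl.measurable hs, withDensity_apply _ hs,
    ← lintegral_indicator_one (continuous_cyl.measurable hs)]
  have := lintegral_cyl (d := d) hd (G := s.indicator 1) (measurable_one.indicator hs)
  refine Eq.trans (lintegral_congr fun x => ?_) (this.trans ?_)
  · rfl
  · rw [← lintegral_const_mul' _ _ ENNReal.ofReal_ne_top,
      ← lintegral_indicator hs]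
    refine lintegral_congr fun y => ?_
    by_cases hy : y ∈ s
    · simp [hy, ENNReal.ofReal_mul (sphereArea_pos hd).le]
    · simp [hy]

theorem integral_cyl (hd : 3 ≤ d) {G : ℝ × ℝ → ℝ} (hG : Measurable G) :
    ∫ x : Space d, G (cyl x) =
      sphereArea d * ∫ y in half, y.1 ^ (d - 2) * G y := by
  rw [← integral_map continuous_cyl.measurable.aemeasurable hG.aestronglyMeasurable, map_cyl hd,
    integral_withDensity_eq_integral_toReal_smul (by fun_prop) (by simp), ← integral_const_mul]
  refine setIntegral_congr_fun measurableSet_half fun y hy => ?_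
  have hy' : 0 < y.1 := hy
  have := sphereArea_pos hd
  simp only [smul_eq_mul]
  rw [ENNReal.toReal_ofReal (by positivity)]
  ring

/-- The angular average of the kernel `D²|x - y|^{-d}`, `D` the distance in the `(r,z)`-plane. -/
theorem lintegral_cyl_kernel_le (hd : 3 ≤ d) : ∃ C : ℝ, 0 < C ∧ ∀ (x : Space d) (ε : ℝ)
    (G : ℝ × ℝ → ℝ≥0∞), 0 < rad x → Measurable G →
    ∫⁻ y : Space d, G (cyl y) * ENNReal.ofReal (((rad x - rad y) ^ 2 + (ax x - ax y) ^ 2) *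
        (‖x - y‖ ^ 2 + ε ^ 2) ^ (-((d : ℝ) / 2))) ≤
      ∫⁻ y in half, G y * ENNReal.ofReal (y.1 ^ (d - 2) * (C / √(rad x * y.1) ^ (d - 2))) := by
  obtain ⟨n, rfl⟩ : ∃ n, d = n + 1 := ⟨d - 1, by omega⟩
  have : Nonempty (Fin n) := ⟨⟨0, by omega⟩⟩
  have hrank : Module.finrank ℝ (EuclideanSpace ℝ (Fin n)) = n := by simp
  obtain ⟨C, hC, H⟩ := lintegral_sphere_kernel_le
    (volume : Measure (EuclideanSpace ℝ (Fin n))) (by rw [hrank]; omega)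
  rw [hrank] at H
  refine ⟨C, hC, fun x ε G hx hG => ?_⟩
  obtain ⟨θ₀, hθ₀, hxθ⟩ := exists_eq_cylPoint hx
  have hmeas : Measurable fun y : Space (n + 1) => G (cyl y) *
      ENNReal.ofReal (((rad x - rad y) ^ 2 + (ax x - ax y) ^ 2) *
        (‖x - y‖ ^ 2 + ε ^ 2) ^ (-(((n + 1 : ℕ) : ℝ) / 2))) := by
    have h1 := (continuous_rad (d := n + 1)).measurable
    have h2 := (continuous_ax (d := n + 1)).measurable
    have h3 := hG.comp (continuous_cyl (d := n + 1)).measurable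
    exact h3.mul (by fun_prop)
  rw [lintegral_cyl_sphere (by omega) hmeas]
  refine setLIntegral_mono' measurableSet_half fun y hy => ?_
  have hy0 : 0 < y.1 := hy
  have hc : ∀ θ : Metric.sphere (0 : EuclideanSpace ℝ (Fin n)) 1,
      cyl (cylPoint y (θ : EuclideanSpace ℝ (Fin n))) = y := by
    intro θ
    rw [cyl, rad_cylPoint, ax_cylPoint, norm_smul, Real.norm_of_nonneg (le_of_lt hy)]
    simp
  have hr : ∀ θ : Metric.sphere (0 : EuclideanSpace ℝ (Fin n)) 1,
      rad (cylPoint y (θ : EuclideanSpace ℝ (Fin n))) = y.1 := fun θ => congrArg Prod.fst (hc θ)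
  simp only [hc, hr, ax_cylPoint]
  rw [ENNReal.ofReal_mul (by positivity), show n + 1 - 2 = n - 1 by omega, mul_left_comm (G y)]
  refine mul_le_mul_right ?_ _
  rcases eq_or_ne y (cyl x) with rfl | hne
  · simp [cyl]
  have hD : 0 < (rad x - y.1) ^ 2 + (ax x - y.2) ^ 2 := by
    by_contra hle
    have h1 : (rad x - y.1) ^ 2 = 0 := by nlinarith [sq_nonneg (rad x - y.1), sq_nonneg (ax x - y.2)]
    have h2 : (ax x - y.2) ^ 2 = 0 := by nlinarith [sq_nonneg (rad x - y.1), sq_nonneg (ax x - y.2)]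
    refine hne (Prod.ext ?_ ?_)
    · exact (sub_eq_zero.1 (pow_eq_zero_iff two_ne_zero |>.1 h1)).symm
    · exact (sub_eq_zero.1 (pow_eq_zero_iff two_ne_zero |>.1 h2)).symm
  have key := H ⟨θ₀, by simpa using hθ₀⟩ (√((rad x - y.1) ^ 2 + (ax x - y.2) ^ 2)) (rad x * y.1)
    (Real.sqrt_pos.2 hD) (by positivity)
  rw [Real.sq_sqrt hD.le] at key
  have hk : Measurable fun θ : Metric.sphere (0 : EuclideanSpace ℝ (Fin n)) 1 =>
      ENNReal.ofReal (((rad x - y.1) ^ 2 + (ax x - y.2) ^ 2) *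
        (‖x - cylPoint y (θ : EuclideanSpace ℝ (Fin n))‖ ^ 2 + ε ^ 2) ^
          (-(((n + 1 : ℕ) : ℝ) / 2))) := by
    have h1 : Measurable fun θ : Metric.sphere (0 : EuclideanSpace ℝ (Fin n)) 1 =>
        cylPoint y (θ : EuclideanSpace ℝ (Fin n)) :=
      measurable_cylPoint.comp (measurable_const.prodMk measurable_subtype_coe)
    fun_prop
  rw [lintegral_const_mul _ hk]
  refine mul_le_mul_right (le_trans (lintegral_mono fun θ => ?_) key) (G y)
  refine ENNReal.ofReal_le_ofReal (mul_le_mul_of_nonneg_left ?_ hD.le)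
  have hθ : ‖(θ : EuclideanSpace ℝ (Fin n))‖ = 1 := by simp
  have hns : ‖x - cylPoint y (θ : EuclideanSpace ℝ (Fin n))‖ ^ 2 =
      (rad x - y.1) ^ 2 + (ax x - y.2) ^ 2 +
        rad x * y.1 * ‖(θ : EuclideanSpace ℝ (Fin n)) - θ₀‖ ^ 2 := by
    conv_lhs => rw [hxθ, norm_sq_cylPoint_sub' _ _ hθ₀ hθ, norm_sub_rev θ₀]
    rfl
  rw [show (((n + 1 : ℕ) : ℝ) / 2) = ((n : ℝ) + 1) / 2 by push_cast; ring]
  refine Real.rpow_le_rpow_of_nonpos (by positivity) ?_ (by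
    have : (0 : ℝ) ≤ n := Nat.cast_nonneg n
    linarith)
  rw [hns]
  exact le_add_of_nonneg_right (sq_nonneg ε)

end

end AxisymEuler
end

noncomputable section
namespace AxisymEuler
open scoped Topology RealInnerProductSpace
open Filter

/-! ### The regularised interaction kernel -/

/-- A vorticity profile on the half plane `r > 0`: continuous, vanishing on the axis, nonnegative and
supported in a ball. The values for `r < 0` are irrelevant. -/
structure IsProfile (R : ℝ) (η : ℝ × ℝ → ℝ) : Prop where
  continuous : Continuous η
  axis : ∀ z, η (0, z) = 0
  nonneg : ∀ y : ℝ × ℝ, 0 < y.1 → 0 ≤ η y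
  support : ∀ y : ℝ × ℝ, 0 < y.1 → η y ≠ 0 → ‖y‖ ≤ R

section
variable {d : ℕ} [NeZero d]

/-- The kernel of the radial velocity at `x` induced by a vortex ring through `y`, regularised at
the scale `ε`. -/
def ker (ε : ℝ) (x y : Space d) : ℝ :=
  (ax x - ax y) * ⟪eR x, eR y⟫ * (‖x - y‖ ^ 2 + ε ^ 2) ^ (-((d : ℝ) / 2))

theorem ker_swap (ε : ℝ) (x y : Space d) : ker ε y x = -ker ε x y := by
  rw [ker, ker, real_inner_comm, norm_sub_rev]
  ring

theorem measurable_eR : Measurable (eR (d := d)) := by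
  have h1 := (continuous_rad (d := d)).measurable
  have h2 := (continuous_horiz (d := d)).measurable
  exact h1.inv.smul h2

theorem measurable_ker (ε : ℝ) : Measurable fun q : Space d × Space d => ker ε q.1 q.2 := by
  have h1 := (continuous_ax (d := d)).measurable
  have h2 := measurable_eR (d := d)
  have h3 : Measurable fun q : Space d × Space d => ⟪eR q.1, eR q.2⟫ :=
    (h2.comp measurable_fst).inner (h2.comp measurable_snd)
  unfold ker
  fun_prop

theorem abs_inner_eR_le (x y : Space d) : |⟪eR x, eR y⟫| ≤ 1 :=
  (abs_real_inner_le_norm _ _).trans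
    (mul_le_one₀ (norm_eR_le x) (norm_nonneg _) (norm_eR_le y))

theorem abs_ker_le (ε : ℝ) (x y : Space d) :
    |ker ε x y| ≤ |ax x - ax y| * (‖x - y‖ ^ 2 + ε ^ 2) ^ (-((d : ℝ) / 2)) := by
  rw [ker, abs_mul, abs_mul, abs_of_nonneg (Real.rpow_nonneg (by positivity) _)]
  refine mul_le_mul_of_nonneg_right ?_ (Real.rpow_nonneg (by positivity) _)
  exact mul_le_of_le_one_right (abs_nonneg _) (abs_inner_eR_le x y)

theorem abs_ker_le_const {ε : ℝ} (hε : 0 < ε) (x y : Space d) :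
    |ker ε x y| ≤ (ε ^ 2) ^ ((1 - (d : ℝ)) / 2) := by
  have hd : 1 ≤ d := NeZero.one_le
  have hd' : (1 : ℝ) ≤ d := by exact_mod_cast hd
  refine (abs_ker_le ε x y).trans ?_
  set s := ‖x - y‖ ^ 2 + ε ^ 2 with hs
  have hs0 : 0 < s := by positivity
  have h1 : |ax x - ax y| ≤ s ^ ((1 : ℝ) / 2) := by
    rw [← Real.sqrt_eq_rpow]
    refine Real.le_sqrt_of_sq_le ?_
    have h2 := abs_ax_le (x - y)
    rw [ax_sub] at h2
    have h3 := pow_le_pow_left₀ (abs_nonneg _) h2 2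
    nlinarith [sq_nonneg ε]
  calc |ax x - ax y| * s ^ (-((d : ℝ) / 2)) ≤ s ^ ((1 : ℝ) / 2) * s ^ (-((d : ℝ) / 2)) :=
        mul_le_mul_of_nonneg_right h1 (Real.rpow_nonneg hs0.le _)
    _ = s ^ ((1 - (d : ℝ)) / 2) := by
        rw [← Real.rpow_add hs0]; congr 1; ring
    _ ≤ _ := Real.rpow_le_rpow_of_nonpos (by positivity)
        (le_add_of_nonneg_left (sq_nonneg _)) (by linarith)

namespace IsProfile
variable {R : ℝ} {η : ℝ × ℝ → ℝ}

theorem cyl_nonneg (h : IsProfile R η) (x : Space d) : 0 ≤ η (cyl x) := by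
  rcases (rad_nonneg x).eq_or_lt with h0 | h0
  · rw [cyl, ← h0, h.axis]
  · exact h.nonneg _ h0

theorem continuous_cyl (h : IsProfile R η) : Continuous fun x : Space d => η (cyl x) :=
  h.continuous.comp AxisymEuler.continuous_cyl

theorem cyl_support (h : IsProfile R η) {x : Space d} (hx : η (cyl x) ≠ 0) : ‖x‖ ≤ 2 * R := by
  rcases (rad_nonneg x).eq_or_lt with h0 | h0
  · rw [cyl, ← h0, h.axis] at hx
    exact absurd rfl hx
  · have h1 := h.support _ h0 hx
    have h2 : rad x ≤ R := (le_abs_self _).trans ((norm_fst_le (cyl x)).trans h1)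
    have h3 : |ax x| ≤ R := (norm_snd_le (cyl x)).trans h1
    have h4 := norm_sq_eq x
    have h5 := sq_abs (ax x)
    have hR : 0 ≤ R := h0.le.trans h2
    nlinarith [norm_nonneg x, abs_nonneg (ax x)]

theorem hasCompactSupport_cyl (h : IsProfile R η) :
    HasCompactSupport fun x : Space d => η (cyl x) :=
  HasCompactSupport.intro (isCompact_closedBall 0 (2 * R)) fun x hx => by
    by_contra hne
    exact hx (by simpa using h.cyl_support hne)

theorem integrable_cyl_mul (h : IsProfile R η) {g : Space d → ℝ} (hg : Continuous g) :
    Integrable fun x : Space d => η (cyl x) * g x :=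
  (h.continuous_cyl.mul hg).integrable_of_hasCompactSupport h.hasCompactSupport_cyl.mul_right

theorem integrable_cyl (h : IsProfile R η) : Integrable fun x : Space d => η (cyl x) :=
  h.continuous_cyl.integrable_of_hasCompactSupport h.hasCompactSupport_cyl

theorem integrableOn_half (h : IsProfile R η) {g : ℝ → ℝ} (hg : Continuous g) :
    IntegrableOn (fun y : ℝ × ℝ => g y.1 * η y) half := by
  have h1 : IntegrableOn (fun y : ℝ × ℝ => g y.1 * η y) (half ∩ Metric.closedBall 0 R) :=
    (((hg.comp continuous_fst).mul h.continuous).continuousOn.integrableOn_compact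
      (isCompact_closedBall _ _)).mono_set inter_subset_right
  refine h1.of_forall_sdiff_eq_zero measurableSet_half fun y hy => ?_
  by_contra hne
  exact hy.2 ⟨hy.1, by simpa using h.support y hy.1 (right_ne_zero_of_mul hne)⟩

end IsProfile

/-- The half turn about the axis. -/
def halfTurn : Space d ≃ₗᵢ[ℝ] Space d := (ℝ ∙ (eZ : Space d)).reflection

theorem halfTurn_apply (y : Space d) : halfTurn y = (2 : ℝ) • (ax y • eZ) - y := by
  rw [halfTurn, Submodule.reflection_singleton_apply, ax_eq_inner, norm_eZ]
  simp [two_smul]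

theorem ax_halfTurn (y : Space d) : ax (halfTurn y) = ax y := by
  rw [halfTurn_apply, ax_sub, ax_smul, ax_smul, ax_eZ]; ring

theorem horiz_halfTurn (y : Space d) : horiz (halfTurn y) = -horiz y := by
  rw [horiz, ax_halfTurn, halfTurn_apply, horiz]
  module

theorem rad_halfTurn (y : Space d) : rad (halfTurn y) = rad y := by
  rw [rad, horiz_halfTurn, norm_neg, rad]

theorem eR_halfTurn (y : Space d) : eR (halfTurn y) = -eR y := by
  rw [eR, rad_halfTurn, horiz_halfTurn, smul_neg, eR]

theorem cyl_halfTurn (y : Space d) : cyl (halfTurn y) = cyl y := by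
  rw [cyl, rad_halfTurn, ax_halfTurn, cyl]

theorem norm_sub_sq_eq_cyl (x y : Space d) :
    ‖x - y‖ ^ 2 = (ax x - ax y) ^ 2 + rad x ^ 2 + rad y ^ 2 - 2 * ⟪horiz x, horiz y⟫ := by
  rw [norm_sq_eq, ax_sub, rad, horiz_sub, @norm_sub_sq_real, rad, rad]
  ring

theorem dist_cyl_sq_le (x y : Space d) :
    (rad x - rad y) ^ 2 + (ax x - ax y) ^ 2 ≤ ‖x - y‖ ^ 2 := by
  have h1 := real_inner_le_norm (horiz x) (horiz y)
  rw [norm_sub_sq_eq_cyl]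
  change _ ≤ rad x * rad y at h1
  nlinarith

theorem abs_rpow_neg_sub_le {p a b m : ℝ} (hp : 0 ≤ p) (hm : 0 < m) (ha : m ≤ a) (hb : m ≤ b) :
    |a ^ (-p) - b ^ (-p)| ≤ p * m ^ (-p - 1) * |a - b| := by
  have h := (convex_Ici m).norm_image_sub_le_of_norm_hasDerivWithin_le (f := fun x : ℝ => x ^ (-p))
    (f' := fun x => -p * x ^ (-p - 1)) (C := p * m ^ (-p - 1)) (fun x hx =>
      (Real.hasDerivAt_rpow_const (Or.inl (hm.trans_le hx).ne')).hasDerivWithinAt)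
    (fun x hx => by
      have hx0 : 0 < x := hm.trans_le hx
      rw [norm_mul, norm_neg, Real.norm_of_nonneg hp,
        Real.norm_of_nonneg (Real.rpow_nonneg hx0.le _)]
      exact mul_le_mul_of_nonneg_left
        (Real.rpow_le_rpow_of_nonpos hm hx (by linarith)) hp) hb ha
  simpa using h

/-- Pairing `y` with its image under the half turn, the kernel decays like that of a dipole. -/
theorem abs_ker_add_ker_halfTurn_le {ρ ε : ℝ} {x y : Space d} (hρ : 0 < ρ) (hx : ρ / 2 ≤ rad x)
    (hx' : rad x ≤ ρ) (hy : rad y ≤ ρ / 4) :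
    |ker ε x y + ker ε x (halfTurn y)| ≤ 2 * d * 4 ^ (d + 1) / ρ ^ d * rad y := by
  have hry := rad_nonneg y
  set Δ := ax x - ax y with hΔ
  set m := (ρ / 4) ^ 2 + Δ ^ 2 with hm
  have hm0 : 0 < m := by positivity
  have hD : m ≤ (rad x - rad y) ^ 2 + Δ ^ 2 := by
    have : ρ / 4 ≤ rad x - rad y := by linarith
    nlinarith
  set a := ‖x - y‖ ^ 2 + ε ^ 2 with ha
  set b := ‖x - halfTurn y‖ ^ 2 + ε ^ 2 with hb
  have ha' : m ≤ a := by
    have := dist_cyl_sq_le x y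
    nlinarith [sq_nonneg ε]
  have hb' : m ≤ b := by
    have := dist_cyl_sq_le x (halfTurn y)
    rw [rad_halfTurn, ax_halfTurn] at this
    nlinarith [sq_nonneg ε]
  have hab : |a - b| ≤ 4 * (ρ * rad y) := by
    have h1 : a - b = -4 * ⟪horiz x, horiz y⟫ := by
      rw [ha, hb, norm_sub_sq_eq_cyl, norm_sub_sq_eq_cyl, rad_halfTurn, ax_halfTurn,
        horiz_halfTurn, inner_neg_right]
      ring
    rw [h1, abs_mul, show |(-4 : ℝ)| = 4 by norm_num]
    have h2 : |⟪horiz x, horiz y⟫| ≤ rad x * rad y := abs_real_inner_le_norm _ _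
    have h3 := mul_le_mul_of_nonneg_right hx' hry
    linarith
  have hp : (0 : ℝ) ≤ (d : ℝ) / 2 := by positivity
  have e1 : ker ε x y + ker ε x (halfTurn y) =
      Δ * ⟪eR x, eR y⟫ * (a ^ (-((d : ℝ) / 2)) - b ^ (-((d : ℝ) / 2))) := by
    rw [ker, ker, ax_halfTurn, eR_halfTurn, inner_neg_right]
    ring
  have hΔm : |Δ| ≤ m ^ ((1 : ℝ) / 2) := by
    rw [← Real.sqrt_eq_rpow]
    refine Real.le_sqrt_of_sq_le ?_
    rw [sq_abs]
    nlinarith [sq_nonneg (ρ / 4)]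
  rw [e1, abs_mul, abs_mul]
  calc |Δ| * |⟪eR x, eR y⟫| * |a ^ (-((d : ℝ) / 2)) - b ^ (-((d : ℝ) / 2))|
      ≤ m ^ ((1 : ℝ) / 2) * 1 * ((d : ℝ) / 2 * m ^ (-((d : ℝ) / 2) - 1) * (4 * (ρ * rad y))) := by
        have h1 := abs_rpow_neg_sub_le hp hm0 ha' hb'
        have h2 := abs_inner_eR_le x y
        have h3 : 0 ≤ m ^ (-((d : ℝ) / 2) - 1) := Real.rpow_nonneg hm0.le _
        refine mul_le_mul (mul_le_mul hΔm h2 (abs_nonneg _) (by positivity)) (h1.trans ?_)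
          (abs_nonneg _) (by positivity)
        exact mul_le_mul_of_nonneg_left hab (by positivity)
    _ = 2 * d * (ρ * rad y) * m ^ (-(((d : ℝ) + 1) / 2)) := by
        have : m ^ (-(((d : ℝ) + 1) / 2)) = m ^ ((1 : ℝ) / 2) * m ^ (-((d : ℝ) / 2) - 1) := by
          rw [← Real.rpow_add hm0]; congr 1; ring
        rw [this]; ring
    _ ≤ 2 * d * (ρ * rad y) * ((ρ / 4) ^ (d + 1))⁻¹ := by
        refine mul_le_mul_of_nonneg_left ?_ (by positivity)
        have h1 : (ρ / 4) ^ 2 ≤ m := le_add_of_nonneg_right (sq_nonneg _)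
        refine (Real.rpow_le_rpow_of_nonpos (by positivity) h1
          (by have : (0 : ℝ) ≤ d := Nat.cast_nonneg d; linarith)).trans (le_of_eq ?_)
        have hb : 0 ≤ ρ / 4 := by positivity
        generalize ρ / 4 = b at hb
        rw [← Real.rpow_natCast b 2, ← Real.rpow_mul hb, ← Real.rpow_natCast b (d + 1),
          ← Real.rpow_neg hb]
        congr 1
        push_cast
        ring
    _ = _ := by
        rw [div_pow, pow_succ ρ d]
        field_simp

end

end AxisymEuler
end

noncomputable section
namespace AxisymEuler
open scoped Topology RealInnerProductSpace
open Filter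

/-! ### Bound for the radial transport of vorticity -/

/-- The moment `∬ r^{d-1} η` of a vorticity profile, a multiple of the fluid impulse. -/
def impulse (d : ℕ) (η : ℝ × ℝ → ℝ) : ℝ := ∫ y in half, y.1 ^ (d - 1) * η y

/-- The mass of a vorticity profile at distance at least `ρ` from the axis. -/
def tail (η : ℝ × ℝ → ℝ) (ρ : ℝ) : ℝ := ∫ y in outer ρ, η y

theorem measurableSet_outer (ρ : ℝ) : MeasurableSet (outer ρ) :=
  (measurableSet_le measurable_const measurable_fst).inter
    (measurableSet_le measurable_const measurable_fst)

theorem outer_subset_half {ρ : ℝ} (hρ : 0 < ρ) : outer ρ ⊆ half := fun _ hy => hρ.trans_le hy.2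

theorem IsProfile.impulse_nonneg {d : ℕ} {R : ℝ} {η : ℝ × ℝ → ℝ} (h : IsProfile R η) : 0 ≤ impulse d η :=
  setIntegral_nonneg measurableSet_half fun y hy =>
    mul_nonneg (pow_nonneg (le_of_lt hy) _) (h.nonneg y hy)

section
variable {d : ℕ} [NeZero d]

/-- The regularised radial velocity induced at `x` by the vorticity `w`. -/
def inducedVel (ε : ℝ) (w : Space d → ℝ) (x : Space d) : ℝ := ∫ y, w y * ker ε x y

theorem integrable_mul_ker {w : Space d → ℝ} (hw : Integrable w) {ε : ℝ} (hε : 0 < ε)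
    (x : Space d) : Integrable fun y => w y * ker ε x y :=
  hw.mul_bdd (c := (ε ^ 2) ^ ((1 - (d : ℝ)) / 2))
    ((measurable_ker ε).comp (measurable_const.prodMk measurable_id)).aestronglyMeasurable
    (Eventually.of_forall fun y => abs_ker_le_const hε x y)

theorem integrable_prod_ker {a b : Space d → ℝ} (ha : Integrable a) (hb : Integrable b) {ε : ℝ}
    (hε : 0 < ε) : Integrable fun q : Space d × Space d => a q.1 * b q.2 * ker ε q.1 q.2 :=
  (ha.mul_prod hb).mul_bdd (c := (ε ^ 2) ^ ((1 - (d : ℝ)) / 2))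
    (measurable_ker ε).aestronglyMeasurable
    (Eventually.of_forall fun q => abs_ker_le_const hε q.1 q.2)

theorem integrable_mul_inducedVel {a b : Space d → ℝ} (ha : Integrable a) (hb : Integrable b)
    {ε : ℝ} (hε : 0 < ε) : Integrable fun x => a x * inducedVel ε b x := by
  refine (integrable_prod_ker ha hb hε).integral_prod_left.congr (Eventually.of_forall fun x => ?_)
  simp only [inducedVel, mul_assoc]
  exact integral_const_mul _ _

theorem integral_mul_inducedVel {a b : Space d → ℝ} (ha : Integrable a) (hb : Integrable b)
    {ε : ℝ} (hε : 0 < ε) : ∫ x, a x * inducedVel ε b x =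
      ∫ q : Space d × Space d, a q.1 * b q.2 * ker ε q.1 q.2 := by
  rw [Measure.volume_eq_prod, integral_prod _ (integrable_prod_ker ha hb hε)]
  refine integral_congr_ae (Eventually.of_forall fun x => ?_)
  simp only [inducedVel, mul_assoc]
  exact (integral_const_mul _ _).symm

/-- Antisymmetry of the kernel. -/
theorem two_mul_integral_mul_inducedVel {g a : Space d → ℝ} (hga : Integrable fun x => g x * a x)
    (ha : Integrable a) {ε : ℝ} (hε : 0 < ε) :
    2 * ∫ x, g x * a x * inducedVel ε a x =
      ∫ q : Space d × Space d, (g q.1 - g q.2) * (a q.1 * a q.2) * ker ε q.1 q.2 := by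
  have h1 := integrable_prod_ker hga ha hε
  have h2 : Integrable fun q : Space d × Space d => g q.2 * a q.2 * a q.1 * ker ε q.2 q.1 :=
    h1.swap
  have h3 : ∫ q : Space d × Space d, g q.2 * a q.2 * a q.1 * ker ε q.2 q.1 =
      ∫ q : Space d × Space d, g q.1 * a q.1 * a q.2 * ker ε q.1 q.2 :=
    integral_prod_swap (fun q : Space d × Space d => g q.1 * a q.1 * a q.2 * ker ε q.1 q.2)
  rw [integral_mul_inducedVel hga ha hε, two_mul]
  nth_rewrite 2 [← h3]
  rw [← integral_add h1 h2]
  refine integral_congr_ae (Eventually.of_forall fun q => ?_)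
  simp only [ker_swap ε q.1 q.2]
  ring

namespace IsProfile
variable {R : ℝ} {η : ℝ × ℝ → ℝ}

theorem integrableOn_outer (h : IsProfile R η) {ρ : ℝ} (hρ : 0 < ρ) :
    IntegrableOn η (outer ρ) := by
  have := h.integrableOn_half (g := fun _ => 1) continuous_const
  simp only [one_mul] at this
  exact this.mono_set (outer_subset_half hρ)

theorem tail_nonneg (h : IsProfile R η) {ρ : ℝ} (hρ : 0 < ρ) : 0 ≤ tail η ρ :=
  setIntegral_nonneg (measurableSet_outer ρ) fun y hy => h.nonneg y (outer_subset_half hρ hy)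

theorem integral_rad_mul (hd : 3 ≤ d) (h : IsProfile R η) :
    ∫ x : Space d, η (cyl x) * rad x = sphereArea d * impulse d η := by
  refine (integral_cyl hd (G := fun y => η y * y.1)
    (h.continuous.measurable.mul measurable_fst)).trans ?_
  rw [impulse]
  congr 1
  refine setIntegral_congr_fun measurableSet_half fun y _ => ?_
  rw [show d - 1 = (d - 2) + 1 by omega, pow_succ]
  ring

/-- The mass in `ℝ^d` carried by the shell `ρ' ≤ r ≤ ρ`. -/
theorem integral_shell_le (hd : 3 ≤ d) (h : IsProfile R η) {ρ ρ' : ℝ} (hρ : 0 ≤ ρ) (hρ' : 0 < ρ') :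
    ∫ x : Space d, (Icc ρ' ρ).indicator 1 (rad x) * η (cyl x) ≤
      sphereArea d * (ρ ^ (d - 2) * tail η ρ') := by
  have hσ := sphereArea_pos hd
  refine (integral_cyl hd (G := fun y => (Icc ρ' ρ).indicator 1 y.1 * η y)
    (((measurable_one.indicator measurableSet_Icc).comp measurable_fst).mul
      h.continuous.measurable)).trans_le ?_
  have hnn : ∀ z ∈ outer ρ', 0 ≤ ρ ^ (d - 2) * η z := fun z hz =>
    mul_nonneg (pow_nonneg hρ _) (h.nonneg z (outer_subset_half hρ' hz))
  refine mul_le_mul_of_nonneg_left ?_ hσ.le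
  rw [tail, ← integral_const_mul, ← integral_indicator (measurableSet_outer ρ'),
    ← integral_indicator measurableSet_half]
  refine integral_mono_of_nonneg (Eventually.of_forall fun y => ?_)
    ((integrable_indicator_iff (measurableSet_outer ρ')).2
      ((h.integrableOn_outer hρ').const_mul _)) (Eventually.of_forall fun y => ?_)
  · refine indicator_nonneg (fun y hy => ?_) y
    have hy0 : 0 < y.1 := hy
    have := h.nonneg y hy
    have h2 : 0 ≤ (Icc ρ' ρ).indicator (1 : ℝ → ℝ) y.1 := indicator_nonneg (fun _ _ => zero_le_one) _
    positivity
  · by_cases hy : y ∈ half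
    · have hy0 : 0 < y.1 := hy
      have hη := h.nonneg y hy
      rw [indicator_of_mem hy]
      by_cases h1 : y.1 ∈ Icc ρ' ρ
      · rw [indicator_of_mem h1, indicator_of_mem (show y ∈ outer ρ' from ⟨hy0.le, h1.1⟩)]
        have h3 := pow_le_pow_left₀ hy0.le h1.2 (d - 2)
        simp only [Pi.one_apply, one_mul]
        exact mul_le_mul_of_nonneg_right h3 hη
      · rw [indicator_of_notMem h1]
        simp only [zero_mul, mul_zero]
        exact indicator_nonneg hnn y
    · rw [indicator_of_notMem hy]
      exact indicator_nonneg hnn y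

/-- The vortex rings near the axis act like dipoles. -/
theorem abs_inducedVel_inner_le (hd : 3 ≤ d) (h : IsProfile R η) {ρ ε : ℝ} (hρ : 0 < ρ)
    (hε : 0 < ε) {x : Space d} (hx : ρ / 2 ≤ rad x) (hx' : rad x ≤ ρ) :
    |inducedVel ε (fun y => (Iic (ρ / 4)).indicator 1 (rad y) * η (cyl y)) x| ≤
      2 * d * 4 ^ (d + 1) / ρ ^ d * (sphereArea d * impulse d η) := by
  set w : Space d → ℝ := fun y => (Iic (ρ / 4)).indicator 1 (rad y) * η (cyl y) with hw
  have hwm : Measurable w :=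
    ((measurable_one.indicator measurableSet_Iic).comp continuous_rad.measurable).mul
      h.continuous_cyl.measurable
  have hw0 : ∀ y, 0 ≤ w y ∧ w y ≤ η (cyl y) := fun y => by
    have := h.cyl_nonneg y
    simp only [hw]
    by_cases hy : rad y ∈ Iic (ρ / 4) <;> simp [indicator, hy, this]
  have hwi : Integrable w := h.integrable_cyl.mono' hwm.aestronglyMeasurable
    (Eventually.of_forall fun y => by
      rw [Real.norm_of_nonneg (hw0 y).1]; exact (hw0 y).2)
  have hwt : ∀ y, w (halfTurn y) = w y := fun y => by
    simp only [hw, rad_halfTurn, cyl_halfTurn]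
  have h1 := integrable_mul_ker hwi hε x
  have h2 : ∫ y, w (halfTurn y) * ker ε x (halfTurn y) = ∫ y, w y * ker ε x y :=
    halfTurn.measurePreserving.integral_comp halfTurn.toHomeomorph.measurableEmbedding
      (fun y => w y * ker ε x y)
  have h3 : Integrable fun y => w (halfTurn y) * ker ε x (halfTurn y) :=
    (halfTurn.measurePreserving.integrable_comp_emb
      halfTurn.toHomeomorph.measurableEmbedding (g := fun y => w y * ker ε x y)).2 h1
  have h4 : 2 * inducedVel ε w x = ∫ y, w y * (ker ε x y + ker ε x (halfTurn y)) := by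
    rw [inducedVel, two_mul]
    nth_rewrite 2 [← h2]
    rw [← integral_add h1 h3]
    refine integral_congr_ae (Eventually.of_forall fun y => ?_)
    simp only [hwt]
    ring
  set c : ℝ := 2 * d * 4 ^ (d + 1) / ρ ^ d with hc
  have hc0 : 0 ≤ c := by positivity
  have h5 : |2 * inducedVel ε w x| ≤ ∫ y : Space d, c * (η (cyl y) * rad y) := by
    rw [h4, ← Real.norm_eq_abs]
    refine norm_integral_le_of_norm_le ((h.integrable_cyl_mul (continuous_rad (d := d))).const_mul c)
      (Eventually.of_forall fun y => ?_)
    rw [norm_mul, Real.norm_of_nonneg (hw0 y).1]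
    by_cases hy : rad y ≤ ρ / 4
    · have h6 := abs_ker_add_ker_halfTurn_le (ε := ε) hρ hx hx' hy
      have h7 := mul_le_mul (hw0 y).2 h6 (abs_nonneg _) (h.cyl_nonneg y)
      refine h7.trans (le_of_eq (by ring))
    · have : w y = 0 := by simp [hw, indicator, hy]
      rw [this, zero_mul]
      have := h.cyl_nonneg y
      have := rad_nonneg y
      positivity
  rw [integral_const_mul, h.integral_rad_mul hd, abs_mul, abs_two] at h5
  have : 0 ≤ |inducedVel ε w x| := abs_nonneg _
  linarith

end IsProfile
end

end AxisymEuler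
end

noncomputable section
namespace AxisymEuler
open scoped Topology RealInnerProductSpace
open Filter

/-- The weight produced by the angular integration of the kernel, compared with the impulse. -/
theorem IsProfile.lintegral_weight_le {d : ℕ} {R : ℝ} {η : ℝ × ℝ → ℝ} (hd : 3 ≤ d)
    (h : IsProfile R η) {ρ C r₀ : ℝ} (hρ : 0 < ρ)
    (hC : 0 ≤ C) (hr₀ : ρ / 4 ≤ r₀) :
    ∫⁻ y in half, ENNReal.ofReal ((Ioi (ρ / 4)).indicator 1 y.1 * η y) *
      ENNReal.ofReal (y.1 ^ (d - 2) * (C / √(r₀ * y.1) ^ (d - 2))) ≤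
      ENNReal.ofReal (C / (ρ / 4) ^ (d - 1) * impulse d η) := by
  have hi := h.integrableOn_half (g := fun r => r ^ (d - 1)) (by fun_prop)
  have hc : 0 ≤ C / (ρ / 4) ^ (d - 1) := by positivity
  rw [impulse, ← integral_const_mul, ofReal_integral_eq_lintegral_ofReal (hi.const_mul _)
    ((ae_restrict_iff' measurableSet_half).2 (Eventually.of_forall fun y hy =>
      mul_nonneg hc (mul_nonneg (pow_nonneg (le_of_lt hy) _) (h.nonneg y hy))))]
  refine setLIntegral_mono' measurableSet_half fun y hy => ?_
  have hy0 : 0 < y.1 := hy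
  have hη := h.nonneg y hy
  by_cases hy4 : y.1 ∈ Ioi (ρ / 4)
  · rw [indicator_of_mem hy4, Pi.one_apply, one_mul, ← ENNReal.ofReal_mul hη]
    refine ENNReal.ofReal_le_ofReal ?_
    have hr0 : 0 < r₀ := by linarith
    have hb0 : 0 < ρ / 4 := by positivity
    have hy4' : ρ / 4 ≤ y.1 := le_of_lt hy4
    obtain ⟨k, hk⟩ : ∃ k, d = k + 2 := ⟨d - 2, by omega⟩
    rw [hk, show k + 2 - 2 = k by omega, show k + 2 - 1 = k + 1 by omega, Real.sqrt_mul hr0.le,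
      mul_pow]
    -- with square roots `s`, `s₀`, `b` of `r`, `r₀`, `ρ/4`, the claim is `b^{2k+2} ≤ s₀^k s^{k+2}`
    set s := √y.1 with hs
    set s₀ := √r₀ with hs₀
    set b := √(ρ / 4) with hb
    have e1 : y.1 = s ^ 2 := (Real.sq_sqrt hy0.le).symm
    have e2 : ρ / 4 = b ^ 2 := (Real.sq_sqrt hb0.le).symm
    have p1 : 0 < s := Real.sqrt_pos.2 hy0
    have p2 : 0 < s₀ := Real.sqrt_pos.2 hr0
    have p3 : 0 < b := Real.sqrt_pos.2 hb0
    have l1 : b ≤ s := Real.sqrt_le_sqrt hy4'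
    have l2 : b ≤ s₀ := Real.sqrt_le_sqrt hr₀
    have l3 : b ^ (2 * (k + 1)) ≤ s₀ ^ k * s ^ (k + 2) := by
      have := mul_le_mul (pow_le_pow_left₀ p3.le l2 k) (pow_le_pow_left₀ p3.le l1 (k + 2))
        (by positivity) (by positivity)
      refine le_trans (le_of_eq ?_) this
      ring
    rw [e1, e2, ← pow_mul, ← pow_mul, ← pow_mul, mul_comm (η y),
      show s ^ (2 * k) * (C / (s₀ ^ k * s ^ k)) = C * s ^ k / s₀ ^ k by
        field_simp; ring, ← mul_assoc]
    refine mul_le_mul_of_nonneg_right ?_ hη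
    rw [div_mul_eq_mul_div, div_le_div_iff₀ (by positivity) (by positivity)]
    have := mul_le_mul_of_nonneg_left l3 (show 0 ≤ C * s ^ k by positivity)
    refine this.trans (le_of_eq ?_)
    ring
  · rw [indicator_of_notMem hy4]
    simp

section
variable {d : ℕ} [NeZero d]

namespace IsProfile
variable {R : ℝ} {η : ℝ × ℝ → ℝ}

theorem integrable_indicator_mul (h : IsProfile R η) {s : Set ℝ} (hs : MeasurableSet s) :
    Integrable fun x : Space d => s.indicator 1 (rad x) * η (cyl x) := by
  refine h.integrable_cyl.mono'
    (((measurable_one.indicator hs).comp continuous_rad.measurable).mul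
      h.continuous_cyl.measurable).aestronglyMeasurable (Eventually.of_forall fun x => ?_)
  have := h.cyl_nonneg x
  by_cases hx : rad x ∈ s <;> simp [indicator, hx, this, abs_of_nonneg this]

/-- The interaction of the vortex rings away from the axis: the antisymmetric kernel is tested with
a Lipschitz function, whence a bounded angular average. -/
theorem exists_abs_outer_le (hd : 3 ≤ d) : ∃ C : ℝ, 0 < C ∧ ∀ (R : ℝ) (η : ℝ × ℝ → ℝ),
    IsProfile R η → ∀ (f : ℝ → ℝ) (B l ρ ρ' ε : ℝ), Measurable f → (∀ r, |f r| ≤ B) →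
    (∀ r s, |f r - f s| ≤ l * |r - s|) → (∀ r, r ∉ Icc ρ' ρ → f r = 0) → 0 ≤ l → 0 < ρ →
    ρ / 2 ≤ ρ' → 0 < ε →
    |∫ x : Space d, f (rad x) * ((Ioi (ρ / 4)).indicator 1 (rad x) * η (cyl x)) *
      inducedVel ε (fun y => (Ioi (ρ / 4)).indicator 1 (rad y) * η (cyl y)) x| ≤
    C * l * (tail η ρ' * impulse d η) / ρ := by
  obtain ⟨C, hC, hker⟩ := lintegral_cyl_kernel_le hd
  have hσ := sphereArea_pos hd
  refine ⟨C * 4 ^ (d - 1) * sphereArea d, by positivity, ?_⟩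
  intro R η h f B l ρ ρ' ε hfm hfB hfl hf0 hl hρ hρ' hε
  have hρ'0 : 0 < ρ' := by linarith
  set a : Space d → ℝ := fun y => (Ioi (ρ / 4)).indicator 1 (rad y) * η (cyl y) with ha
  have hai : Integrable a := h.integrable_indicator_mul measurableSet_Ioi
  have ha0 : ∀ y, 0 ≤ a y := fun y =>
    mul_nonneg (indicator_nonneg (fun _ _ => zero_le_one) _) (h.cyl_nonneg y)
  have ham : Measurable a :=
    ((measurable_one.indicator measurableSet_Ioi).comp continuous_rad.measurable).mul
      h.continuous_cyl.measurable
  have hfa : Integrable fun x => f (rad x) * a x :=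
    hai.bdd_mul (c := B) (hfm.comp continuous_rad.measurable).aestronglyMeasurable
      (Eventually.of_forall fun x => hfB _)
  set S : Space d → ℝ := fun x => (Icc ρ' ρ).indicator 1 (rad x) with hS
  have hS0 : ∀ x, 0 ≤ S x := fun x => indicator_nonneg (fun _ _ => zero_le_one) _
  have hSm : Measurable S :=
    (measurable_one.indicator measurableSet_Icc).comp continuous_rad.measurable
  set N : Space d → Space d → ℝ := fun x y => ((rad x - rad y) ^ 2 + (ax x - ax y) ^ 2) *
    (‖x - y‖ ^ 2 + ε ^ 2) ^ (-((d : ℝ) / 2)) with hN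
  have hN0 : ∀ x y, 0 ≤ N x y := fun x y =>
    mul_nonneg (by positivity) (Real.rpow_nonneg (by positivity) _)
  have hNm : Measurable fun q : Space d × Space d => N q.1 q.2 := by
    have h1 := (continuous_rad (d := d)).measurable
    have h2 := (continuous_ax (d := d)).measurable
    simp only [hN]
    fun_prop
  have hNs : ∀ x y, N x y = N y x := fun x y => by
    simp only [hN]
    rw [norm_sub_rev, sub_sq_comm (rad x), sub_sq_comm (ax x)]
  -- pointwise bound for the symmetrised integrand
  have hpt : ∀ x y, |(f (rad x) - f (rad y)) * (a x * a y) * ker ε x y| ≤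
      (S x + S y) * (l / 2 * (a x * a y * N x y)) := by
    intro x y
    have h1 : |f (rad x) - f (rad y)| ≤ (S x + S y) * (l * |rad x - rad y|) := by
      have h2 : 0 ≤ l * |rad x - rad y| := by positivity
      by_cases hx : rad x ∈ Icc ρ' ρ
      · have : S x = 1 := by simp [hS, hx]
        rw [this]
        nlinarith [hfl (rad x) (rad y), hS0 y]
      · by_cases hy : rad y ∈ Icc ρ' ρ
        · have : S y = 1 := by simp [hS, hy]
          rw [this]
          nlinarith [hfl (rad x) (rad y), hS0 x]
        · rw [hf0 _ hx, hf0 _ hy, sub_self, abs_zero]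
          have := hS0 x
          have := hS0 y
          positivity
    have h3 := abs_ker_le ε x y
    have hP : 0 ≤ (‖x - y‖ ^ 2 + ε ^ 2) ^ (-((d : ℝ) / 2)) := Real.rpow_nonneg (by positivity) _
    have haa : 0 ≤ a x * a y := mul_nonneg (ha0 x) (ha0 y)
    have hSS : 0 ≤ S x + S y := add_nonneg (hS0 x) (hS0 y)
    rw [abs_mul, abs_mul, abs_of_nonneg haa]
    calc |f (rad x) - f (rad y)| * (a x * a y) * |ker ε x y|
        ≤ (S x + S y) * (l * |rad x - rad y|) * (a x * a y) *
          (|ax x - ax y| * (‖x - y‖ ^ 2 + ε ^ 2) ^ (-((d : ℝ) / 2))) := by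
          gcongr
      _ = (S x + S y) * l * (a x * a y) * (‖x - y‖ ^ 2 + ε ^ 2) ^ (-((d : ℝ) / 2)) *
          (|rad x - rad y| * |ax x - ax y|) := by ring
      _ ≤ (S x + S y) * l * (a x * a y) * (‖x - y‖ ^ 2 + ε ^ 2) ^ (-((d : ℝ) / 2)) *
          (((rad x - rad y) ^ 2 + (ax x - ax y) ^ 2) / 2) := by
          refine mul_le_mul_of_nonneg_left ?_ (by positivity)
          have := sq_nonneg (|rad x - rad y| - |ax x - ax y|)
          rw [sub_sq, sq_abs, sq_abs] at this
          linarith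
      _ = _ := by simp only [hN]; ring
  -- integration in `y` for `x` in the shell
  have hJ : ∀ x, 0 < S x → ∫⁻ y, ENNReal.ofReal (a y) * ENNReal.ofReal (N x y) ≤
      ENNReal.ofReal (C / (ρ / 4) ^ (d - 1) * impulse d η) := by
    intro x hx
    have hxm : rad x ∈ Icc ρ' ρ := by
      by_contra hne
      simp [hS, hne] at hx
    have hx4 : ρ / 4 ≤ rad x := by linarith [hxm.1]
    refine le_trans ?_ (h.lintegral_weight_le hd hρ hC.le hx4)
    exact hker x ε (fun p => ENNReal.ofReal ((Ioi (ρ / 4)).indicator 1 p.1 * η p))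
      (by linarith) (((measurable_one.indicator measurableSet_Ioi).comp measurable_fst).mul
        h.continuous.measurable).ennreal_ofReal
  set T : Space d × Space d → ℝ≥0∞ := fun q =>
    ENNReal.ofReal (S q.1 * (l / 2 * (a q.1 * a q.2 * N q.1 q.2))) with hT
  have hTm : Measurable T := by
    simp only [hT]
    fun_prop
  have hTint : ∫⁻ q, T q ≤ ENNReal.ofReal (l / 2 * (sphereArea d * (ρ ^ (d - 2) * tail η ρ')) *
      (C / (ρ / 4) ^ (d - 1) * impulse d η)) := by
    have himp := h.impulse_nonneg (d := d)
    have hc : 0 ≤ C / (ρ / 4) ^ (d - 1) * impulse d η := by positivity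
    rw [Measure.volume_eq_prod, lintegral_prod _ hTm.aemeasurable]
    calc _ ≤ ∫⁻ x, ENNReal.ofReal (l / 2 * (S x * η (cyl x))) *
          ENNReal.ofReal (C / (ρ / 4) ^ (d - 1) * impulse d η) := by
          refine lintegral_mono fun x => ?_
          rcases (hS0 x).eq_or_lt with h0 | h0
          · simp only [hT, ← h0]
            simp
          · have e : ∀ y, T (x, y) = ENNReal.ofReal (S x * (l / 2 * a x)) *
                (ENNReal.ofReal (a y) * ENNReal.ofReal (N x y)) := fun y => by
              rw [← ENNReal.ofReal_mul (ha0 y), ← ENNReal.ofReal_mul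
                (mul_nonneg h0.le (mul_nonneg (by positivity) (ha0 x)))]
              simp only [hT]
              congr 1
              ring
            simp only [e]
            rw [lintegral_const_mul' _ _ ENNReal.ofReal_ne_top]
            refine mul_le_mul' (ENNReal.ofReal_le_ofReal ?_) (hJ x h0)
            have h5 : a x ≤ η (cyl x) := by
              have := h.cyl_nonneg x
              by_cases hx : ρ / 4 < rad x <;> simp [ha, indicator, hx, this]
            calc S x * (l / 2 * a x) = l / 2 * (S x * a x) := by ring
              _ ≤ _ := by gcongr
      _ = ENNReal.ofReal (l / 2 * ∫ x, S x * η (cyl x)) *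
          ENNReal.ofReal (C / (ρ / 4) ^ (d - 1) * impulse d η) := by
          rw [lintegral_mul_const' _ _ ENNReal.ofReal_ne_top, ← integral_const_mul,
            ofReal_integral_eq_lintegral_ofReal
              ((h.integrable_indicator_mul measurableSet_Icc).const_mul _)
              (Eventually.of_forall fun x => mul_nonneg (by positivity)
                (mul_nonneg (hS0 x) (h.cyl_nonneg x)))]
      _ ≤ _ := by
          rw [ENNReal.ofReal_mul' hc]
          gcongr
          exact h.integral_shell_le hd hρ.le hρ'0
  have hmain : ENNReal.ofReal |2 * ∫ x : Space d, f (rad x) * a x * inducedVel ε a x| ≤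
      2 * ENNReal.ofReal (l / 2 * (sphereArea d * (ρ ^ (d - 2) * tail η ρ')) *
      (C / (ρ / 4) ^ (d - 1) * impulse d η)) := by
    rw [two_mul_integral_mul_inducedVel hfa hai hε, ← Real.norm_eq_abs, ofReal_norm]
    refine (enorm_integral_le_lintegral_enorm _).trans ?_
    calc _ ≤ ∫⁻ q, (T q + T q.swap) := by
          refine lintegral_mono fun q => ?_
          rw [← ofReal_norm, Real.norm_eq_abs]
          refine (ENNReal.ofReal_le_ofReal (hpt q.1 q.2)).trans (le_of_eq ?_)
          simp only [hT, Prod.fst_swap, Prod.snd_swap]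
          have hnn : ∀ x y, 0 ≤ l / 2 * (a x * a y * N x y) := fun x y =>
            mul_nonneg (by positivity) (mul_nonneg (mul_nonneg (ha0 x) (ha0 y)) (hN0 x y))
          rw [← ENNReal.ofReal_add (mul_nonneg (hS0 _) (hnn _ _))
            (mul_nonneg (hS0 _) (hnn _ _)), hNs q.2 q.1]
          congr 1
          ring
      _ = 2 * ∫⁻ q, T q := by
          rw [lintegral_add_left hTm, two_mul]
          congr 1
          exact lintegral_prod_swap T
      _ ≤ _ := by gcongr
  have htail := h.tail_nonneg hρ'0
  have himp := h.impulse_nonneg (d := d)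
  set P := l / 2 * (sphereArea d * (ρ ^ (d - 2) * tail η ρ')) *
      (C / (ρ / 4) ^ (d - 1) * impulse d η) with hP
  have hP0 : 0 ≤ P := by positivity
  have key : |∫ x : Space d, f (rad x) * a x * inducedVel ε a x| ≤ P := by
    have h2 : ENNReal.ofReal |2 * ∫ x : Space d, f (rad x) * a x * inducedVel ε a x| ≤
        ENNReal.ofReal (2 * P) := by
      refine hmain.trans (le_of_eq ?_)
      rw [two_mul P, ENNReal.ofReal_add hP0 hP0, ← two_mul]
    rw [ENNReal.ofReal_le_ofReal_iff (by positivity), abs_mul, abs_two] at h2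
    linarith
  refine key.trans ?_
  obtain ⟨k, hk⟩ : ∃ k, d = k + 2 := ⟨d - 2, by omega⟩
  have e : l / 2 * (sphereArea d * (ρ ^ (d - 2) * tail η ρ')) *
      (C / (ρ / 4) ^ (d - 1) * impulse d η) =
      (C * 4 ^ (d - 1) * sphereArea d * l * (tail η ρ' * impulse d η) / ρ) / 2 := by
    rw [show d - 2 = k by omega, show d - 1 = k + 1 by omega, div_pow, pow_succ ρ]
    field_simp
  rw [hP, e]
  refine half_le_self ?_
  positivity

end IsProfile
end

end AxisymEuler
end

noncomputable section
namespace AxisymEuler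
open scoped Topology RealInnerProductSpace
open Filter

section
variable {d : ℕ} [NeZero d]

/-- The rate at which a Lipschitz radial weight supported in the shell `ρ' ≤ r ≤ ρ` is transported by
the regularised velocity is controlled by the mass beyond `ρ'`. -/
theorem exists_abs_transport_le (hd : 3 ≤ d) : ∃ C : ℝ, 0 < C ∧ ∀ (R : ℝ) (η : ℝ × ℝ → ℝ),
    IsProfile R η → ∀ (f : ℝ → ℝ) (l ρ ρ' ε : ℝ), Measurable f → (∀ r, |f r| ≤ l * ρ) →
    (∀ r s, |f r - f s| ≤ l * |r - s|) → (∀ r, r ∉ Icc ρ' ρ → f r = 0) → 0 ≤ l → 0 < ρ →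
    ρ / 2 ≤ ρ' → 0 < ε →
    |∫ x : Space d, f (rad x) * η (cyl x) * inducedVel ε (fun y => η (cyl y)) x| ≤
    C * l * (tail η ρ' * impulse d η) / ρ := by
  obtain ⟨C, hC, hout⟩ := IsProfile.exists_abs_outer_le (d := d) hd
  have hσ := sphereArea_pos hd
  refine ⟨2 * d * 4 ^ (d + 1) * sphereArea d ^ 2 + C, by positivity, ?_⟩
  intro R η h f l ρ ρ' ε hfm hfB hfl hf0 hl hρ hρ' hε
  have hρ'0 : 0 < ρ' := by linarith
  set w₁ : Space d → ℝ := fun y => (Iic (ρ / 4)).indicator 1 (rad y) * η (cyl y) with hw₁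
  set w₂ : Space d → ℝ := fun y => (Ioi (ρ / 4)).indicator 1 (rad y) * η (cyl y) with hw₂
  have hi₁ : Integrable w₁ := h.integrable_indicator_mul measurableSet_Iic
  have hi₂ : Integrable w₂ := h.integrable_indicator_mul measurableSet_Ioi
  have hsum : ∀ y : Space d, η (cyl y) = w₁ y + w₂ y := fun y => by
    by_cases hy : rad y ≤ ρ / 4
    · simp [hw₁, hw₂, indicator, hy, not_lt.2 hy]
    · simp [hw₁, hw₂, indicator, hy, not_le.1 hy]
  have hV : ∀ x : Space d, inducedVel ε (fun y => η (cyl y)) x =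
      inducedVel ε w₁ x + inducedVel ε w₂ x := fun x => by
    unfold inducedVel
    rw [← integral_add (integrable_mul_ker hi₁ hε x) (integrable_mul_ker hi₂ hε x)]
    refine integral_congr_ae (Eventually.of_forall fun y => ?_)
    simp only [hsum]
    ring
  have hfw : ∀ x : Space d, f (rad x) * η (cyl x) = f (rad x) * w₂ x := fun x => by
    by_cases hx : rad x ∈ Icc ρ' ρ
    · have : ρ / 4 < rad x := by linarith [hx.1]
      simp [hw₂, indicator, this]
    · rw [hf0 _ hx, zero_mul, zero_mul]
  have hfi : Integrable fun x : Space d => f (rad x) * w₂ x :=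
    hi₂.bdd_mul (c := l * ρ) (hfm.comp continuous_rad.measurable).aestronglyMeasurable
      (Eventually.of_forall fun x => hfB _)
  have himp := h.impulse_nonneg (d := d)
  have htail := h.tail_nonneg hρ'0
  have hsplit : ∫ x : Space d, f (rad x) * η (cyl x) * inducedVel ε (fun y => η (cyl y)) x =
      (∫ x : Space d, f (rad x) * w₂ x * inducedVel ε w₁ x) +
      ∫ x : Space d, f (rad x) * w₂ x * inducedVel ε w₂ x := by
    rw [← integral_add (integrable_mul_inducedVel hfi hi₁ hε)
      (integrable_mul_inducedVel hfi hi₂ hε)]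
    refine integral_congr_ae (Eventually.of_forall fun x => ?_)
    simp only [hfw, hV]
    ring
  set c : ℝ := 2 * d * 4 ^ (d + 1) / ρ ^ d * (sphereArea d * impulse d η) with hc
  have hc0 : 0 ≤ c := by positivity
  have h1 : |∫ x : Space d, f (rad x) * w₂ x * inducedVel ε w₁ x| ≤
      ∫ x : Space d, l * ρ * c * ((Icc ρ' ρ).indicator 1 (rad x) * η (cyl x)) := by
    rw [← Real.norm_eq_abs]
    refine norm_integral_le_of_norm_le
      ((h.integrable_indicator_mul measurableSet_Icc).const_mul _) (Eventually.of_forall fun x => ?_)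
    rw [← hfw, Real.norm_eq_abs, abs_mul, abs_mul, abs_of_nonneg (h.cyl_nonneg x)]
    by_cases hx : rad x ∈ Icc ρ' ρ
    · rw [indicator_of_mem hx, Pi.one_apply, one_mul]
      have h2 := h.abs_inducedVel_inner_le hd hρ hε (hρ'.trans hx.1) hx.2
      have h3 := mul_le_mul (mul_le_mul_of_nonneg_right (hfB (rad x)) (h.cyl_nonneg x)) h2
        (abs_nonneg _) (mul_nonneg (by positivity) (h.cyl_nonneg x))
      exact h3.trans (le_of_eq (by ring))
    · rw [hf0 _ hx, indicator_of_notMem hx]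
      simp
  have h2 : |∫ x : Space d, f (rad x) * w₂ x * inducedVel ε w₁ x| ≤
      2 * d * 4 ^ (d + 1) * sphereArea d ^ 2 * l * (tail η ρ' * impulse d η) / ρ := by
    rw [integral_const_mul] at h1
    have h3 := mul_le_mul_of_nonneg_left (h.integral_shell_le hd hρ.le hρ'0)
      (show 0 ≤ l * ρ * c by positivity)
    refine (h1.trans h3).trans (le_of_eq ?_)
    obtain ⟨k, hk⟩ : ∃ k, d = k + 2 := ⟨d - 2, by omega⟩
    have e : ρ ^ d = ρ ^ (d - 2) * ρ ^ 2 := by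
      rw [← pow_add]; congr 1; omega
    rw [hc, e]
    field_simp
  have h3 := hout R η h f (l * ρ) l ρ ρ' ε hfm hfB hfl hf0 hl hρ hρ' hε
  rw [hsplit]
  refine (abs_add_le _ _).trans ((add_le_add h2 h3).trans (le_of_eq ?_))
  ring

/-- A constant weight is not transported. -/
theorem IsProfile.transport_const_eq_zero {R : ℝ} {η : ℝ × ℝ → ℝ} (h : IsProfile R η) (c : ℝ)
    {ε : ℝ} (hε : 0 < ε) :
    ∫ x : Space d, c * η (cyl x) * inducedVel ε (fun y => η (cyl y)) x = 0 := by
  have := two_mul_integral_mul_inducedVel (g := fun _ : Space d => c)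
    (h.integrable_cyl.const_mul c) h.integrable_cyl hε
  simpa using this

end

end AxisymEuler
end

noncomputable section
namespace AxisymEuler
open scoped Topology RealInnerProductSpace
open Filter

/-! ### A regularised Biot–Savart law -/

section Trace
variable {d : ℕ}

/-- The trace of a linear map, in coordinates. -/
def tr (A : Space d →L[ℝ] Space d) : ℝ := ∑ i, A (EuclideanSpace.single i 1) i

theorem tr_add (A B : Space d →L[ℝ] Space d) : tr (A + B) = tr A + tr B := by
  simp [tr, Finset.sum_add_distrib]

theorem tr_sub (A B : Space d →L[ℝ] Space d) : tr (A - B) = tr A - tr B := by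
  simp [tr, Finset.sum_sub_distrib]

theorem tr_smul (c : ℝ) (A : Space d →L[ℝ] Space d) : tr (c • A) = c * tr A := by
  simp [tr, Finset.mul_sum]

theorem tr_id : tr (ContinuousLinearMap.id ℝ (Space d)) = d := by
  simp [tr]

theorem tr_smulRight (φ : Space d →L[ℝ] ℝ) (v : Space d) : tr (φ.smulRight v) = φ v := by
  have h : v = ∑ i, v i • EuclideanSpace.single i (1 : ℝ) := by
    have := (EuclideanSpace.basisFun (Fin d) ℝ).sum_repr v
    simpa using this.symm
  conv_rhs => rw [h]
  simp [tr, mul_comm]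

/-- The divergence theorem for compactly supported vector fields. -/
theorem integral_tr_fderiv_eq_zero {X : Space d → Space d} (hX : ContDiff ℝ 1 X)
    (hc : HasCompactSupport X) : ∫ y, tr (fderiv ℝ X y) = 0 := by
  have hdX := hX.differentiable one_ne_zero
  have hcont := hX.continuous_fderiv one_ne_zero
  have hi : ∀ i, Continuous fun y => fderiv ℝ X y (EuclideanSpace.single i 1) i := fun i => by
    fun_prop
  have hci : ∀ i, HasCompactSupport fun y => fderiv ℝ X y (EuclideanSpace.single i 1) i := fun i =>
    (hc.fderiv ℝ).comp_left (g := fun A : Space d →L[ℝ] Space d =>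
      A (EuclideanSpace.single i 1) i) (by simp)
  unfold tr
  rw [integral_finsetSum _ fun i _ => (hi i).integrable_of_hasCompactSupport (hci i)]
  refine Finset.sum_eq_zero fun i _ => ?_
  have hXi : HasCompactSupport fun y => X y i :=
    hc.comp_left (g := fun v : Space d => v i) (by simp)
  have hXc : Continuous fun y => X y i := by
    have := hX.continuous
    fun_prop
  have := integral_bilinear_hasLineDerivAt_right_eq_neg_left_of_integrable (μ := volume)
    (B := ContinuousLinearMap.mul ℝ ℝ) (f := fun _ : Space d => (1 : ℝ)) (f' := fun _ => 0)
    (g := fun y => X y i) (g' := fun y => fderiv ℝ X y (EuclideanSpace.single i 1) i)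
    (v := EuclideanSpace.single i 1) (by simp)
    (by simpa using (hi i).integrable_of_hasCompactSupport (hci i))
    (by simpa using hXc.integrable_of_hasCompactSupport hXi)
    (fun x _ => by simpa using (hasFDerivAt_const (1 : ℝ) x).hasLineDerivAt (EuclideanSpace.single i 1))
    (fun x _ => (((EuclideanSpace.proj i : Space d →L[ℝ] ℝ).hasFDerivAt.comp x
      (hdX x).hasFDerivAt).hasLineDerivAt (EuclideanSpace.single i 1)))
  simpa using this

/-- The divergence theorem for integrable vector fields with integrable divergence. -/
theorem integral_tr_fderiv_eq_zero_of_integrable {Z : Space d → Space d} (hZ : ContDiff ℝ 1 Z)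
    (hi : Integrable Z) (hdiv : Integrable fun y => tr (fderiv ℝ Z y)) :
    ∫ y, tr (fderiv ℝ Z y) = 0 := by
  let χ : ContDiffBump (0 : Space d) := ⟨1, 2, by norm_num, by norm_num⟩
  have hχ : ContDiff ℝ 1 χ := χ.contDiff
  obtain ⟨K, hK⟩ : ∃ K, ∀ y, ‖fderiv ℝ χ y‖ ≤ K :=
    (hχ.continuous_fderiv one_ne_zero).bounded_above_of_compact_support
      (χ.hasCompactSupport.fderiv ℝ)
  have hdZ := hZ.differentiable one_ne_zero
  set a : ℕ → ℝ := fun n => 1 / ((n : ℝ) + 1) with ha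
  have haT : Tendsto a atTop (𝓝 0) := tendsto_one_div_add_atTop_nhds_zero_nat
  have ha0 : ∀ n, 0 < a n := fun n => by simp only [ha]; positivity
  have hcut : ∀ n y, HasFDerivAt (fun y => χ (a n • y)) (a n • fderiv ℝ χ (a n • y)) y := by
    intro n y
    have h1 : HasFDerivAt (fun y : Space d => a n • y)
        (a n • ContinuousLinearMap.id ℝ (Space d)) y := (hasFDerivAt_id y).const_smul (a n)
    refine (((hχ.differentiable one_ne_zero) (a n • y)).hasFDerivAt.comp y h1).congr_fderiv ?_
    ext v
    simp
  have hX : ∀ n y, tr (fderiv ℝ (fun y => χ (a n • y) • Z y) y) =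
      χ (a n • y) * tr (fderiv ℝ Z y) + a n * fderiv ℝ χ (a n • y) (Z y) := by
    intro n y
    have h : HasFDerivAt (fun y => χ (a n • y) • Z y) _ y :=
      (hcut n y).smul (hdZ y).hasFDerivAt
    rw [h.fderiv, tr_add, tr_smul, tr_smulRight]
    simp
  have hint : ∀ n, ∫ y, χ (a n • y) * tr (fderiv ℝ Z y) =
      -∫ y, a n * fderiv ℝ χ (a n • y) (Z y) := by
    intro n
    have h1 := integral_tr_fderiv_eq_zero (X := fun y => χ (a n • y) • Z y)
      ((hχ.comp (contDiff_const_smul (a n))).smul hZ)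
      ((χ.hasCompactSupport.comp_smul (ha0 n).ne').smul_right)
    simp only [hX] at h1
    rw [integral_add] at h1
    · linarith
    · refine hdiv.bdd_mul (c := 1) (by have := hχ.continuous; fun_prop)
        (Eventually.of_forall fun y => ?_)
      rw [Real.norm_of_nonneg χ.nonneg]
      exact χ.le_one
    · refine Integrable.const_mul ?_ _
      refine Integrable.mono' (hi.norm.const_mul K) ?_ (Eventually.of_forall fun y => ?_)
      · have h2 := hχ.continuous_fderiv one_ne_zero
        have h3 := hZ.continuous
        exact (Continuous.clm_apply (by fun_prop) h3).aestronglyMeasurable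
      · exact ContinuousLinearMap.le_of_opNorm_le _ (hK _) _
  have l1 : Tendsto (fun n => ∫ y, χ (a n • y) * tr (fderiv ℝ Z y)) atTop
      (𝓝 (∫ y, tr (fderiv ℝ Z y))) := by
    refine tendsto_integral_of_dominated_convergence (fun y => ‖tr (fderiv ℝ Z y)‖)
      (fun n => AEStronglyMeasurable.mul (by
        have := hχ.continuous
        exact Continuous.aestronglyMeasurable (by fun_prop)) hdiv.aestronglyMeasurable) hdiv.norm
      (fun n => Eventually.of_forall fun y => ?_) (Eventually.of_forall fun y => ?_)
    · rw [norm_mul, Real.norm_of_nonneg χ.nonneg]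
      exact mul_le_of_le_one_left (norm_nonneg _) χ.le_one
    · have h1 : Tendsto (fun n => χ (a n • y)) atTop (𝓝 1) := by
        have h2 : Tendsto (fun n => a n • y) atTop (𝓝 0) := by
          simpa using haT.smul_const y
        have h3 := (hχ.continuous.tendsto 0).comp h2
        rwa [χ.one_of_mem_closedBall (by simpa using χ.rIn_pos.le)] at h3
      simpa using h1.mul_const (tr (fderiv ℝ Z y))
  have l2 : Tendsto (fun n => -∫ y, a n * fderiv ℝ χ (a n • y) (Z y)) atTop (𝓝 0) := by
    have l3 : Tendsto (fun n => a n * (K * ∫ y, ‖Z y‖)) atTop (𝓝 0) := by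
      simpa using haT.mul_const (K * ∫ y, ‖Z y‖)
    refine squeeze_zero_norm (fun n => ?_) l3
    rw [norm_neg, integral_const_mul, norm_mul, Real.norm_of_nonneg (ha0 n).le]
    refine mul_le_mul_of_nonneg_left ?_ (ha0 n).le
    rw [← integral_const_mul]
    exact norm_integral_le_of_norm_le (hi.norm.const_mul K) (Eventually.of_forall fun y =>
      ContinuousLinearMap.le_of_opNorm_le _ (hK _) _)
  simp only [hint] at l1
  exact tendsto_nhds_unique l1 l2

end Trace

end AxisymEuler
end

noncomputable section
namespace AxisymEuler
open scoped Topology RealInnerProductSpace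
open Filter

section Regularised
variable {d : ℕ}

theorem integrable_reg {ε p : ℝ} (hε : 0 < ε) (hε1 : ε ≤ 1) (hp : (d : ℝ) < 2 * p) (x : Space d) :
    Integrable fun y : Space d => (‖x - y‖ ^ 2 + ε ^ 2) ^ (-p) := by
  have hp0 : 0 < p := by
    have : (0 : ℝ) ≤ d := Nat.cast_nonneg d
    linarith
  have h1 : Integrable fun z : Space d => (1 + ‖z‖ ^ 2) ^ (-(2 * p) / 2) :=
    integrable_rpow_neg_one_add_norm_sq (by simpa using hp)
  have h2 : Integrable fun y : Space d => (ε ^ 2) ^ (-p) * (1 + ‖x - y‖ ^ 2) ^ (-(2 * p) / 2) :=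
    (h1.comp_sub_left x).const_mul _
  refine h2.mono' (Continuous.aestronglyMeasurable ?_) (Eventually.of_forall fun y => ?_)
  · refine Continuous.rpow_const (by fun_prop) fun y => Or.inl ?_
    positivity
  · rw [Real.norm_of_nonneg (Real.rpow_nonneg (by positivity) _),
      show -(2 * p) / 2 = -p by ring, ← Real.mul_rpow (by positivity) (by positivity)]
    refine Real.rpow_le_rpow_of_nonpos (by positivity) ?_ (by linarith)
    have : ε ^ 2 ≤ 1 := pow_le_one₀ hε.le hε1
    nlinarith [sq_nonneg ‖x - y‖]

/-- The gradient, up to a constant, of the regularised Newtonian potential with pole `x`. -/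
def newtonField (ε : ℝ) (x y : Space d) : Space d :=
  (‖x - y‖ ^ 2 + ε ^ 2) ^ (-((d : ℝ) / 2)) • (y - x)

/-- The derivative of `newtonField ε x`. -/
def newtonDeriv (ε : ℝ) (x y : Space d) : Space d →L[ℝ] Space d :=
  (‖x - y‖ ^ 2 + ε ^ 2) ^ (-((d : ℝ) / 2)) • ContinuousLinearMap.id ℝ (Space d) +
    ((-(d : ℝ) * (‖x - y‖ ^ 2 + ε ^ 2) ^ (-((d : ℝ) / 2) - 1)) • innerSL ℝ (y - x)).smulRight (y - x)

theorem hasFDerivAt_newtonField {ε : ℝ} (hε : 0 < ε) (x y : Space d) :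
    HasFDerivAt (newtonField ε x) (newtonDeriv ε x y) y := by
  have h0 : HasFDerivAt (fun y : Space d => y - x) (ContinuousLinearMap.id ℝ (Space d)) y :=
    (hasFDerivAt_id y).sub_const x
  have h1 : HasFDerivAt (fun y : Space d => ‖y - x‖ ^ 2 + ε ^ 2) (2 • innerSL ℝ (y - x)) y := by
    have := (h0.norm_sq).add_const (ε ^ 2)
    refine this.congr_fderiv ?_
    ext v
    simp
  have h2 : HasFDerivAt (fun y : Space d => (‖x - y‖ ^ 2 + ε ^ 2) ^ (-((d : ℝ) / 2)))
      ((-(d : ℝ) * (‖x - y‖ ^ 2 + ε ^ 2) ^ (-((d : ℝ) / 2) - 1)) • innerSL ℝ (y - x)) y := by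
    simp only [norm_sub_rev x]
    refine (h1.rpow_const (p := -((d : ℝ) / 2)) (Or.inl (by positivity))).congr_fderiv ?_
    ext v
    simp
    ring
  exact h2.smul h0

theorem contDiff_newtonField {ε : ℝ} (hε : 0 < ε) (x : Space d) :
    ContDiff ℝ 1 (newtonField ε x) := by
  unfold newtonField
  have h' : ContDiff ℝ 1 fun y : Space d => y - x := contDiff_id.sub contDiff_const
  have h : ContDiff ℝ 1 fun y : Space d => x - y := contDiff_const.sub contDiff_id
  have h3 : ContDiff ℝ 1 fun y : Space d => (‖x - y‖ ^ 2 + ε ^ 2) ^ (-((d : ℝ) / 2)) :=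
    ((h.norm_sq ℝ).add contDiff_const).rpow_const_of_ne fun y => by positivity
  exact h3.smul h'

theorem inner_newtonDeriv (ε : ℝ) (x y a b : Space d) :
    ⟪newtonDeriv ε x y a, b⟫ = ⟪newtonDeriv ε x y b, a⟫ := by
  simp only [newtonDeriv, add_apply, smul_apply, ContinuousLinearMap.smulRight_apply, inner_add_left,
    inner_smul_left, ContinuousLinearMap.id_apply, innerSL_apply_apply, smul_eq_mul, conj_trivial]
  rw [real_inner_comm a b]
  ring

/-- The divergence of the regularised Newtonian field is a mollifier at scale `ε`. -/
theorem tr_newtonDeriv {ε : ℝ} (hε : 0 < ε) (x y : Space d) :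
    tr (newtonDeriv ε x y) = d * ε ^ 2 * (‖x - y‖ ^ 2 + ε ^ 2) ^ (-((d : ℝ) / 2) - 1) := by
  rw [newtonDeriv, tr_add, tr_smul, tr_id, tr_smulRight, smul_apply, innerSL_apply_apply,
    real_inner_self_eq_norm_sq, norm_sub_rev y x, smul_eq_mul]
  set s := ‖x - y‖ ^ 2 + ε ^ 2 with hs
  have hs0 : 0 < s := by positivity
  have e : s ^ (-((d : ℝ) / 2)) = s ^ (-((d : ℝ) / 2) - 1) * s := by
    rw [← Real.rpow_add_one hs0.ne']; congr 1; ring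
  rw [e, show ‖x - y‖ ^ 2 = s - ε ^ 2 by rw [hs]; ring]
  ring

theorem norm_newtonField_sq_le {ε : ℝ} (hε : 0 < ε) (x y : Space d) :
    ‖newtonField ε x y‖ ^ 2 ≤ (‖x - y‖ ^ 2 + ε ^ 2) ^ (-((d : ℝ) - 1)) := by
  rw [newtonField, norm_smul, norm_sub_rev y x, mul_pow,
    Real.norm_of_nonneg (Real.rpow_nonneg (by positivity) _)]
  set s := ‖x - y‖ ^ 2 + ε ^ 2 with hs
  have hs0 : 0 < s := by positivity
  have h1 : ‖x - y‖ ^ 2 ≤ s := le_add_of_nonneg_right (sq_nonneg ε)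
  refine (mul_le_mul_of_nonneg_left h1 (by positivity)).trans (le_of_eq ?_)
  rw [← Real.rpow_natCast, ← Real.rpow_mul hs0.le, ← Real.rpow_add_one hs0.ne']
  congr 1
  push_cast
  ring

theorem memLp_newtonField (hd : 3 ≤ d) {ε : ℝ} (hε : 0 < ε) (hε1 : ε ≤ 1) (x : Space d) :
    MemLp (newtonField ε x) 2 volume := by
  have hm := (contDiff_newtonField hε x).continuous.aestronglyMeasurable (μ := volume)
  rw [memLp_two_iff_integrable_sq_norm hm]
  have hd' : (3 : ℝ) ≤ d := by exact_mod_cast hd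
  refine (integrable_reg hε hε1 (p := (d : ℝ) - 1) (by linarith) x).mono' (hm.norm.pow 2)
    (Eventually.of_forall fun y => ?_)
  rw [Real.norm_of_nonneg (by positivity)]
  exact norm_newtonField_sq_le hε x y

variable {u : Space d → Space d}

/-- The vector field whose divergence encodes the Biot–Savart law. -/
def biotSavartField (ε : ℝ) (x e : Space d) (u : Space d → Space d) (y : Space d) : Space d :=
  ⟪u y, e⟫ • newtonField ε x y + ⟪newtonField ε x y, e⟫ • u y - ⟪newtonField ε x y, u y⟫ • e

theorem norm_biotSavartField_le (ε : ℝ) (x e y : Space d) :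
    ‖biotSavartField ε x e u y‖ ≤ 3 * ‖e‖ * (‖u y‖ * ‖newtonField ε x y‖) := by
  set P := newtonField ε x y with hP
  have h1 : ‖⟪u y, e⟫ • P‖ ≤ ‖u y‖ * ‖e‖ * ‖P‖ := by
    rw [norm_smul]
    exact mul_le_mul_of_nonneg_right (abs_real_inner_le_norm _ _) (norm_nonneg _)
  have h2 : ‖⟪P, e⟫ • u y‖ ≤ ‖P‖ * ‖e‖ * ‖u y‖ := by
    rw [norm_smul]
    exact mul_le_mul_of_nonneg_right (abs_real_inner_le_norm _ _) (norm_nonneg _)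
  have h3 : ‖⟪P, u y⟫ • e‖ ≤ ‖P‖ * ‖u y‖ * ‖e‖ := by
    rw [norm_smul]
    exact mul_le_mul_of_nonneg_right (abs_real_inner_le_norm _ _) (norm_nonneg _)
  have h4 := norm_sub_le (⟪u y, e⟫ • P + ⟪P, e⟫ • u y) (⟪P, u y⟫ • e)
  have h5 := norm_add_le (⟪u y, e⟫ • P) (⟪P, e⟫ • u y)
  rw [biotSavartField, ← hP]
  nlinarith

theorem contDiff_biotSavartField {ε : ℝ} (hε : 0 < ε) (x e : Space d) (hu : ContDiff ℝ 1 u) :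
    ContDiff ℝ 1 (biotSavartField ε x e u) := by
  have hP := contDiff_newtonField hε x
  exact (((hu.inner ℝ contDiff_const).smul hP).add ((hP.inner ℝ contDiff_const).smul hu)).sub
    ((hP.inner ℝ hu).smul contDiff_const)

/-- The divergence of `biotSavartField` is the mollifier times `⟪u, e⟫` plus a term in which the
derivative of `u` enters antisymmetrised, so that it carries only the vorticity. -/
theorem tr_fderiv_biotSavartField {ε : ℝ} (hε : 0 < ε) (x e : Space d) (hu : ContDiff ℝ 1 u)
    (hdiv : ∀ y, tr (fderiv ℝ u y) = 0) (y : Space d) :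
    tr (fderiv ℝ (biotSavartField ε x e u) y) =
      d * ε ^ 2 * (‖x - y‖ ^ 2 + ε ^ 2) ^ (-((d : ℝ) / 2) - 1) * ⟪u y, e⟫ +
      (⟪fderiv ℝ u y (newtonField ε x y), e⟫ - ⟪fderiv ℝ u y e, newtonField ε x y⟫) := by
  have hP := hasFDerivAt_newtonField hε x y
  have hU := (hu.differentiable one_ne_zero y).hasFDerivAt
  have he := hasFDerivAt_const (𝕜 := ℝ) e y
  have h : HasFDerivAt (biotSavartField ε x e u) _ y :=
    (((hU.inner ℝ he).smul hP).add ((hP.inner ℝ he).smul hU)).sub ((hP.inner ℝ hU).smul he)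
  rw [h.fderiv, tr_sub, tr_add, tr_add, tr_add, tr_add, tr_smul, tr_smul, tr_smul, tr_smulRight,
    tr_smulRight, tr_smulRight, hdiv, tr_newtonDeriv hε]
  simp only [tr, zero_apply, PiLp.zero_apply, Finset.sum_const_zero, ContinuousLinearMap.comp_apply,
    ContinuousLinearMap.prod_apply, fderivInnerCLM_apply, inner_zero_right]
  rw [inner_newtonDeriv ε x y (u y) e, real_inner_comm (newtonField ε x y) (fderiv ℝ u y e)]
  ring

/-- The mass of the mollifier in the regularised Biot–Savart law. -/
def mollMass (d : ℕ) : ℝ := ∫ v : Space d, d * (‖v‖ ^ 2 + 1) ^ (-((d : ℝ) / 2) - 1)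

theorem integrable_moll (d : ℕ) :
    Integrable fun v : Space d => d * (‖v‖ ^ 2 + 1) ^ (-((d : ℝ) / 2) - 1) := by
  have := (integrable_reg (d := d) one_pos le_rfl (p := (d : ℝ) / 2 + 1) (by linarith) 0).const_mul d
  rw [show -((d : ℝ) / 2 + 1) = -((d : ℝ) / 2) - 1 by ring] at this
  simpa using this

theorem integral_moll_eq {ε : ℝ} (hε : 0 < ε) (x e : Space d) :
    ∫ y, d * ε ^ 2 * (‖x - y‖ ^ 2 + ε ^ 2) ^ (-((d : ℝ) / 2) - 1) * ⟪u y, e⟫ =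
      ∫ v : Space d, d * (‖v‖ ^ 2 + 1) ^ (-((d : ℝ) / 2) - 1) * ⟪u (x + ε • v), e⟫ := by
  set F : Space d → ℝ := fun y =>
    d * ε ^ 2 * (‖x - y‖ ^ 2 + ε ^ 2) ^ (-((d : ℝ) / 2) - 1) * ⟪u y, e⟫ with hF
  have h1 : ∫ v, F (x + ε • v) = (ε ^ d)⁻¹ * ∫ y, F y := by
    have := Measure.integral_comp_smul (volume : Measure (Space d)) (fun z => F (x + z)) ε
    rw [this, integral_add_left_eq_self]
    simp [abs_of_pos hε]
  have h2 : ∀ v, F (x + ε • v) = (ε ^ d)⁻¹ *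
      (d * (‖v‖ ^ 2 + 1) ^ (-((d : ℝ) / 2) - 1) * ⟪u (x + ε • v), e⟫) := fun v => by
    simp only [hF]
    rw [show x - (x + ε • v) = -(ε • v) by abel, norm_neg, norm_smul, Real.norm_of_nonneg hε.le,
      show (ε * ‖v‖) ^ 2 + ε ^ 2 = ε ^ 2 * (‖v‖ ^ 2 + 1) by ring,
      Real.mul_rpow (by positivity) (by positivity)]
    have : (ε ^ 2) ^ (-((d : ℝ) / 2) - 1) = (ε ^ d)⁻¹ * (ε ^ 2)⁻¹ := by
      rw [← Real.rpow_natCast ε 2, ← Real.rpow_mul hε.le, ← Real.rpow_natCast ε d,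
        ← Real.rpow_neg hε.le, ← Real.rpow_neg hε.le, ← Real.rpow_add hε]
      congr 1
      push_cast
      ring
    rw [this]
    field_simp
  simp only [h2] at h1
  rw [integral_const_mul] at h1
  exact (mul_left_cancel₀ (inv_ne_zero (pow_ne_zero d hε.ne')) h1).symm

theorem abs_integral_moll_le {B : ℝ} (hB : ∀ y, ‖u y‖ ≤ B) (ε : ℝ) {x e : Space d}
    (he : ‖e‖ ≤ 1) :
    |∫ v : Space d, d * (‖v‖ ^ 2 + 1) ^ (-((d : ℝ) / 2) - 1) * ⟪u (x + ε • v), e⟫| ≤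
      mollMass d * B := by
  rw [mollMass, ← integral_mul_const, ← Real.norm_eq_abs]
  refine norm_integral_le_of_norm_le ((integrable_moll d).mul_const B)
    (Eventually.of_forall fun v => ?_)
  rw [norm_mul, Real.norm_of_nonneg (mul_nonneg (Nat.cast_nonneg d)
    (Real.rpow_nonneg (by positivity) _))]
  refine mul_le_mul_of_nonneg_left ?_ (mul_nonneg (Nat.cast_nonneg d)
    (Real.rpow_nonneg (by positivity) _))
  refine (norm_inner_le_norm _ _).trans ?_
  exact (mul_le_of_le_one_right (norm_nonneg _) he).trans (hB _)

theorem tendsto_integral_moll (hu : Continuous u) {B : ℝ} (hB : ∀ y, ‖u y‖ ≤ B) (x : Space d)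
    {e : Space d} (he : ‖e‖ ≤ 1) :
    Tendsto (fun ε : ℝ => ∫ v : Space d,
      d * (‖v‖ ^ 2 + 1) ^ (-((d : ℝ) / 2) - 1) * ⟪u (x + ε • v), e⟫) (𝓝[>] 0)
      (𝓝 (mollMass d * ⟪u x, e⟫)) := by
  rw [mollMass, ← integral_mul_const]
  have hnn : ∀ v : Space d, 0 ≤ d * (‖v‖ ^ 2 + 1) ^ (-((d : ℝ) / 2) - 1) := fun v =>
    mul_nonneg (Nat.cast_nonneg d) (Real.rpow_nonneg (by positivity) _)
  refine tendsto_integral_filter_of_dominated_convergence _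
    (Eventually.of_forall fun ε => (integrable_moll d).aestronglyMeasurable.mul ?_)
    (Eventually.of_forall fun ε => Eventually.of_forall fun v => ?_)
    ((integrable_moll d).mul_const B) (Eventually.of_forall fun v => ?_)
  · exact Continuous.aestronglyMeasurable (by fun_prop)
  · rw [norm_mul, Real.norm_of_nonneg (hnn v)]
    refine mul_le_mul_of_nonneg_left ?_ (hnn v)
    refine (norm_inner_le_norm _ _).trans ?_
    exact (mul_le_of_le_one_right (norm_nonneg _) he).trans (hB _)
  · have hc : Continuous fun ε : ℝ => d * (‖v‖ ^ 2 + 1) ^ (-((d : ℝ) / 2) - 1) *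
        ⟪u (x + ε • v), e⟫ := by fun_prop
    have := hc.tendsto 0
    simp only [zero_smul, add_zero] at this
    exact this.mono_left nhdsWithin_le_nhds

end Regularised

section
variable {d : ℕ} [NeZero d]

theorem ae_rad_pos (hd : 3 ≤ d) : ∀ᵐ x : Space d, 0 < rad x := by
  have h := lintegral_cyl (d := d) hd (G := (halfᶜ : Set (ℝ × ℝ)).indicator 1)
    (measurable_one.indicator measurableSet_half.compl)
  have h2 : ∫⁻ y in half, ENNReal.ofReal (y.1 ^ (d - 2)) *
      (halfᶜ : Set (ℝ × ℝ)).indicator (1 : ℝ × ℝ → ℝ≥0∞) y = 0 := by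
    rw [setLIntegral_congr_fun (g := fun _ => 0) measurableSet_half fun y hy => by
      simp [indicator, hy]]
    simp
  have h3 : volume ((cyl : Space d → ℝ × ℝ) ⁻¹' halfᶜ) = 0 := by
    rw [h2, mul_zero] at h
    rw [← lintegral_indicator_one (continuous_cyl.measurable measurableSet_half.compl)]
    exact h
  exact (measure_eq_zero_iff_ae_notMem.1 h3).mono fun x hx => by
    simpa [half, cyl] using hx

variable {u : Space d → Space d} {vr vz : ℝ → ℝ → ℝ}

/-- The radial velocity induced by the vorticity through the regularised kernel is a mollification
of the velocity field. -/
theorem inducedVel_eq_integral (hd : 3 ≤ d) (hu : ContDiff ℝ 1 u) (hax : IsAxisymNoSwirl u vr vz)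
    (hdiv : ∀ y, tr (fderiv ℝ u y) = 0) (hL2 : MemLp u 2 volume) {B : ℝ} (hB : ∀ y, ‖u y‖ ≤ B)
    (hw : Integrable fun y : Space d => curl (meridian hd u) (cyl y)) {ε : ℝ} (hε : 0 < ε)
    (hε1 : ε ≤ 1) (x : Space d) :
    inducedVel ε (fun y => curl (meridian hd u) (cyl y)) x =
      ∫ y, d * ε ^ 2 * (‖x - y‖ ^ 2 + ε ^ 2) ^ (-((d : ℝ) / 2) - 1) * ⟪u y, eR x⟫ := by
  set A : Space d → ℝ := fun y =>
    d * ε ^ 2 * (‖x - y‖ ^ 2 + ε ^ 2) ^ (-((d : ℝ) / 2) - 1) * ⟪u y, eR x⟫ with hA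
  have hZ := contDiff_biotSavartField hε x (eR x) hu
  have hZi : Integrable (biotSavartField ε x (eR x) u) := by
    have h1 : Integrable fun y => ‖u y‖ * ‖newtonField ε x y‖ :=
      hL2.norm.integrable_mul (memLp_newtonField hd hε hε1 x).norm
    exact (h1.const_mul (3 * ‖eR x‖)).mono' hZ.continuous.aestronglyMeasurable
      (Eventually.of_forall fun y => norm_biotSavartField_le ε x (eR x) y)
  have hAi : Integrable A := by
    have h1 : Integrable fun y : Space d =>
        d * ε ^ 2 * (‖x - y‖ ^ 2 + ε ^ 2) ^ (-((d : ℝ) / 2) - 1) := by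
      have := (integrable_reg (d := d) hε hε1 (p := (d : ℝ) / 2 + 1) (by linarith) x).const_mul
        (d * ε ^ 2)
      rwa [show -((d : ℝ) / 2 + 1) = -((d : ℝ) / 2) - 1 by ring] at this
    refine h1.mul_bdd (c := B * ‖eR x‖)
      (hu.continuous.inner continuous_const).aestronglyMeasurable
      (Eventually.of_forall fun y => ?_)
    exact (norm_inner_le_norm _ _).trans (mul_le_mul_of_nonneg_right (hB y) (norm_nonneg _))
  have hki := integrable_mul_ker hw hε x
  have hae : (fun y => tr (fderiv ℝ (biotSavartField ε x (eR x) u) y)) =ᵐ[volume]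
      fun y => A y - curl (meridian hd u) (cyl y) * ker ε x y := by
    filter_upwards [ae_rad_pos hd] with y hy
    rw [tr_fderiv_biotSavartField hε x (eR x) hu hdiv,
      hax.fderiv_antisymm (hd := hd) hu hy, ax_eR, newtonField, ax_smul, ax_sub, ker,
      real_inner_comm (eR x) (eR y)]
    simp only [hA]
    ring
  have h0 := integral_tr_fderiv_eq_zero_of_integrable hZ hZi ((hAi.sub hki).congr hae.symm)
  rw [integral_congr_ae hae, integral_sub hAi hki] at h0
  rw [inducedVel]
  linarith

theorem mollMass_pos : 0 < mollMass d := by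
  have hd : (0 : ℝ) < d := by exact_mod_cast NeZero.pos d
  have hp : ∀ v : Space d, 0 < d * (‖v‖ ^ 2 + 1) ^ (-((d : ℝ) / 2) - 1) := fun v =>
    mul_pos hd (Real.rpow_pos_of_pos (by positivity) _)
  rw [mollMass, integral_pos_iff_support_of_nonneg (fun v => (hp v).le) (integrable_moll d)]
  have : (Function.support fun v : Space d => d * (‖v‖ ^ 2 + 1) ^ (-((d : ℝ) / 2) - 1)) = univ :=
    eq_univ_of_forall fun v => (hp v).ne'
  rw [this]
  exact Measure.measure_univ_pos.2 (NeZero.ne _)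

/-- The Biot–Savart law, tested against a radial weight. -/
theorem tendsto_transport (hd : 3 ≤ d) (hu : ContDiff ℝ 1 u) (hax : IsAxisymNoSwirl u vr vz)
    (hdiv : ∀ y, tr (fderiv ℝ u y) = 0) (hL2 : MemLp u 2 volume) {B : ℝ} (hB : ∀ y, ‖u y‖ ≤ B)
    (hw : Integrable fun y : Space d => curl (meridian hd u) (cyl y)) {g : Space d → ℝ}
    (hg : Integrable g) :
    Tendsto (fun ε => ∫ x, g x * inducedVel ε (fun y => curl (meridian hd u) (cyl y)) x)
      (𝓝[>] 0) (𝓝 (mollMass d * ∫ x, g x * ⟪u x, eR x⟫)) := by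
  have hmem : Ioc (0 : ℝ) 1 ∈ 𝓝[>] (0 : ℝ) := Ioc_mem_nhdsGT one_pos
  have hV : ∀ ε ∈ Ioc (0 : ℝ) 1, ∀ x, inducedVel ε (fun y => curl (meridian hd u) (cyl y)) x =
      ∫ v : Space d, d * (‖v‖ ^ 2 + 1) ^ (-((d : ℝ) / 2) - 1) * ⟪u (x + ε • v), eR x⟫ :=
    fun ε hε x => (inducedVel_eq_integral hd hu hax hdiv hL2 hB hw hε.1 hε.2 x).trans
      (integral_moll_eq hε.1 x (eR x))
  rw [← integral_const_mul]
  refine tendsto_integral_filter_of_dominated_convergence (fun x => ‖g x‖ * (mollMass d * B))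
    ?_ ?_ (hg.norm.mul_const _) (Eventually.of_forall fun x => ?_)
  · filter_upwards [hmem] with ε hε
    exact (integrable_mul_inducedVel hg hw hε.1).aestronglyMeasurable
  · filter_upwards [hmem] with ε hε
    refine Eventually.of_forall fun x => ?_
    rw [norm_mul, hV ε hε]
    exact mul_le_mul_of_nonneg_left (abs_integral_moll_le hB ε (norm_eR_le x)) (norm_nonneg _)
  · have h1 := (tendsto_integral_moll hu.continuous hB x (norm_eR_le x)).const_mul (g x)
    rw [show mollMass d * (g x * ⟪u x, eR x⟫) = g x * (mollMass d * ⟪u x, eR x⟫) by ring]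
    refine h1.congr' ?_
    filter_upwards [hmem] with ε hε
    rw [hV ε hε]

end

end AxisymEuler
end

noncomputable section
namespace AxisymEuler
open scoped Topology RealInnerProductSpace
open Filter

/-! ### Moments of the vorticity along the flow -/

/-- The primitive of `r^{d-2} f(r)` that vanishes for `r ≤ 0`. -/
def weight (d : ℕ) (f : ℝ → ℝ) (r : ℝ) : ℝ := ∫ s in (0 : ℝ)..r, max s 0 ^ (d - 2) * f s

section Weight
variable {d : ℕ} {f : ℝ → ℝ}

theorem hasDerivAt_weight (hf : Continuous f) (r : ℝ) :
    HasDerivAt (weight d f) (max r 0 ^ (d - 2) * f r) r :=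
  (Continuous.integral_hasStrictDerivAt (by fun_prop) 0 r).hasDerivAt

theorem continuous_weight (hf : Continuous f) : Continuous (weight d f) :=
  continuous_iff_continuousAt.2 fun r => (hasDerivAt_weight hf r).continuousAt

theorem weight_eq_zero {a r : ℝ} (ha : 0 ≤ a) (hf : ∀ s, 0 < s → s ≤ a → f s = 0) (hd : 3 ≤ d)
    (hr : r ≤ a) : weight d f r = 0 := by
  rw [weight]
  refine (intervalIntegral.integral_congr (g := fun _ => 0) fun s hs => ?_).trans (by simp)
  have hs' : s ≤ a := (mem_uIcc.1 hs).elim (fun h => h.2.trans hr) fun h => h.2.trans ha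
  rcases le_or_gt s 0 with h | h
  · simp [max_eq_right h, show d - 2 ≠ 0 by omega]
  · simp [hf s h hs']

theorem weight_nonneg (hf : ∀ s, 0 ≤ f s) {r : ℝ} (hr : 0 ≤ r) : 0 ≤ weight d f r :=
  intervalIntegral.integral_nonneg hr fun s _ =>
    mul_nonneg (pow_nonneg (le_max_right _ _) _) (hf s)

theorem weight_const (hd : 3 ≤ d) {r : ℝ} (hr : 0 ≤ r) :
    weight d (fun _ => (d : ℝ) - 1) r = r ^ (d - 1) := by
  obtain ⟨k, rfl⟩ : ∃ k, d = k + 2 := ⟨d - 2, by omega⟩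
  rw [weight]
  have : ∀ s ∈ uIcc 0 r, max s 0 ^ (k + 2 - 2) * (((k + 2 : ℕ) : ℝ) - 1) = s ^ k * ((k : ℝ) + 1) := by
    intro s hs
    rw [uIcc_of_le hr] at hs
    rw [max_eq_left hs.1]
    rw [show k + 2 - 2 = k by omega]
    push_cast
    ring
  rw [intervalIntegral.integral_congr this, intervalIntegral.integral_mul_const, integral_pow]
  rw [show k + 2 - 1 = k + 1 by omega]
  field_simp
  simp

end Weight

/-- The facts about an axisymmetric Euler flow without swirl on the time interval `[0, t₁]` on which
the transport estimates rest. -/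
structure ControlledFlow {d : ℕ} [NeZero d] (hd : 3 ≤ d) (t₁ L R : ℝ)
    (u : ℝ → Space d → Space d) (ur uz : ℝ → ℝ → ℝ → ℝ) : Prop where
  planar : PlanarFlow t₁ L (fun t => meridian hd (u t))
  pos : 0 < R
  profile : ∀ t ∈ Icc 0 t₁, IsProfile R (curl (meridian hd (u t)))
  contDiff : ∀ t ∈ Icc 0 t₁, ContDiff ℝ 1 (u t)
  axisym : ∀ t ∈ Icc 0 t₁, IsAxisymNoSwirl (u t) (ur t) (uz t)
  div : ∀ t ∈ Icc 0 t₁, ∀ y, tr (fderiv ℝ (u t) y) = 0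
  memLp : ∀ t ∈ Icc 0 t₁, MemLp (u t) 2 volume
  bound : ∃ B, ∀ t ∈ Icc 0 t₁, ∀ y, ‖u t y‖ ≤ B

section
variable {d : ℕ} [NeZero d] {hd : 3 ≤ d} {t₁ L R : ℝ} {u : ℝ → Space d → Space d}
  {ur uz : ℝ → ℝ → ℝ → ℝ}

theorem IsAxisymNoSwirl.inner_eR {v : Space d → Space d} {vr vz : ℝ → ℝ → ℝ}
    (h : IsAxisymNoSwirl v vr vz) {x : Space d} (hx : 0 < rad x) :
    ⟪v x, eR x⟫ = (meridian hd v (cyl x)).1 := by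
  have h1 : ⟪(eZ : Space d), eR x⟫ = 0 := by rw [← ax_eq_inner, ax_eR]
  rw [h.eq_meridian (hd := hd) hx, inner_add_left, inner_smul_left, inner_smul_left, h1,
    real_inner_self_eq_norm_sq, norm_eR hx]
  simp

/-- The weight `g` with `g' = r^{d-2} f` is chosen so that its transport rate is an integral over
`ℝ^d` against `f`. -/
theorem ControlledFlow.hasDerivAt_moment (hF : ControlledFlow hd t₁ L R u ur uz) {f : ℝ → ℝ}
    (hf : Continuous f) {t : ℝ} (ht : t ∈ Ioo 0 t₁) :
    HasDerivAt (fun τ => ∫ y : ℝ × ℝ, weight d f y.1 * curl (meridian hd (u τ)) y)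
      ((sphereArea d)⁻¹ * ∫ x, f (rad x) * curl (meridian hd (u t)) (cyl x) * ⟪u t x, eR x⟫) t := by
  have ht' := Ioo_subset_Icc_self ht
  have h0 : ∀ r ≤ (0 : ℝ), max r 0 ^ (d - 2) * f r = 0 := fun r hr => by
    rw [max_eq_right hr, zero_pow (by omega), zero_mul]
  have h := hF.planar.hasDerivAt_moment hF.pos (fun t ht => (hF.profile t ht).support)
    (hasDerivAt_weight (d := d) hf) (by fun_prop)
    (fun r hr => weight_eq_zero le_rfl (fun s h1 h2 => absurd h1 (not_lt.2 h2)) hd hr) h0 ht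
  refine h.congr_deriv ?_
  set v := meridian hd (u t) with hv
  have hvc : Continuous v := (contDiff_meridian (hF.contDiff t ht')).continuous
  have hηc := (hF.profile t ht').continuous
  have e1 : ∫ x, f (rad x) * curl v (cyl x) * ⟪u t x, eR x⟫ =
      ∫ x : Space d, f (rad x) * curl v (cyl x) * (v (cyl x)).1 := by
    refine integral_congr_ae ((ae_rad_pos hd).mono fun x hx => ?_)
    simp only
    rw [(hF.axisym t ht').inner_eR (hd := hd) hx]
  have e2 := integral_cyl hd (G := fun y => f y.1 * curl v y * (v y).1)
    (by fun_prop : Continuous fun y : ℝ × ℝ => f y.1 * curl v y * (v y).1).measurable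
  have e3 : ∫ x : Space d, f (rad x) * curl v (cyl x) * (v (cyl x)).1 = _ := e2
  rw [e1, e3, inv_mul_cancel_left₀ (sphereArea_pos hd).ne', ← integral_indicator measurableSet_half]
  refine integral_congr_ae (Eventually.of_forall fun y => ?_)
  by_cases hy : y ∈ half
  · have hy0 : 0 < y.1 := hy
    simp only
    rw [indicator_of_mem hy, max_eq_left hy0.le]
    ring
  · simp only
    rw [indicator_of_notMem hy, h0 _ (not_lt.1 hy)]
    ring

theorem ControlledFlow.continuousOn_moment (hF : ControlledFlow hd t₁ L R u ur uz) {f : ℝ → ℝ}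
    (hf : Continuous f) :
    ContinuousOn (fun τ => ∫ y : ℝ × ℝ, weight d f y.1 * curl (meridian hd (u τ)) y) (Icc 0 t₁) :=
  hF.planar.continuousOn_moment (fun t ht => (hF.profile t ht).support) (continuous_weight hf)
    fun _ hr => weight_eq_zero le_rfl (fun _ h1 h2 => absurd h1 (not_lt.2 h2)) hd hr

theorem ControlledFlow.tendsto_transport (hF : ControlledFlow hd t₁ L R u ur uz) {t : ℝ}
    (ht : t ∈ Icc 0 t₁) {f : ℝ → ℝ} (hf : Continuous f) :
    Tendsto (fun ε => ∫ x : Space d, f (rad x) * curl (meridian hd (u t)) (cyl x) *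
      inducedVel ε (fun y => curl (meridian hd (u t)) (cyl y)) x) (𝓝[>] 0)
      (𝓝 (mollMass d * ∫ x, f (rad x) * curl (meridian hd (u t)) (cyl x) * ⟪u t x, eR x⟫)) := by
  obtain ⟨B, hB⟩ := hF.bound
  have hp := hF.profile t ht
  refine AxisymEuler.tendsto_transport hd (hF.contDiff t ht) (hF.axisym t ht) (hF.div t ht)
    (hF.memLp t ht) (hB t ht) hp.integrable_cyl ?_
  simp only [mul_comm (f _)]
  exact hp.integrable_cyl_mul (hf.comp continuous_rad)

/-- The impulse `∬ r^{d-1} ω` is conserved: it is the moment belonging to a constant `f`, and a constant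
is not transported. -/
theorem ControlledFlow.impulse_eq (hF : ControlledFlow hd t₁ L R u ur uz) {t : ℝ}
    (ht : t ∈ Icc 0 t₁) :
    impulse d (curl (meridian hd (u t))) = impulse d (curl (meridian hd (u 0))) := by
  set f : ℝ → ℝ := fun _ => (d : ℝ) - 1 with hf
  have hfc : Continuous f := continuous_const
  have himp : ∀ τ, ∫ y : ℝ × ℝ, weight d f y.1 * curl (meridian hd (u τ)) y =
      impulse d (curl (meridian hd (u τ))) := fun τ => by
    rw [impulse, ← integral_indicator measurableSet_half]
    refine integral_congr_ae (Eventually.of_forall fun y => ?_)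
    simp only
    by_cases hy : y ∈ half
    · rw [indicator_of_mem hy, weight_const hd (le_of_lt hy)]
    · rw [indicator_of_notMem hy, weight_eq_zero le_rfl
        (fun s h1 h2 => absurd h1 (not_lt.2 h2)) hd (not_lt.1 hy), zero_mul]
  rcases ht.1.eq_or_lt with h0 | h0
  · rw [h0]
  have hsub : Icc 0 t ⊆ Icc 0 t₁ := Icc_subset_Icc_right ht.2
  obtain ⟨c, hc, hslope⟩ := exists_hasDerivAt_eq_slope _ _ h0
    ((hF.continuousOn_moment hfc).mono hsub)
    fun s hs => hF.hasDerivAt_moment hfc ⟨hs.1, hs.2.trans_le ht.2⟩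
  have hc' : c ∈ Icc 0 t₁ := hsub (Ioo_subset_Icc_self hc)
  have hzero : mollMass d * ∫ x, f (rad x) * curl (meridian hd (u c)) (cyl x) * ⟪u c x, eR x⟫ = 0 := by
    refine tendsto_nhds_unique (hF.tendsto_transport hc' hfc) ?_
    refine tendsto_const_nhds.congr' ?_
    filter_upwards [self_mem_nhdsWithin] with ε hε
    exact ((hF.profile c hc').transport_const_eq_zero _ hε).symm
  rw [(mul_eq_zero.1 hzero).resolve_left mollMass_pos.ne', mul_zero, himp, himp] at hslope
  have := (div_eq_zero_iff.1 hslope.symm).resolve_right (by linarith)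
  linarith

/-- The transport rate of a Lipschitz weight supported in a shell. -/
theorem exists_abs_rate_le (hd : 3 ≤ d) : ∃ C : ℝ, 0 < C ∧ ∀ (t₁ L R : ℝ)
    (u : ℝ → Space d → Space d) (ur uz : ℝ → ℝ → ℝ → ℝ), ControlledFlow hd t₁ L R u ur uz →
    ∀ t ∈ Icc 0 t₁, ∀ (f : ℝ → ℝ) (l ρ ρ' : ℝ), Continuous f → (∀ r, |f r| ≤ l * ρ) →
    (∀ r s, |f r - f s| ≤ l * |r - s|) → (∀ r, r ∉ Icc ρ' ρ → f r = 0) → 0 ≤ l → 0 < ρ →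
    ρ / 2 ≤ ρ' →
    |(sphereArea d)⁻¹ * ∫ x, f (rad x) * curl (meridian hd (u t)) (cyl x) * ⟪u t x, eR x⟫| ≤
      C * l / ρ * impulse d (curl (meridian hd (u 0))) * tail (curl (meridian hd (u t))) ρ' := by
  obtain ⟨C, hC, H⟩ := exists_abs_transport_le (d := d) hd
  have hσ := sphereArea_pos hd
  have hm := mollMass_pos (d := d)
  refine ⟨C / (sphereArea d * mollMass d), by positivity, ?_⟩
  intro t₁ L R u ur uz hF t ht f l ρ ρ' hf hfB hfl hf0 hl hρ hρ'
  have h1 : |mollMass d * ∫ x, f (rad x) * curl (meridian hd (u t)) (cyl x) * ⟪u t x, eR x⟫| ≤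
      C * l * (tail (curl (meridian hd (u t))) ρ' * impulse d (curl (meridian hd (u t)))) / ρ := by
    refine le_of_tendsto (hF.tendsto_transport ht hf).abs ?_
    filter_upwards [self_mem_nhdsWithin] with ε hε
    exact H R _ (hF.profile t ht) f l ρ ρ' ε hf.measurable hfB hfl hf0 hl hρ hρ' hε
  rw [hF.impulse_eq ht, abs_mul, abs_of_pos hm] at h1
  rw [abs_mul, abs_of_pos (inv_pos.2 hσ)]
  rw [← le_div_iff₀' hm] at h1
  refine (mul_le_mul_of_nonneg_left h1 (inv_pos.2 hσ).le).trans (le_of_eq ?_)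
  field_simp

end

end AxisymEuler
end

noncomputable section
namespace AxisymEuler
open scoped Topology RealInnerProductSpace
open Filter

/-! ### Gain of a power of time for the tail of the vorticity -/

/-- A tent of slope `l` over the interval `[ρ - h, ρ]`. -/
def tent (l h ρ r : ℝ) : ℝ := l * max 0 (h / 2 - |r - (ρ - h / 2)|)

section Tent
variable {l h ρ : ℝ}

theorem continuous_tent : Continuous (tent l h ρ) := by
  unfold tent; fun_prop

theorem tent_nonneg (hl : 0 ≤ l) (r : ℝ) : 0 ≤ tent l h ρ r :=
  mul_nonneg hl (le_max_left _ _)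

theorem abs_tent_le (hl : 0 ≤ l) (hh : 0 ≤ h) (hρ : h ≤ ρ) (r : ℝ) : |tent l h ρ r| ≤ l * ρ := by
  rw [abs_of_nonneg (tent_nonneg hl r)]
  refine mul_le_mul_of_nonneg_left (max_le (by linarith) ?_) hl
  have := abs_nonneg (r - (ρ - h / 2))
  linarith

theorem abs_tent_sub_le (hl : 0 ≤ l) (r s : ℝ) :
    |tent l h ρ r - tent l h ρ s| ≤ l * |r - s| := by
  rw [tent, tent, ← mul_sub, abs_mul, abs_of_nonneg hl]
  refine mul_le_mul_of_nonneg_left ?_ hl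
  rw [max_comm 0, max_comm 0]
  refine (abs_max_sub_max_le_abs _ _ _).trans ?_
  rw [sub_sub_sub_cancel_left]
  refine (abs_abs_sub_abs_le _ _).trans (le_of_eq ?_)
  rw [abs_sub_comm]
  congr 1
  ring

theorem tent_eq_zero {r : ℝ} (hr : r ≤ ρ - h ∨ ρ ≤ r) : tent l h ρ r = 0 := by
  rw [tent, max_eq_left, mul_zero]
  rcases hr with hr | hr
  · have := neg_abs_le (r - (ρ - h / 2)); linarith
  · have := le_abs_self (r - (ρ - h / 2)); linarith

/-- With slope `2^{d+1} h^{-2} ρ^{-(d-2)}`, the weight of the tent is at least `1` beyond `ρ`. -/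
theorem one_le_weight_tent {d : ℕ} (hd : 3 ≤ d) (hh : 0 < h) (hρ : h ≤ ρ / 2) {r : ℝ} (hr : ρ ≤ r) :
    1 ≤ weight d (tent (2 ^ (d + 1) / (h ^ 2 * ρ ^ (d - 2))) h ρ) r := by
  have hρ0 : 0 < ρ := by linarith
  set l : ℝ := 2 ^ (d + 1) / (h ^ 2 * ρ ^ (d - 2)) with hl
  have hl0 : 0 < l := by positivity
  set F : ℝ → ℝ := fun s => max s 0 ^ (d - 2) * tent l h ρ s with hF
  have hFc : Continuous F := by
    have := continuous_tent (l := l) (h := h) (ρ := ρ)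
    simp only [hF]
    fun_prop
  have hF0 : ∀ s, 0 ≤ F s := fun s =>
    mul_nonneg (pow_nonneg (le_max_right _ _) _) (tent_nonneg hl0.le s)
  -- the middle half of the tent carries enough mass
  have h1 : ∫ s in (ρ - 3 * h / 4)..(ρ - h / 4), ((ρ / 2) ^ (d - 2) * (l * (h / 4))) ≤
      ∫ s in (ρ - 3 * h / 4)..(ρ - h / 4), F s := by
    refine intervalIntegral.integral_mono_on (by linarith) (by simp) (hFc.intervalIntegrable _ _)
      fun s hs => ?_
    refine mul_le_mul (pow_le_pow_left₀ (by linarith) (le_max_of_le_left (by linarith [hs.1])) _)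
      (mul_le_mul_of_nonneg_left (le_max_of_le_right ?_) hl0.le) (by positivity)
      (pow_nonneg (le_max_right _ _) _)
    have : |s - (ρ - h / 2)| ≤ h / 4 := abs_le.2 ⟨by linarith [hs.1], by linarith [hs.2]⟩
    linarith
  have h2 : ∫ s in (ρ - 3 * h / 4)..(ρ - h / 4), F s ≤ ∫ s in (0 : ℝ)..r, F s :=
    intervalIntegral.integral_mono_interval (by linarith) (by linarith) (by linarith)
      (Eventually.of_forall hF0) (hFc.intervalIntegrable _ _)
  refine le_trans (le_of_eq ?_) (h1.trans h2)
  rw [intervalIntegral.integral_const, smul_eq_mul, hl, div_pow]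
  obtain ⟨k, rfl⟩ : ∃ k, d = k + 2 := ⟨d - 2, by omega⟩
  rw [show k + 2 - 2 = k by omega]
  field_simp
  ring

end Tent

/-- A weight which is at least `1` beyond `ρ` dominates the tail. -/
theorem IsProfile.tail_le_weight {d : ℕ} {R : ℝ} {η : ℝ × ℝ → ℝ} (hη : IsProfile R η)
    (hd : 3 ≤ d) {f : ℝ → ℝ}
    (hf : Continuous f) (hf0 : ∀ s, 0 ≤ f s) {ρ : ℝ} (hρ : 0 < ρ)
    (h1 : ∀ r, ρ ≤ r → 1 ≤ weight d f r) :
    tail η ρ ≤ ∫ y : ℝ × ℝ, weight d f y.1 * η y := by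
  have hz : ∀ y : ℝ × ℝ, y ∉ half → weight d f y.1 * η y = 0 := fun y hy => by
    rw [weight_eq_zero le_rfl (fun _ h1 h2 => absurd h1 (not_lt.2 h2)) hd (not_lt.1 hy), zero_mul]
  rw [← setIntegral_eq_integral_of_forall_compl_eq_zero hz]
  have hi := hη.integrableOn_half (continuous_weight (d := d) hf)
  have hnn : ∀ y ∈ half, 0 ≤ weight d f y.1 * η y := fun y hy =>
    mul_nonneg (weight_nonneg hf0 (le_of_lt hy)) (hη.nonneg y hy)
  refine le_trans (setIntegral_mono_on (hη.integrableOn_outer hρ)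
    (hi.mono_set (outer_subset_half hρ)) (measurableSet_outer ρ) fun y hy => ?_)
    (setIntegral_mono_set hi ((ae_restrict_iff' measurableSet_half).2 (Eventually.of_forall hnn))
      (outer_subset_half hρ).eventuallyLE)
  exact le_mul_of_one_le_left (hη.nonneg y (outer_subset_half hρ hy)) (h1 _ hy.2)

theorem IsProfile.tail_le_impulse {d : ℕ} {R : ℝ} {η : ℝ × ℝ → ℝ} (hη : IsProfile R η)
    {ρ : ℝ} (hρ : 0 < ρ) :
    tail η ρ ≤ impulse d η / ρ ^ (d - 1) := by
  have hi := hη.integrableOn_half (g := fun r => r ^ (d - 1)) (by fun_prop)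
  have hsub := outer_subset_half hρ
  rw [le_div_iff₀ (by positivity), tail, ← integral_mul_const, impulse]
  refine le_trans (setIntegral_mono_on ((hη.integrableOn_outer hρ).mul_const _)
    (hi.mono_set hsub) (measurableSet_outer ρ) fun y hy => ?_)
    (setIntegral_mono_set hi ((ae_restrict_iff' measurableSet_half).2
      (Eventually.of_forall fun y hy => mul_nonneg (pow_nonneg (le_of_lt hy) _) (hη.nonneg y hy)))
      hsub.eventuallyLE)
  rw [mul_comm]
  exact mul_le_mul_of_nonneg_right (pow_le_pow_left₀ hρ.le hy.2 _) (hη.nonneg y (hsub hy))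

section
variable {d : ℕ} [NeZero d] {t₁ L R : ℝ} {u : ℝ → Space d → Space d}
  {ur uz : ℝ → ℝ → ℝ → ℝ}

/-- A bound `K t^k` for the mass beyond `ρ - h` gives a bound of order `t^{k+1}` for the mass
beyond `ρ`. -/
theorem exists_tail_step (hd : 3 ≤ d) : ∃ C : ℝ, 0 < C ∧ ∀ (t₁ L R : ℝ)
    (u : ℝ → Space d → Space d) (ur uz : ℝ → ℝ → ℝ → ℝ), ControlledFlow hd t₁ L R u ur uz →
    ∀ (ρ h K : ℝ) (k : ℕ), 0 < h → h ≤ ρ / 2 →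
    (∀ y : ℝ × ℝ, ρ - h ≤ y.1 → curl (meridian hd (u 0)) y = 0) →
    (∀ t ∈ Icc 0 t₁, tail (curl (meridian hd (u t))) (ρ - h) ≤ K * t ^ k) →
    ∀ t ∈ Icc 0 t₁, tail (curl (meridian hd (u t))) ρ ≤
      C * impulse d (curl (meridian hd (u 0))) / (h ^ 2 * ρ ^ (d - 1)) * K *
        (t ^ (k + 1) / (k + 1)) := by
  obtain ⟨C, hC, H⟩ := exists_abs_rate_le (d := d) hd
  refine ⟨C * 2 ^ (d + 1), by positivity, ?_⟩
  intro t₁ L R u ur uz hF ρ h K k hh hhρ h0 hK t ht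
  have hρ : 0 < ρ := by linarith
  set I := impulse d (curl (meridian hd (u 0))) with hI
  have m0 : (0 : ℝ) ∈ Icc 0 t₁ := ⟨le_rfl, ht.1.trans ht.2⟩
  have hI0 : 0 ≤ I := (hF.profile 0 m0).impulse_nonneg
  set l : ℝ := 2 ^ (d + 1) / (h ^ 2 * ρ ^ (d - 2)) with hl
  have hl0 : 0 ≤ l := by positivity
  set f := tent l h ρ with hf
  have hfc : Continuous f := continuous_tent
  set Φ : ℝ → ℝ := fun τ => ∫ y : ℝ × ℝ, weight d f y.1 * curl (meridian hd (u τ)) y with hΦ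
  set A : ℝ := C * l / ρ * I with hA
  have hA0 : 0 ≤ A := by positivity
  have hΦ0 : Φ 0 = 0 := by
    refine (integral_congr_ae (g := fun _ => 0) (Eventually.of_forall fun y => ?_)).trans (by simp)
    simp only
    rcases le_total (ρ - h) y.1 with hy | hy
    · rw [h0 y hy, mul_zero]
    · rw [weight_eq_zero (a := ρ - h) (by linarith) (fun s _ hs => tent_eq_zero (Or.inl hs)) hd hy,
        zero_mul]
  -- `Φ` grows at most like the integral of the bound for the tail beyond `ρ - h`
  set Ψ : ℝ → ℝ := fun τ => Φ τ - A * K * (τ ^ (k + 1) / (k + 1)) with hΨ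
  have hk : ((k : ℝ) + 1) ≠ 0 := by positivity
  have hder : ∀ s ∈ Ioo 0 t₁, HasDerivAt Ψ (((sphereArea d)⁻¹ * ∫ x, f (rad x) *
      curl (meridian hd (u s)) (cyl x) * ⟪u s x, eR x⟫) - A * K * s ^ k) s := by
    intro s hs
    refine (hF.hasDerivAt_moment hfc hs).sub ?_
    have := ((hasDerivAt_pow (k + 1) s).div_const ((k : ℝ) + 1)).const_mul (A * K)
    refine this.congr_deriv ?_
    push_cast
    field_simp
  have hanti : AntitoneOn Ψ (Icc 0 t₁) := by
    refine antitoneOn_of_deriv_nonpos (convex_Icc 0 t₁)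
      ((hF.continuousOn_moment hfc).sub (by fun_prop)) (fun s hs => ?_) fun s hs => ?_
    · rw [interior_Icc] at hs
      exact (hder s hs).differentiableAt.differentiableWithinAt
    · rw [interior_Icc] at hs
      have hs' := Ioo_subset_Icc_self hs
      rw [(hder s hs).deriv]
      have h1 := H t₁ L R u ur uz hF s hs' f l ρ (ρ - h) hfc
        (abs_tent_le hl0 hh.le (by linarith)) (abs_tent_sub_le hl0) (fun r hr => by
          refine tent_eq_zero ?_
          by_contra! hne
          exact hr ⟨hne.1.le, hne.2.le⟩) hl0 hρ (by linarith)
      have h2 := mul_le_mul_of_nonneg_left (hK s hs') hA0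
      have h3 := (le_abs_self _).trans h1
      rw [← mul_assoc] at h2
      linarith
  have h1 := hanti m0 ht ht.1
  have h2 : Ψ 0 = 0 := by simp [hΨ, hΦ0]
  have h3 : tail (curl (meridian hd (u t))) ρ ≤ Φ t :=
    (hF.profile t ht).tail_le_weight hd hfc (tent_nonneg hl0) hρ
      fun r hr => one_le_weight_tent hd hh hhρ hr
  have h4 : A = C * 2 ^ (d + 1) * I / (h ^ 2 * ρ ^ (d - 1)) := by
    rw [hA, hl, show d - 1 = (d - 2) + 1 by omega, pow_succ ρ]
    field_simp
  rw [← h4]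
  rw [h2] at h1
  simp only [hΨ] at h1
  linarith

/-- Iterating over `n` shells of width `r/(2n)`. -/
theorem exists_tail_le (hd : 3 ≤ d) : ∃ C : ℝ, 0 < C ∧ ∀ (t₁ L R : ℝ)
    (u : ℝ → Space d → Space d) (ur uz : ℝ → ℝ → ℝ → ℝ), ControlledFlow hd t₁ L R u ur uz →
    ∀ (r : ℝ) (n : ℕ), 0 < r → 0 < n →
    (∀ y : ℝ × ℝ, r / 2 ≤ y.1 → curl (meridian hd (u 0)) y = 0) →
    ∀ t ∈ Icc 0 t₁, tail (curl (meridian hd (u t))) r ≤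
      impulse d (curl (meridian hd (u 0))) / (r / 2) ^ (d - 1) *
      (C * impulse d (curl (meridian hd (u 0))) * n * t / r ^ (d + 1)) ^ n := by
  obtain ⟨C, hC, H⟩ := exists_tail_step (d := d) hd
  refine ⟨C * 2 ^ (d + 1) * Real.exp 1, by positivity, ?_⟩
  intro t₁ L R u ur uz hF r n hr hn h0 t ht
  set I := impulse d (curl (meridian hd (u 0))) with hI
  have m0 : (0 : ℝ) ∈ Icc 0 t₁ := ⟨le_rfl, ht.1.trans ht.2⟩
  have hI0 : 0 ≤ I := (hF.profile 0 m0).impulse_nonneg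
  have hn' : (0 : ℝ) < n := by exact_mod_cast hn
  set h : ℝ := r / (2 * n) with hh
  have hh0 : 0 < h := by positivity
  set K₀ : ℝ := I / (r / 2) ^ (d - 1) with hK₀
  set A : ℝ := C * I / (h ^ 2 * (r / 2) ^ (d - 1)) with hA
  have hK₀0 : 0 ≤ K₀ := by positivity
  have hA0 : 0 ≤ A := by positivity
  have hhr : h ≤ r / 2 := by
    rw [hh, div_le_div_iff₀ (by positivity) (by norm_num)]
    have : (1 : ℝ) ≤ n := by exact_mod_cast hn
    nlinarith
  have claim : ∀ k : ℕ, ∀ s ∈ Icc 0 t₁, tail (curl (meridian hd (u s))) (r / 2 + k * h) ≤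
      K₀ * A ^ k / k.factorial * s ^ k := by
    intro k
    induction k with
    | zero =>
      intro s hs
      have := (hF.profile s hs).tail_le_impulse (d := d) (ρ := r / 2) (by positivity)
      rw [hF.impulse_eq hs] at this
      simpa using this
    | succ k ih =>
      intro s hs
      have hkh : 0 ≤ k * h := by positivity
      have e1 : r / 2 + ((k + 1 : ℕ) : ℝ) * h - h = r / 2 + k * h := by push_cast; ring
      have hρ : r / 2 ≤ r / 2 + ((k + 1 : ℕ) : ℝ) * h := by push_cast; linarith
      have hstep := H t₁ L R u ur uz hF (r / 2 + ((k + 1 : ℕ) : ℝ) * h) h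
        (K₀ * A ^ k / k.factorial) k hh0 (by push_cast; linarith)
        (fun y hy => h0 y (by rw [e1] at hy; linarith)) (fun τ hτ => by rw [e1]; exact ih τ hτ) s hs
      have hs0 : 0 ≤ s := hs.1
      refine hstep.trans ?_
      have hle : C * I / (h ^ 2 * (r / 2 + ((k + 1 : ℕ) : ℝ) * h) ^ (d - 1)) ≤ A := by
        rw [hA]
        gcongr
      calc _ ≤ A * (K₀ * A ^ k / k.factorial) * (s ^ (k + 1) / (k + 1)) := by
            gcongr
        _ = _ := by
            rw [Nat.factorial_succ]
            push_cast
            field_simp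
            ring
  have e2 : r / 2 + (n : ℝ) * h = r := by rw [hh]; field_simp; ring
  have h1 := claim n t ht
  rw [e2] at h1
  refine h1.trans ?_
  have ht0 : 0 ≤ t := ht.1
  -- `n! ≥ (n/e)^n`
  have hfac : ((n : ℝ) / Real.exp 1) ^ n ≤ n.factorial := by
    have h2 := Real.pow_div_factorial_le_exp (n : ℝ) hn'.le n
    rw [div_le_iff₀ (by positivity)] at h2
    rw [div_pow, ← Real.exp_nat_mul, mul_one, div_le_iff₀ (Real.exp_pos _)]
    linarith
  have e3 : C * 2 ^ (d + 1) * Real.exp 1 * I * n * t / r ^ (d + 1) = A * t / (n / Real.exp 1) := by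
    rw [hA, hh]
    obtain ⟨k, rfl⟩ : ∃ k, d = k + 2 := ⟨d - 2, by omega⟩
    rw [show k + 2 - 1 = k + 1 by omega]
    rw [div_pow r 2]
    field_simp
    ring
  have e4 : K₀ * A ^ n / n.factorial * t ^ n = K₀ * ((A * t) ^ n / n.factorial) := by
    rw [mul_pow]; ring
  rw [e3, div_pow (A * t), e4]
  gcongr

end

end AxisymEuler
end

noncomputable section
namespace AxisymEuler
open scoped Topology RealInnerProductSpace
open Filter

/-! ### From the tail estimate to polynomial decay -/

/-- If `X` exceeds a large multiple of `(1 + t) ln(e + t)`, it also exceeds a given multiple of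
`t ln X`. -/
theorem mul_log_le {D t X : ℝ} (hD : 1 ≤ D) (ht : 0 ≤ t)
    (hX : 16 * D ^ 2 * ((1 + t) * Real.log (Real.exp 1 + t)) ≤ X) : D * t * Real.log X ≤ X := by
  have hlog : 1 ≤ Real.log (Real.exp 1 + t) := by
    rw [Real.le_log_iff_exp_le (by positivity)]
    linarith
  have h1t : 0 < 1 + t := by linarith
  set z := X / (1 + t) with hz
  have hXz : X = (1 + t) * z := by rw [hz]; field_simp
  have hz1 : 16 * D ^ 2 * Real.log (Real.exp 1 + t) ≤ z := by
    rw [hz, le_div_iff₀ h1t]; linarith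
  have hz2 : 16 * D ^ 2 ≤ z := le_trans (le_mul_of_one_le_right (by positivity) hlog) hz1
  have hz0 : 0 < z := lt_of_lt_of_le (by positivity) hz2
  have l1 : D * Real.log z ≤ z / 2 := by
    have h1 : Real.log z ≤ 2 * √z := by
      have := Real.log_le_self (Real.sqrt_nonneg z)
      rw [Real.log_sqrt hz0.le] at this
      linarith
    have h2 : 4 * D ≤ √z := Real.le_sqrt_of_sq_le (by nlinarith)
    have h3 : √z * √z = z := Real.mul_self_sqrt hz0.le
    nlinarith [Real.sqrt_nonneg z]
  have l2 : D * Real.log (1 + t) ≤ z / 2 := by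
    have h1 : Real.log (1 + t) ≤ Real.log (Real.exp 1 + t) :=
      Real.log_le_log h1t (by linarith [Real.one_le_exp (zero_le_one (α := ℝ))])
    have h2 : D * Real.log (1 + t) ≤ D * Real.log (Real.exp 1 + t) :=
      mul_le_mul_of_nonneg_left h1 (by linarith)
    nlinarith
  have hlX : Real.log X = Real.log (1 + t) + Real.log z := by
    rw [hXz, Real.log_mul h1t.ne' hz0.ne']
  have h5 : D * Real.log X ≤ z := by rw [hlX]; linarith
  calc D * t * Real.log X = t * (D * Real.log X) := by ring
    _ ≤ t * z := mul_le_mul_of_nonneg_left h5 ht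
    _ ≤ X := by rw [hXz]; nlinarith

/-- The number of iterations `n = ⌈q ln r⌉` turns the bound `e^{-n}` into `r^{-q}`. -/
theorem pow_ceil_le {q : ℕ} {C r t x : ℝ} (hq : 1 ≤ q) (hC : 0 < C) (ht : 0 ≤ t)
    (hr : Real.exp 1 ≤ r) {m : ℕ} (hx : x = C * ⌈q * Real.log r⌉₊ * t / r ^ m)
    (hm : Real.exp 1 * C * (q + 1) * t * Real.log r ≤ r ^ m) :
    0 < ⌈q * Real.log r⌉₊ ∧ x ^ ⌈q * Real.log r⌉₊ ≤ 1 / r ^ q := by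
  have hr0 : 0 < r := (Real.exp_pos 1).trans_le hr
  have hlog : 1 ≤ Real.log r := (Real.le_log_iff_exp_le hr0).2 hr
  have hq' : (1 : ℝ) ≤ q := by exact_mod_cast hq
  have hql : 0 < q * Real.log r := by positivity
  set n := ⌈q * Real.log r⌉₊ with hn
  have hn1 : q * Real.log r ≤ n := Nat.le_ceil _
  have hn2 : (n : ℝ) ≤ (q + 1) * Real.log r := by
    have := Nat.ceil_lt_add_one hql.le
    linarith
  refine ⟨Nat.ceil_pos.2 hql, ?_⟩
  have hx0 : 0 ≤ x := by rw [hx]; positivity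
  have hx1 : x ≤ Real.exp (-1) := by
    rw [hx, div_le_iff₀ (by positivity), Real.exp_neg, inv_mul_eq_div,
      le_div_iff₀ (Real.exp_pos 1)]
    refine le_trans ?_ hm
    calc C * n * t * Real.exp 1 = Real.exp 1 * C * t * n := by ring
      _ ≤ Real.exp 1 * C * t * ((q + 1) * Real.log r) := by gcongr
      _ = _ := by ring
  calc x ^ n ≤ Real.exp (-1) ^ n := pow_le_pow_left₀ hx0 hx1 n
    _ = Real.exp (-n) := by rw [← Real.exp_nat_mul]; congr 1; ring
    _ ≤ Real.exp (-(q * Real.log r)) := Real.exp_le_exp.2 (by linarith)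
    _ = 1 / r ^ q := by
      rw [Real.exp_neg, Real.exp_nat_mul, Real.exp_log hr0, one_div]

section
variable {d : ℕ} [NeZero d]

/-- An Euler solution restricted to a compact time interval satisfies all the hypotheses of the
transport estimates. -/
theorem IsEulerSolution.exists_controlledFlow (hd : 3 ≤ d) {s : ℝ} (hs : 1 + (d : ℝ) / 2 < s)
    {T : EReal} {u : ℝ → Space d → Space d} {p : ℝ → Space d → ℝ} {ur uz : ℝ → ℝ → ℝ → ℝ}
    (hu : IsEulerSolution s T u p)
    (hax : ∀ t ∈ lifespan T, IsAxisymNoSwirl (u t) (ur t) (uz t)) {t₁ : ℝ}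
    (ht₁ : t₁ ∈ lifespan T) (hpos : ∀ r z, 0 < r → 0 ≤ vorticity (ur 0) (uz 0) r z)
    (hcpt : HasCompactSupport (lift (d := d) (vorticity (ur 0) (uz 0)))) :
    ∃ L R, ControlledFlow hd t₁ L R u ur uz := by
  obtain ⟨L, hc⟩ := hu.exists_uniformControl hs ht₁
  obtain ⟨R, hR, H⟩ := hu.vorticity_nonneg_and_support hd hax ht₁ hc hpos hcpt
  have hsub := Icc_subset_lifespan ht₁
  refine ⟨2 * L, R, hu.planarFlow hd hax ht₁ hc, hR, fun t ht => ?_, hc.contDiff,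
    fun t ht => hax t (hsub ht), fun t ht y => hu.divergence_free t (hsub ht) y,
    fun t ht => hu.memLp (hsub ht), L, hc.bound⟩
  exact ⟨continuous_curl (contDiff_meridian (hc.contDiff t ht)),
    fun z => (hax t (hsub ht)).curl_meridian_axis (hc.contDiff t ht) z,
    fun y hy => (H t ht y hy).1, fun y hy => (H t ht y hy).2⟩

/-- The initial bound on `‖r ω₀‖_{L¹}` bounds the impulse. -/
theorem ControlledFlow.impulse_le {hd : 3 ≤ d} {t₁ L R : ℝ} {u : ℝ → Space d → Space d}
    {ur uz : ℝ → ℝ → ℝ → ℝ} (hF : ControlledFlow hd t₁ L R u ur uz) (ht₁ : 0 ≤ t₁) {M : ℝ}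
    (hM : eLpNorm (fun x : Space d => rad x * lift (vorticity (ur 0) (uz 0)) x) 1 volume ≤
      ENNReal.ofReal M) :
    impulse d (curl (meridian hd (u 0))) ≤ max M 0 / sphereArea d := by
  have m0 : (0 : ℝ) ∈ Icc 0 t₁ := ⟨le_rfl, ht₁⟩
  have hp := hF.profile 0 m0
  rw [le_div_iff₀' (sphereArea_pos hd), ← hp.integral_rad_mul hd]
  have e : (fun x : Space d => rad x * lift (vorticity (ur 0) (uz 0)) x) =
      fun x => curl (meridian hd (u 0)) (cyl x) * rad x := funext fun x => by
    rw [(hF.axisym 0 m0).lift_vorticity (hd := hd) (hF.contDiff 0 m0), mul_comm]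
  rw [e, eLpNorm_one_eq_lintegral_enorm] at hM
  have h1 := enorm_integral_le_lintegral_enorm (μ := volume)
    (fun x : Space d => curl (meridian hd (u 0)) (cyl x) * rad x)
  have h2 := h1.trans hM
  rw [← ofReal_norm] at h2
  have h3 : ENNReal.ofReal ‖∫ x : Space d, curl (meridian hd (u 0)) (cyl x) * rad x‖ ≤
      ENNReal.ofReal (max M 0) := h2.trans (ENNReal.ofReal_le_ofReal (le_max_left _ _))
  rw [ENNReal.ofReal_le_ofReal_iff (le_max_right _ _)] at h3
  exact (Real.le_norm_self _).trans h3

end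

end AxisymEuler
end

theorem mainTheorem2 (d : ℕ) [NeZero d] (hd : 3 ≤ d) (q : ℕ) (hq : d ≤ q) (M K S : ℝ) :
    ∃ C : ℝ, 0 < C ∧
      ∀ (s : ℝ) (T : EReal) (u : ℝ → AxisymEuler.Space d → AxisymEuler.Space d)
        (p : ℝ → AxisymEuler.Space d → ℝ) (ur uz : ℝ → ℝ → ℝ → ℝ) (ω : ℝ → ℝ → ℝ → ℝ),
        1 + (d : ℝ) / 2 < s →
        0 < T →
        AxisymEuler.IsEulerSolution s T u p →
        (∀ t ∈ AxisymEuler.lifespan T, AxisymEuler.IsAxisymNoSwirl (u t) (ur t) (uz t)) →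
        (∀ t, ω t = AxisymEuler.vorticity (ur t) (uz t)) →
        -- the initial vorticity is nonnegative and compactly supported in `ℝ^d`
        (∀ r z, 0 < r → 0 ≤ ω 0 r z) →
        HasCompactSupport (AxisymEuler.lift (d := d) (ω 0)) →
        -- its size is controlled by `M`, `K`, `S`
        eLpNorm (fun x : AxisymEuler.Space d => AxisymEuler.rad x * AxisymEuler.lift (ω 0) x)
          1 volume ≤ ENNReal.ofReal M →
        eLpNorm (fun x : AxisymEuler.Space d =>
          AxisymEuler.lift (ω 0) x / AxisymEuler.rad x ^ (d - 2)) ∞ volume ≤ ENNReal.ofReal K →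
        (∀ r z, 0 < r → ω 0 r z ≠ 0 → r ≤ S) →
        ∀ t ∈ AxisymEuler.lifespan T, ∀ r : ℝ,
          C * ((1 + t) * Real.log (Real.exp 1 + t)) ^ (1 / ((d : ℝ) + 1)) ≤ r →
          IntegrableOn (fun y : ℝ × ℝ => ω t y.1 y.2) (AxisymEuler.outer r) ∧
            AxisymEuler.mass (ω t) r ≤ 1 / r ^ q := by
  obtain ⟨C, hC, H⟩ := AxisymEuler.exists_tail_le (d := d) hd
  have hσ := AxisymEuler.sphereArea_pos hd
  -- `J ≥ 1` bounds the impulse, and `D` is the constant required by `pow_ceil_le`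
  set J : ℝ := max M 0 / AxisymEuler.sphereArea d + 1 with hJ
  have hJ1 : 1 ≤ J := le_add_of_nonneg_left (by positivity)
  set D : ℝ := Real.exp 1 * (C * J) * (q + 1) + 1 with hD
  have hD1 : 1 ≤ D := le_add_of_nonneg_left (by positivity)
  set C₀ : ℝ := 16 * D ^ 2 + Real.exp 1 + 2 * J + (2 * |S| + 1) with hC₀
  have hS0 := abs_nonneg S
  have he := Real.exp_pos 1
  have hD2 : 1 ≤ D ^ 2 := one_le_pow₀ hD1
  have hC₀1 : 1 ≤ C₀ := by linarith
  refine ⟨C₀, by linarith, ?_⟩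
  intro s T u p ur uz ω hs _ hu hax hω hpos hcpt hM _ hS t ht r hr
  have ht0 : 0 ≤ t := ht.1
  rw [hω 0] at hpos hcpt hM hS
  obtain ⟨L, R, hF⟩ := hu.exists_controlledFlow hd hs hax ht hpos hcpt
  have m0 : (0 : ℝ) ∈ Icc 0 t := ⟨le_rfl, ht0⟩
  have mt : t ∈ Icc 0 t := ⟨ht0, le_rfl⟩
  have hlog : 1 ≤ Real.log (Real.exp 1 + t) := by
    rw [Real.le_log_iff_exp_le (by positivity)]
    linarith
  set Y : ℝ := (1 + t) * Real.log (Real.exp 1 + t) with hY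
  have hY1 : 1 ≤ Y := by nlinarith
  have hrC : C₀ ≤ r := by
    refine le_trans (le_mul_of_one_le_right (by linarith) ?_) hr
    exact Real.one_le_rpow hY1 (by positivity)
  have hr0 : 0 < r := by linarith
  have hrpow : 16 * D ^ 2 * Y ≤ r ^ (d + 1) := by
    have h1 : (C₀ * Y ^ (1 / ((d : ℝ) + 1))) ^ (d + 1) ≤ r ^ (d + 1) :=
      pow_le_pow_left₀ (by positivity) hr _
    rw [mul_pow, ← Real.rpow_natCast (Y ^ (1 / ((d : ℝ) + 1))), ← Real.rpow_mul (by linarith),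
      show 1 / ((d : ℝ) + 1) * ((d + 1 : ℕ) : ℝ) = 1 by push_cast; field_simp, Real.rpow_one] at h1
    refine le_trans (mul_le_mul_of_nonneg_right ?_ (by linarith)) h1
    exact le_trans (by linarith) (le_self_pow₀ hC₀1 (by omega))
  have htail : ∀ y ∈ AxisymEuler.outer r, ω t y.1 y.2 =
      AxisymEuler.curl (AxisymEuler.meridian hd (u t)) y := fun y hy => by
    rw [hω, (hF.axisym t mt).curl_meridian (hF.contDiff t mt) (hr0.trans_le hy.2)]
  have hmeas := AxisymEuler.measurableSet_outer r
  refine ⟨((hF.profile t mt).integrableOn_outer hr0).congr_fun (fun y hy => (htail y hy).symm) hmeas,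
    ?_⟩
  have hmass : AxisymEuler.mass (ω t) r =
      AxisymEuler.tail (AxisymEuler.curl (AxisymEuler.meridian hd (u t))) r :=
    setIntegral_congr_fun hmeas htail
  rw [hmass]
  set I := AxisymEuler.impulse d (AxisymEuler.curl (AxisymEuler.meridian hd (u 0))) with hI
  have hI0 : 0 ≤ I := (hF.profile 0 m0).impulse_nonneg
  have hIJ : I ≤ J := (hF.impulse_le ht0 hM).trans (by rw [hJ]; linarith)
  have hinit : ∀ y : ℝ × ℝ, r / 2 ≤ y.1 →
      AxisymEuler.curl (AxisymEuler.meridian hd (u 0)) y = 0 := fun y hy => by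
    have hy0 : 0 < y.1 := by linarith
    rw [(hF.axisym 0 m0).curl_meridian (hF.contDiff 0 m0) hy0]
    by_contra hne
    have h1 := hS y.1 y.2 hy0 hne
    have h2 := le_abs_self S
    linarith
  obtain ⟨hn, hpow⟩ := AxisymEuler.pow_ceil_le (q := q) (C := C * J) (r := r) (t := t)
    (m := d + 1) (by omega) (by positivity) ht0 (by linarith) rfl (by
      have h1 := AxisymEuler.mul_log_le hD1 ht0 hrpow
      have h2 : Real.log r ≤ Real.log (r ^ (d + 1)) :=
        Real.log_le_log hr0 (le_self_pow₀ (by linarith) (by omega))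
      have h3 : 0 ≤ Real.log r := Real.log_nonneg (by linarith)
      refine le_trans ?_ h1
      have h4 : Real.exp 1 * (C * J) * (q + 1) ≤ D := by rw [hD]; linarith
      gcongr)
  refine (H t L R u ur uz hF r _ hr0 hn hinit t mt).trans ?_
  refine le_trans ?_ hpow
  have h1 : I / (r / 2) ^ (d - 1) ≤ 1 := by
    rw [div_le_one (by positivity)]
    have h2 : 1 ≤ r / 2 := by linarith
    have h3 : r / 2 ≤ (r / 2) ^ (d - 1) := le_self_pow₀ h2 (by omega)
    linarith
  refine (mul_le_of_le_one_left (by positivity) h1).trans ?_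
  gcongr
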